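/- All graphs are finite and simple. A *block* is a (nonempty) connected graph without a cutvertex, that is, an isolated vertex, a single edge with its two ends, or a $2$-connected graph. A graph is *$K_{2,4}$-minor-free* if it has no minor isomorphic to $K_{2,4}$. A graph is *$3$-connected* if it has at least four vertices and remains connected whenever at most two vertices are deleted. A graph is *outerplanar* if it has an embedding in the plane with every vertex on the outer face. For vertices $x,y$ of a graph $H$, $H$ is *$xy$-outerplanar* if it has an embedding in a closed disk such that some Hamilton path of $H$ from $x$ to $y$ is contained in the boundary of the disk. A set $F$ of edges of a $K_{2,4}$-minor-free graph is *subdividable* if the graph obtained by replacing every edge of $F$ by a path of length $2$ is $K_{2,4}$-minor-free. **Theorem.** Let $G$ be a block. Then $G$ is $K_{2,4}$-minor-free if and only if one of the following holds. (i) $G$ is outerplanar. (ii) There are vertices $x,y$ of $G$ such that $G$ is the union of three $xy$-outerplanar graphs $H_1,H_2,H_3$ and possibly the edge $xy$, where $|V(H_i)|\ge 3$ for each $i$ and $V(H_i)\cap V(H_j)=\{x,y\}$ for $i\ne j$. (iii) $G$ is obtained from a $3$-connected $K_{2,4}$-minor-free graph $G_0$ by replacing each edge $x_iy_i$ in a (possibly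 empty) subdividable set of edges $\{x_1y_1,x_2y_2,\ldots,x_ky_k\}$ of $G_0$ by an $x_iy_i$-outerplanar graph $H_i$, where $V(H_i)\cap V(G_0)=\{x_i,y_i\}$ for each $i$, and $V(H_i)\cap V(H_j)\subseteq V(G_0)$ for $i\ne j$. -/

import Mathlib

namespace SimpleGraph

/-- A model of `H` as a minor of `G`: pairwise disjoint branch sets `B w`, one for each vertex `w`
of `H`, each inducing a connected (in particular nonempty) subgraph of `G`, such that adjacent
vertices of `H` have branch sets joined by an edge of `G`. -/
def HasMinor {V W : Type*} (G : SimpleGraph V) (H : SimpleGraph W) : Prop :=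
  ∃ B : W → Set V,
    (∀ w, (G.induce (B w)).Connected) ∧
    (∀ w w', w ≠ w' → Disjoint (B w) (B w')) ∧
    (∀ w w', H.Adj w w' → ∃ a ∈ B w, ∃ b ∈ B w', G.Adj a b)

/-- `G` has no minor isomorphic to the complete bipartite graph `K_{2,4}`. -/
def IsK24MinorFree {V : Type*} (G : SimpleGraph V) : Prop :=
  ¬ G.HasMinor (completeBipartiteGraph (Fin 2) (Fin 4))

/-- A block: a connected graph without a cutvertex.  (In a connected graph, a cutvertex is a vertex
whose deletion leaves two vertices that are not joined by a walk.) -/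
def IsBlock {V : Type*} (G : SimpleGraph V) : Prop :=
  G.Connected ∧ ∀ v : V, (G.induce {v}ᶜ).Preconnected

/-- `k`-connectedness: more than `k` vertices, and no deletion of fewer than `k` vertices
disconnects the graph. -/
def IsVertexConnected {V : Type*} (k : ℕ) (G : SimpleGraph V) : Prop :=
  k < Nat.card V ∧ ∀ S : Finset V, S.card < k → (G.induce (S : Set V)ᶜ).Connected

/-- The graph formed from `G` by subdividing once every edge of `F`: each `e = uv ∈ F` is replaced
by a path `u, e, v` of length two through a new vertex `Sum.inr e`. -/
def subdivide {V : Type*} (G : SimpleGraph V) (F : Set (Sym2 V)) : SimpleGraph (V ⊕ F) where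
  Adj
    | .inl u, .inl v => G.Adj u v ∧ s(u, v) ∉ F
    | .inl u, .inr e => u ∈ (e : Sym2 V)
    | .inr e, .inl u => u ∈ (e : Sym2 V)
    | .inr _, .inr _ => False
  symm := ⟨by
    rintro (u | e) (v | f) h
    · exact ⟨h.1.symm, by rw [Sym2.eq_swap]; exact h.2⟩
    · exact h
    · exact h
    · exact h⟩
  loopless := ⟨by
    rintro (u | e) h
    · exact G.loopless.irrefl u h.1
    · exact h⟩

/-- A set `F` of edges of `G` is subdividable if subdividing all its members leaves a
`K_{2,4}`-minor-free graph. -/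
def IsSubdividable {V : Type*} (G : SimpleGraph V) (F : Set (Sym2 V)) : Prop :=
  F ⊆ G.edgeSet ∧ (G.subdivide F).IsK24MinorFree

/-- `A` is a simple arc in the plane `ℂ` with ends `a` and `b`. -/
def IsPlaneArc (A : Set ℂ) (a b : ℂ) : Prop :=
  ∃ γ : unitInterval → ℂ, Continuous γ ∧ Function.Injective γ ∧
    γ 0 = a ∧ γ 1 = b ∧ Set.range γ = A

/-- An embedding (drawing without crossings) of `G` in the plane `ℂ`: distinct vertices are
distinct points, an edge `uv` is a simple arc between the points of `u` and `v`, no arc passes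
through a vertex other than its two ends, and two distinct arcs meet only in points of common
ends. -/
structure PlaneEmbedding {V : Type*} (G : SimpleGraph V) where
  /-- the point representing a vertex -/
  pt : V → ℂ
  /-- the arc representing an edge -/
  arc : G.edgeSet → Set ℂ
  pt_injective : Function.Injective pt
  isPlaneArc : ∀ (u v : V) (h : G.Adj u v), IsPlaneArc (arc ⟨s(u, v), h⟩) (pt u) (pt v)
  mem_of_pt_mem : ∀ (w : V) (e : G.edgeSet), pt w ∈ arc e → w ∈ (e : Sym2 V)
  inter_subset : ∀ e f : G.edgeSet, e ≠ f →
    arc e ∩ arc f ⊆ pt '' {v | v ∈ (e : Sym2 V) ∧ v ∈ (f : Sym2 V)}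

/-- The point set of the drawing. -/
def PlaneEmbedding.carrier {V : Type*} {G : SimpleGraph V} (φ : G.PlaneEmbedding) : Set ℂ :=
  Set.range φ.pt ∪ ⋃ e, φ.arc e

/-- The outer face of a drawing: the unbounded connected component of its complement. -/
def PlaneEmbedding.IsOuterFace {V : Type*} {G : SimpleGraph V} (φ : G.PlaneEmbedding)
    (U : Set ℂ) : Prop :=
  (∃ z ∈ φ.carrierᶜ, U = connectedComponentIn φ.carrierᶜ z) ∧ ¬ Bornology.IsBounded U

/-- `G` is outerplanar: it has a plane embedding with every vertex on (the boundary of) the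
outer face. -/
def IsOuterplanar {V : Type*} (G : SimpleGraph V) : Prop :=
  ∃ (φ : G.PlaneEmbedding) (U : Set ℂ), φ.IsOuterFace U ∧ ∀ v, φ.pt v ∈ frontier U

/-- `G` is `xy`-outerplanar: it has an embedding in a closed disk (here the closed unit disk) such
that some Hamilton path of `G` from `x` to `y` is contained in the boundary of the disk. -/
def IsPathOuterplanar {V : Type*} (G : SimpleGraph V) (x y : V) : Prop :=
  ∃ (φ : G.PlaneEmbedding) (P : G.Walk x y),
    P.IsPath ∧ (∀ v, v ∈ P.support) ∧
    φ.carrier ⊆ Metric.closedBall 0 1 ∧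
    (∀ v, φ.pt v ∈ Metric.sphere (0 : ℂ) 1) ∧
    ∀ e : G.edgeSet, (e : Sym2 V) ∈ P.edges → φ.arc e ⊆ Metric.sphere 0 1

/-- The subgraph `H`, as a graph on its own vertex set, contains `x` and `y` and is
`xy`-outerplanar. -/
def Subgraph.IsPathOuterplanar {V : Type*} {G : SimpleGraph V} (H : G.Subgraph) (x y : V) : Prop :=
  ∃ (hx : x ∈ H.verts) (hy : y ∈ H.verts), H.coe.IsPathOuterplanar ⟨x, hx⟩ ⟨y, hy⟩

/-- `G` is the union of three `xy`-outerplanar graphs, each with at least three vertices and any two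
of them having exactly the vertices `x` and `y` in common, and possibly the edge `xy`. -/
def IsTriplePathOuterplanarUnion {V : Type*} (G : SimpleGraph V) : Prop :=
  ∃ (x y : V) (H : Fin 3 → G.Subgraph),
    (∀ i, (H i).IsPathOuterplanar x y) ∧
    (∀ i, 3 ≤ (H i).verts.ncard) ∧
    (∀ i j, i ≠ j → (H i).verts ∩ (H j).verts = {x, y}) ∧
    ((⨆ i, H i) = ⊤ ∨ ∃ h : G.Adj x y, (⨆ i, H i) ⊔ G.subgraphOfAdj h = ⊤)

/-- `G` is obtained from the graph `G₀` (with vertex set `W`, a subset of the vertices of `G`) by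
replacing each edge `xy` of the set `F` of edges of `G₀` by an `xy`-outerplanar graph `H`
that meets `W` in exactly `x` and `y`; the graphs replacing distinct edges meet only in `W`. -/
def IsPathOuterplanarReplacement {V : Type*} (G : SimpleGraph V) {W : Set V} (G₀ : SimpleGraph W)
    (F : Set (Sym2 W)) : Prop :=
  ∃ H : F → G.Subgraph,
    (∀ (x y : W) (h : s(x, y) ∈ F),
      (H ⟨s(x, y), h⟩).IsPathOuterplanar x y ∧
      (H ⟨s(x, y), h⟩).verts ∩ W = {(x : V), (y : V)}) ∧
    (∀ e f : F, e ≠ f → (H e).verts ∩ (H f).verts ⊆ W) ∧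
    W ∪ (⋃ e, (H e).verts) = Set.univ ∧
    G = (G₀.deleteEdges F).map (Function.Embedding.subtype (· ∈ W)) ⊔ ⨆ e, (H e).spanningCoe

end SimpleGraph

/-! Topology is traded for linear orders. Reading the vertices of an `xy`-outerplanar graph along
its Hamilton path gives an order from `x` to `y` in which no two edges cross; conversely, a
noncrossing order is realised by arcs and chords of the unit circle. That a drawing yields a
noncrossing order, and that an outerplanar graph has no `K_{2,3}` minor, follows from the
nonplanarity of `K₅` and `K₃,₃`, which is proved by a parity count of the changes of logarithms
along edges.

Sufficiency. A noncrossing order admits no two interleaved disjoint connected sets. Hence it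
excludes `K_{2,3}` minors, and `K_{2,2}` minors with one side rooted at the first and last vertex.
So an `xy`-outerplanar piece attached at `x` and `y` contains no hub of a `K_{2,4}` model and at
most one of the four other branch sets: it acts like a path of length two. By
`IsPieceDecomposition.exists_isK24Model` a model survives the replacement of all pieces by such
paths. In (ii) this leaves five vertices, too few; in (iii) it leaves the subdivision of `G₀`, which
has no such minor by hypothesis.

Necessity. Call a component of `G - {x, y}` a side. In a side without a rooted `K_{2,2}` a longest
path from `x` to `y` is Hamiltonian and has no crossing chords, so the side is `xy`-outerplanar
(`IsSide.isPathOuterplanar`). At any pair there are at most three disjoint sides. If there are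
three, none has a rooted `K_{2,2}`, for this and the other two sides would form `K_{2,4}`; this is
(ii). Of two sides at most one has a rooted `K_{2,2}` (`IsK24MinorFree.not_two_rooted`).

If no pair has three sides, take a smallest set `W` of at least two vertices such that every
component of `G - W` is attached at two vertices of `W` and has no rooted `K_{2,2}`. By minimality,
a side at two vertices of `W` that meets `W` has a rooted `K_{2,2}`. If `W` has two elements, `G` is
outerplanar; three are impossible (`IsSkeleton.not_three`). Otherwise `G₀` is the torso: `W` with an
edge for every component. A 2-cut of it would yield two rooted sides, so it is 3-connected, and
contracting components to subdividing vertices shows that the new edges are subdividable. -/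

/-! ### Changes of logarithms and the nonplanarity of `K₅` and `K₃,₃` -/

open Complex in
/-- Two continuous branches of the logarithm of the same function change by the same amount. -/
theorem log_change_unique {F G : ℝ → ℂ} (hF : Continuous F) (hG : Continuous G)
    (h : ∀ t, exp (F t) = exp (G t)) : F 1 - F 0 = G 1 - G 0 := by
  have := Complex.isCoveringMap_exp.const_of_comp (A := ℝ) (g := fun t => F t - G t)
    (hF.sub hG) (fun a a' => by simp [Complex.exp_sub, h]) 1 0
  linear_combination this

-- The parameter plane is simply connected, so the nowhere zero function `γ s - δ t` has a single
-- logarithm continuous in both variables.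
open Complex in
theorem exists_log_sub {γ δ : ℝ → ℂ} (hγ : Continuous γ) (hδ : Continuous δ)
    (h : ∀ s t, γ s ≠ δ t) :
    ∃ F : ℝ × ℝ → ℂ, Continuous F ∧ ∀ s t, exp (F (s, t)) = γ s - δ t := by
  obtain ⟨F, hF, hF'⟩ := Complex.exists_continuousOn_eqOn_exp_comp (X := ℝ × ℝ) (U := Set.univ)
    (by
      have := (convex_univ (𝕜 := ℝ) (E := ℝ × ℝ)).contractibleSpace Set.univ_nonempty
      exact (inferInstance : SimplyConnectedSpace (Set.univ : Set (ℝ × ℝ)))) isOpen_univ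
    (g := fun q => γ q.1 - δ q.2) (by fun_prop)
    (by
      rintro ⟨q, -, hq⟩
      exact h q.1 q.2 (sub_eq_zero.1 hq))
  exact ⟨F, continuousOn_univ.1 hF, fun s t => hF' (Set.mem_univ (s, t))⟩

/-- The change of a continuous branch of `log (γ - c)` along a path `γ`. -/
noncomputable def logChange {a b : ℂ} (γ : Path a b) (c : ℂ) : ℂ :=
  open Classical in
  if h : ∃ F : ℝ → ℂ, Continuous F ∧ ∀ t, Complex.exp (F t) = γ.extend t - c
  then h.choose 1 - h.choose 0 else 0

theorem logChange_eq {a b : ℂ} (γ : Path a b) {c : ℂ} {F : ℝ → ℂ} (hF : Continuous F)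
    (h : ∀ t, Complex.exp (F t) = γ.extend t - c) : logChange γ c = F 1 - F 0 := by
  have hex : ∃ F : ℝ → ℂ, Continuous F ∧ ∀ t, Complex.exp (F t) = γ.extend t - c := ⟨F, hF, h⟩
  rw [logChange, dif_pos hex]
  exact log_change_unique hex.choose_spec.1 hF fun t => by rw [hex.choose_spec.2, h]

theorem exp_logChange {a b : ℂ} (γ : Path a b) {c : ℂ} (hc : c ∉ Set.range γ) :
    Complex.exp (logChange γ c) = (b - c) / (a - c) := by
  obtain ⟨F, hF, hF'⟩ := exists_log_sub (γ := γ.extend) (δ := fun _ => c) γ.continuous_extend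
    continuous_const (fun s t h => hc (by rw [← γ.extend_range]; exact ⟨s, h⟩))
  rw [logChange_eq γ (F := fun t => F (t, 0)) (by fun_prop) (fun t => hF' t 0), Complex.exp_sub,
    hF', hF']
  simp

/-- Both sides equal the alternating sum, over the four corners of the parameter square, of one
logarithm of `γ s - δ t`. Adding `πi` turns it into a logarithm of `δ t - γ s`. -/
theorem logChange_sub {a b c d : ℂ} (γ : Path a b) (δ : Path c d)
    (h : Disjoint (Set.range γ) (Set.range δ)) :
    logChange γ c - logChange γ d = logChange δ a - logChange δ b := by
  have hne : ∀ s t, γ.extend s ≠ δ.extend t := fun s t h' => by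
    rw [← γ.extend_range, ← δ.extend_range] at h
    exact Set.disjoint_left.1 h ⟨s, rfl⟩ ⟨t, h'.symm⟩
  obtain ⟨F, hF, hF'⟩ := exists_log_sub γ.continuous_extend δ.continuous_extend hne
  have hπ : ∀ z : ℂ, Complex.exp (z + Real.pi * Complex.I) = - Complex.exp z := fun z => by
    rw [Complex.exp_add, Complex.exp_pi_mul_I]; ring
  rw [logChange_eq γ (F := fun s => F (s, 0)) (by fun_prop) (by simp [hF']),
    logChange_eq γ (F := fun s => F (s, 1)) (by fun_prop) (by simp [hF']),
    logChange_eq δ (F := fun t => F (0, t) + Real.pi * Complex.I) (by fun_prop)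
      (by simp [hF', hπ]),
    logChange_eq δ (F := fun t => F (1, t) + Real.pi * Complex.I) (by fun_prop)
      (by simp [hF', hπ])]
  ring

/-- Integral winding data for a drawing: for edges `ab` and `cd` drawn without crossing, the
winding numbers of the edges around the ends of the other edge satisfy a parity relation. -/
theorem exists_winding {m : ℕ} {p : Fin m → ℂ} (hp : Function.Injective p)
    (γ : ∀ i j, Path (p i) (p j)) :
    ∃ n : Fin m → Fin m → Fin m → ℤ, ∀ a b c d : Fin m, 
      Disjoint (Set.range (γ a b)) (Set.range (γ c d)) →
      2 * (n a b c - n a b d - n c d a + n c d b) =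
        (if b < c then 1 else -1) - (if a < c then 1 else -1)
          - (if b < d then 1 else -1) + (if a < d then 1 else -1) := by
  -- A logarithm of `p u - p v`, with branches chosen so that exchanging `u` and `v` changes it by
  -- exactly `πi` or `-πi` according to their order. These signs make up the right side of the
  -- relation.
  let α : Fin m → Fin m → ℂ := fun u v =>
    if u < v then Complex.log (p u - p v) else Complex.log (p v - p u) + Real.pi * Complex.I
  have hα : ∀ u v, u ≠ v → Complex.exp (α u v) = p u - p v := by
    intro u v huv
    have h1 : p u - p v ≠ 0 := sub_ne_zero.2 (hp.ne huv)
    have h2 : p v - p u ≠ 0 := sub_ne_zero.2 (hp.ne huv.symm)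
    by_cases h : u < v
    · simp only [α, if_pos h]; rw [Complex.exp_log h1]
    · simp only [α, if_neg h]
      rw [Complex.exp_add, Complex.exp_pi_mul_I, Complex.exp_log h2]; ring
  have hε : ∀ u v, u ≠ v → α v u - α u v = (if u < v then (1 : ℤ) else -1 : ℤ) *
      (Real.pi * Complex.I) := by
    intro u v huv
    rcases lt_or_gt_of_ne huv with h | h
    · simp [α, h, h.not_gt]
    · simp [α, h, h.not_gt]
  have key : ∀ i j v, ∃ n : ℤ, p v ∉ Set.range (γ i j) →
      logChange (γ i j) (p v) = α j v - α i v + n * (2 * Real.pi * Complex.I) := by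
    intro i j v
    by_cases h : p v ∈ Set.range (γ i j)
    · exact ⟨0, fun h' => absurd h h'⟩
    · have hj : j ≠ v := by rintro rfl; exact h ⟨1, by simp⟩
      have hi : i ≠ v := by rintro rfl; exact h ⟨0, by simp⟩
      obtain ⟨n, hn⟩ := Complex.exp_eq_exp_iff_exists_int.1
        ((exp_logChange (γ i j) h).trans (by rw [Complex.exp_sub, hα j v hj, hα i v hi] :
          _ = Complex.exp (α j v - α i v)))
      exact ⟨n, fun _ => hn⟩
  choose n hn using key
  refine ⟨n, fun a b c d hd => ?_⟩
  have ha : p a ∈ Set.range (γ a b) := ⟨0, by simp⟩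
  have hb : p b ∈ Set.range (γ a b) := ⟨1, by simp⟩
  have hc : p c ∈ Set.range (γ c d) := ⟨0, by simp⟩
  have hd' : p d ∈ Set.range (γ c d) := ⟨1, by simp⟩
  have hac : a ≠ c := by rintro rfl; exact Set.disjoint_left.1 hd ha hc
  have had : a ≠ d := by rintro rfl; exact Set.disjoint_left.1 hd ha hd'
  have hbc : b ≠ c := by rintro rfl; exact Set.disjoint_left.1 hd hb hc
  have hbd : b ≠ d := by rintro rfl; exact Set.disjoint_left.1 hd hb hd'
  have h := logChange_sub (γ a b) (γ c d) hd
  rw [hn a b c (Set.disjoint_right.1 hd hc), hn a b d (Set.disjoint_right.1 hd hd'),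
    hn c d a (Set.disjoint_left.1 hd ha), hn c d b (Set.disjoint_left.1 hd hb)] at h
  have hpi : (Real.pi : ℂ) * Complex.I ≠ 0 := by
    simp [Complex.ofReal_eq_zero, Real.pi_ne_zero, Complex.I_ne_zero]
  have h1 := hε a c hac
  have h2 := hε a d had
  have h3 := hε b c hbc
  have h4 := hε b d hbd
  set e1 : ℤ := if a < c then 1 else -1
  set e2 : ℤ := if a < d then 1 else -1
  set e3 : ℤ := if b < c then 1 else -1
  set e4 : ℤ := if b < d then 1 else -1
  have : ((2 * (n a b c - n a b d - n c d a + n c d b) : ℤ) : ℂ) * (Real.pi * Complex.I) =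
      ((e3 - e1 - e4 + e2 : ℤ) : ℂ) * (Real.pi * Complex.I) := by
    push_cast
    linear_combination h + h3 - h1 - h4 + h2
  exact_mod_cast mul_right_cancel₀ hpi this

/-- In a drawing of `K₅`, two independent edges meet. -/
theorem not_drawing_K5 {p : Fin 5 → ℂ} (hp : Function.Injective p)
    (S : Fin 5 → Fin 5 → Set ℂ)
    (j01 : JoinedIn (S 0 1) (p 0) (p 1))
    (j02 : JoinedIn (S 0 2) (p 0) (p 2))
    (j03 : JoinedIn (S 0 3) (p 0) (p 3))
    (j04 : JoinedIn (S 0 4) (p 0) (p 4))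
    (j12 : JoinedIn (S 1 2) (p 1) (p 2))
    (j13 : JoinedIn (S 1 3) (p 1) (p 3))
    (j14 : JoinedIn (S 1 4) (p 1) (p 4))
    (j23 : JoinedIn (S 2 3) (p 2) (p 3))
    (j24 : JoinedIn (S 2 4) (p 2) (p 4))
    (j34 : JoinedIn (S 3 4) (p 3) (p 4))
    (d0123 : Disjoint (S 0 1) (S 2 3))
    (d0124 : Disjoint (S 0 1) (S 2 4))
    (d0134 : Disjoint (S 0 1) (S 3 4))
    (d0213 : Disjoint (S 0 2) (S 1 3))
    (d0214 : Disjoint (S 0 2) (S 1 4))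
    (d0234 : Disjoint (S 0 2) (S 3 4))
    (d0312 : Disjoint (S 0 3) (S 1 2))
    (d0314 : Disjoint (S 0 3) (S 1 4))
    (d0324 : Disjoint (S 0 3) (S 2 4))
    (d0412 : Disjoint (S 0 4) (S 1 2))
    (d0413 : Disjoint (S 0 4) (S 1 3))
    (d0423 : Disjoint (S 0 4) (S 2 3))
    (d1234 : Disjoint (S 1 2) (S 3 4))
    (d1324 : Disjoint (S 1 3) (S 2 4))
    (d1423 : Disjoint (S 1 4) (S 2 3)) : False := by
  have hS : ∀ i j, i < j → JoinedIn (S i j) (p i) (p j) := by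
    intro i j
    fin_cases i <;> fin_cases j <;>
      first | (intro h; exact absurd h (by decide)) | (intro; assumption)
  have hex : ∀ i j : Fin 5, ∃ γ : Path (p i) (p j), i < j → Set.range γ ⊆ S i j := by
    intro i j
    by_cases h : i < j
    · obtain ⟨γ, hγ⟩ := hS i j h
      exact ⟨γ, fun _ => by rintro _ ⟨t, rfl⟩; exact hγ t⟩
    · exact ⟨PathConnectedSpace.somePath _ _, fun h' => absurd h' h⟩
  choose γ hγ using hex
  obtain ⟨n, hn⟩ := exists_winding hp γ
  have e1 := hn 0 1 2 3 (d0123.mono (hγ _ _ (by decide)) (hγ _ _ (by decide)))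
  have e2 := hn 0 1 2 4 (d0124.mono (hγ _ _ (by decide)) (hγ _ _ (by decide)))
  have e3 := hn 0 1 3 4 (d0134.mono (hγ _ _ (by decide)) (hγ _ _ (by decide)))
  have e4 := hn 0 2 1 3 (d0213.mono (hγ _ _ (by decide)) (hγ _ _ (by decide)))
  have e5 := hn 0 2 1 4 (d0214.mono (hγ _ _ (by decide)) (hγ _ _ (by decide)))
  have e6 := hn 0 2 3 4 (d0234.mono (hγ _ _ (by decide)) (hγ _ _ (by decide)))
  have e7 := hn 0 3 1 2 (d0312.mono (hγ _ _ (by decide)) (hγ _ _ (by decide)))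
  have e8 := hn 0 3 1 4 (d0314.mono (hγ _ _ (by decide)) (hγ _ _ (by decide)))
  have e9 := hn 0 3 2 4 (d0324.mono (hγ _ _ (by decide)) (hγ _ _ (by decide)))
  have e10 := hn 0 4 1 2 (d0412.mono (hγ _ _ (by decide)) (hγ _ _ (by decide)))
  have e11 := hn 0 4 1 3 (d0413.mono (hγ _ _ (by decide)) (hγ _ _ (by decide)))
  have e12 := hn 0 4 2 3 (d0423.mono (hγ _ _ (by decide)) (hγ _ _ (by decide)))
  have e13 := hn 1 2 3 4 (d1234.mono (hγ _ _ (by decide)) (hγ _ _ (by decide)))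
  have e14 := hn 1 3 2 4 (d1324.mono (hγ _ _ (by decide)) (hγ _ _ (by decide)))
  have e15 := hn 1 4 2 3 (d1423.mono (hγ _ _ (by decide)) (hγ _ _ (by decide)))
  simp [Fin.lt_def] at e1 e2 e3 e4 e5 e6 e7 e8 e9 e10 e11 e12 e13 e14 e15
  -- After halving, the right side is odd exactly for the pairs of edges that interleave in the
  -- order of the vertices. There are five such pairs among the fifteen, while each unknown `n i j
  -- v` occurs in exactly two equations: the sum is contradictory modulo 2.
  omega

/-- `not_drawing_K5` with the points and the sets listed. -/
theorem not_drawing_K5_of_list {p0 p1 p2 p3 p4 : ℂ}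
    (n01 : p0 ≠ p1)
    (n02 : p0 ≠ p2)
    (n03 : p0 ≠ p3)
    (n04 : p0 ≠ p4)
    (n12 : p1 ≠ p2)
    (n13 : p1 ≠ p3)
    (n14 : p1 ≠ p4)
    (n23 : p2 ≠ p3)
    (n24 : p2 ≠ p4)
    (n34 : p3 ≠ p4)
    {S01 S02 S03 S04 S12 S13 S14 S23 S24 S34 : Set ℂ}
    (j01 : JoinedIn S01 p0 p1)
    (j02 : JoinedIn S02 p0 p2)
    (j03 : JoinedIn S03 p0 p3)
    (j04 : JoinedIn S04 p0 p4)
    (j12 : JoinedIn S12 p1 p2)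
    (j13 : JoinedIn S13 p1 p3)
    (j14 : JoinedIn S14 p1 p4)
    (j23 : JoinedIn S23 p2 p3)
    (j24 : JoinedIn S24 p2 p4)
    (j34 : JoinedIn S34 p3 p4)
    (d0123 : Disjoint S01 S23)
    (d0124 : Disjoint S01 S24)
    (d0134 : Disjoint S01 S34)
    (d0213 : Disjoint S02 S13)
    (d0214 : Disjoint S02 S14)
    (d0234 : Disjoint S02 S34)
    (d0312 : Disjoint S03 S12)
    (d0314 : Disjoint S03 S14)
    (d0324 : Disjoint S03 S24)
    (d0412 : Disjoint S04 S12)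
    (d0413 : Disjoint S04 S13)
    (d0423 : Disjoint S04 S23)
    (d1234 : Disjoint S12 S34)
    (d1324 : Disjoint S13 S24)
    (d1423 : Disjoint S14 S23)  : False := by
  have hp : Function.Injective ![p0, p1, p2, p3, p4] := by
    intro u v huv
    fin_cases u <;> fin_cases v <;>
      first | rfl | exact absurd huv (by assumption) | exact absurd huv.symm (by assumption)
  exact not_drawing_K5 hp
    ![![∅, S01, S02, S03, S04], ![∅, ∅, S12, S13, S14], ![∅, ∅, ∅, S23, S24], ![∅, ∅, ∅, ∅, S34],
      ![∅, ∅, ∅, ∅, ∅]]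
    j01 j02 j03 j04 j12 j13 j14 j23 j24 j34
    d0123 d0124 d0134 d0213 d0214 d0234 d0312 d0314 d0324 d0412 d0413 d0423 d1234 d1324 d1423

/-- In a drawing of `K₃,₃`, two independent edges meet. -/
theorem not_drawing_K33 (a b : Fin 3 → ℂ) (S : Fin 3 → Fin 3 → Set ℂ)
    (hS : ∀ i j, JoinedIn (S i j) (a i) (b j))
    (hdis : ∀ i j k l, i < k → j ≠ l → Disjoint (S i j) (S k l))
    (hab : ∀ i j, a i ≠ b j) : False := by
  have ha : ∀ i k, i < k → a i ≠ a k := fun i k h h' =>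
    Set.disjoint_left.1 (hdis i 0 k 1 h (by decide)) (hS i 0).source_mem
      (h' ▸ (hS k 1).source_mem)
  have hb : ∀ j l, j ≠ l → b j ≠ b l := fun j l h h' =>
    Set.disjoint_left.1 (hdis 0 j 1 l (by decide) h) (hS 0 j).target_mem
      (h' ▸ (hS 1 l).target_mem)
  let p : Fin 6 → ℂ := ![a 0, a 1, a 2, b 0, b 1, b 2]
  have hp : Function.Injective p := by
    have h1 := ha 0 1 (by decide)
    have h2 := ha 0 2 (by decide)
    have h3 := ha 1 2 (by decide)
    have h4 := hb 0 1 (by decide)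
    have h5 := hb 0 2 (by decide)
    have h6 := hb 1 2 (by decide)
    intro u v huv
    fin_cases u <;> fin_cases v <;> first | rfl | (exfalso; simp [p] at huv; grind)
  let A : Fin 3 → Fin 6 := ![0, 1, 2]
  let B : Fin 3 → Fin 6 := ![3, 4, 5]
  have hA : ∀ i, p (A i) = a i := by intro i; fin_cases i <;> rfl
  have hB : ∀ i, p (B i) = b i := by intro i; fin_cases i <;> rfl
  have hex : ∀ i j : Fin 6, ∃ γ : Path (p i) (p j), ∀ k l, i = A k → j = B l →
      Set.range γ ⊆ S k l := by
    intro i j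
    by_cases h : ∃ k l, i = A k ∧ j = B l
    · obtain ⟨k, l, rfl, rfl⟩ := h
      obtain ⟨γ, hγ⟩ := hS k l
      refine ⟨γ.cast (hA k) (hB l), fun k' l' hk hl => ?_⟩
      have : k = k' := by clear hγ γ; revert k k'; decide
      have : l = l' := by clear hγ γ; revert l l'; decide
      subst_vars
      rintro _ ⟨t, rfl⟩
      exact hγ t
    · exact ⟨PathConnectedSpace.somePath _ _, fun k l hk hl => absurd ⟨k, l, hk, hl⟩ h⟩
  choose γ hγ using hex
  obtain ⟨n, hn⟩ := exists_winding hp γ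
  have H : ∀ i j k l, i < k ∧ j ≠ l → _ := fun i j k l h =>
    hn (A i) (B j) (A k) (B l) ((hdis i j k l h.1 h.2).mono (hγ _ _ i j rfl rfl)
      (hγ _ _ k l rfl rfl))
  have e1 := H 0 0 1 1 (by decide)
  have e2 := H 0 0 1 2 (by decide)
  have e3 := H 0 1 1 0 (by decide)
  have e4 := H 0 1 1 2 (by decide)
  have e5 := H 0 2 1 0 (by decide)
  have e6 := H 0 2 1 1 (by decide)
  have f1 := H 0 0 2 1 (by decide)
  have f2 := H 0 0 2 2 (by decide)
  have f3 := H 0 1 2 0 (by decide)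
  have f4 := H 0 1 2 2 (by decide)
  have f5 := H 0 2 2 0 (by decide)
  have f6 := H 0 2 2 1 (by decide)
  have g1 := H 1 0 2 1 (by decide)
  have g2 := H 1 0 2 2 (by decide)
  have g3 := H 1 1 2 0 (by decide)
  have g4 := H 1 1 2 2 (by decide)
  have g5 := H 1 2 2 0 (by decide)
  have g6 := H 1 2 2 1 (by decide)
  simp [Fin.lt_def, A, B] at e1 e2 e3 e4 e5 e6 f1 f2 f3 f4 f5 f6 g1 g2 g3 g4 g5 g6
  -- The same parity count: nine of the eighteen pairs interleave, and each unknown occurs twice.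
  omega

/-! ### Connected vertex sets as an induction principle -/

namespace SimpleGraph

variable {V : Type*} {G : SimpleGraph V}

/-- `S` is nonempty and induces a connected subgraph of `G`: a property of vertices that is passed
on along the edges inside `S` and holds somewhere on `S` holds on all of `S`. -/
def IsConn (G : SimpleGraph V) (S : Set V) : Prop :=
  S.Nonempty ∧ ∀ Q : V → Prop, (∀ u ∈ S, ∀ v ∈ S, G.Adj u v → Q u → Q v) →
    ∀ u ∈ S, ∀ v ∈ S, Q u → Q v

theorem connected_induce_iff_isConn {S : Set V} : (G.induce S).Connected ↔ G.IsConn S := by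
  constructor
  · intro h
    refine ⟨Set.nonempty_coe_sort.1 h.nonempty, fun Q hQ u hu v hv hQu => ?_⟩
    obtain ⟨p⟩ := h.preconnected ⟨u, hu⟩ ⟨v, hv⟩
    suffices H : ∀ a b : S, (G.induce S).Walk a b → Q a → Q b from H _ _ p hQu
    intro a b p
    induction p with
    | nil => exact id
    | cons h _ ih => exact fun ha => ih (hQ _ (Subtype.prop _) _ (Subtype.prop _) h ha)
  · rintro ⟨⟨a, ha⟩, h⟩
    have := (⟨⟨a, ha⟩⟩ : Nonempty S)
    refine ⟨fun ⟨u, hu⟩ ⟨v, hv⟩ => ?_⟩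
    obtain ⟨_, h'⟩ := h (fun w => ∃ hw : w ∈ S, (G.induce S).Reachable ⟨u, hu⟩ ⟨w, hw⟩)
      (fun w hw z hz hwz ⟨_, hr⟩ => ⟨hz, hr.trans (Adj.reachable (by exact hwz))⟩) u hu v hv
      ⟨hu, .refl _⟩
    exact h'

/-- The induction principle in contrapositive form, which produces an edge leaving a part of a
connected set. -/
theorem IsConn.exists_adj {S : Set V} (h : G.IsConn S) {Q : V → Prop} {a b : V} (ha : a ∈ S)
    (hb : b ∈ S) (hQa : Q a) (hQb : ¬ Q b) : ∃ u ∈ S, ∃ v ∈ S, G.Adj u v ∧ Q u ∧ ¬ Q v := by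
  by_contra! hcon
  exact hQb (h.2 Q hcon a ha b hb hQa)

theorem isConn_singleton (a : V) : G.IsConn {a} :=
  ⟨Set.singleton_nonempty a, by
    rintro Q - u hu v hv h
    rw [Set.mem_singleton_iff] at hu hv
    rwa [hv, ← hu]⟩

theorem IsConn.union {S T : Set V} (hS : G.IsConn S) (hT : G.IsConn T) {a b : V} (ha : a ∈ S)
    (hb : b ∈ T) (hab : G.Adj a b) : G.IsConn (S ∪ T) := by
  refine ⟨hS.1.mono Set.subset_union_left, fun Q hQ => ?_⟩
  have h1 := hS.2 Q (fun u hu v hv => hQ u (.inl hu) v (.inl hv))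
  have h2 := hT.2 Q (fun u hu v hv => hQ u (.inr hu) v (.inr hv))
  have h3 := hQ a (.inl ha) b (.inr hb) hab
  have h4 := hQ b (.inr hb) a (.inl ha) hab.symm
  rintro u (hu | hu) v (hv | hv) h
  · exact h1 u hu v hv h
  · exact h2 b hb v hv (h3 (h1 u hu a ha h))
  · exact h1 a ha v hv (h4 (h2 u hu b hb h))
  · exact h2 u hu v hv h

/-- In the order given by `f` no two edges of `G` cross. -/
def IsNoncrossing (G : SimpleGraph V) (f : V → ℕ) : Prop :=
  ∀ a b c d, f a < f b → f b < f c → f c < f d → G.Adj a c → ¬ G.Adj b d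

end SimpleGraph

/-! ### Arcs, the exterior of the disk, and parts of drawings -/

theorem IsPlaneArc.joinedIn {A : Set ℂ} {a b : ℂ} (h : SimpleGraph.IsPlaneArc A a b) :
    JoinedIn A a b := by
  obtain ⟨γ, hγ, -, h0, h1, hr⟩ := h
  exact ⟨⟨⟨γ, hγ⟩, h0, h1⟩, fun t => hr ▸ ⟨t, rfl⟩⟩

theorem IsPlaneArc.isCompact {A : Set ℂ} {a b : ℂ} (h : SimpleGraph.IsPlaneArc A a b) :
    IsCompact A := by
  obtain ⟨γ, hγ, -, -, -, hr⟩ := h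
  exact hr ▸ isCompact_range hγ

/-- Interpolating linearly between the logarithms of `z` and 2 makes the logarithm of the modulus
grow from 0 as `t * log 2`, so the path leaves the circle at once. -/
theorem joinedIn_exterior {z : ℂ} (hz : ‖z‖ = 1) : JoinedIn ({z} ∪ {w | 1 < ‖w‖}) z 2 := by
  have hz0 : z ≠ 0 := by rintro rfl; simp at hz
  have hl : (Complex.log z).re = 0 := by rw [Complex.log_re, hz, Real.log_one]
  have h2 : (Complex.log 2).re = Real.log 2 := by rw [Complex.log_re]; norm_num
  have h2' : 0 < Real.log 2 := Real.log_pos (by norm_num)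
  have hf : Continuous fun t : ℝ =>
      Complex.exp (((1 - t : ℝ) : ℂ) * Complex.log z + (t : ℂ) * Complex.log 2) := by fun_prop
  refine JoinedIn.ofLine hf.continuousOn ?_ ?_ ?_
  · simp [Complex.exp_log hz0]
  · simp [Complex.exp_log]
  · rintro _ ⟨t, ht, rfl⟩
    rcases ht.1.eq_or_lt with h | h
    · left; simp [← h, Complex.exp_log hz0]
    · right
      rw [Set.mem_ofPred_eq, Complex.norm_exp, Complex.add_re, Complex.re_ofReal_mul,
        Complex.re_ofReal_mul, hl, h2, mul_zero, zero_add]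
      exact Real.one_lt_exp_iff.2 (mul_pos h h2')

/-- By strict convexity the interior of a chord lies in the open disk. -/
theorem segment_inter_sphere {a b : ℂ} (ha : ‖a‖ = 1) (hb : ‖b‖ = 1) {z : ℂ}
    (hz : z ∈ segment ℝ a b) (h : 1 ≤ ‖z‖) : z = a ∨ z = b := by
  by_cases hab : a = b
  · subst hab; rw [segment_same] at hz; exact .inl hz
  by_contra! hne
  have := openSegment_subset_ball_of_ne (z := (0 : ℂ)) (r := 1) (by simp [ha]) (by simp [hb]) hab
    (mem_openSegment_of_ne_left_right hne.1.symm hne.2.symm hz)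
  simp at this
  linarith

namespace SimpleGraph

variable {V : Type*} {G : SimpleGraph V}

namespace PlaneEmbedding

variable (φ : G.PlaneEmbedding)

/-- The part of a drawing formed by the vertices in `T` and the edges of `E` joining them. -/
def carrierOn (E : Set (Sym2 V)) (T : Set V) : Set ℂ :=
  φ.pt '' T ∪ {z | ∃ e : G.edgeSet, (e : Sym2 V) ∈ E ∧ (∀ v ∈ (e : Sym2 V), v ∈ T) ∧ z ∈ φ.arc e}

theorem pt_mem_carrierOn {E : Set (Sym2 V)} {T : Set V} {v : V} :
    φ.pt v ∈ φ.carrierOn E T ↔ v ∈ T := by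
  refine ⟨?_, fun h => .inl ⟨v, h, rfl⟩⟩
  rintro (⟨w, hw, h⟩ | ⟨e, -, he, hz⟩)
  · rwa [← φ.pt_injective h]
  · exact he v (φ.mem_of_pt_mem v e hz)

theorem carrierOn_subset (E : Set (Sym2 V)) (T : Set V) : φ.carrierOn E T ⊆ φ.carrier := by
  rintro z (⟨w, hw, h⟩ | ⟨e, -, he, hz⟩)
  · exact .inl ⟨w, h⟩
  · exact .inr (Set.mem_iUnion.2 ⟨e, hz⟩)

theorem disjoint_carrierOn {E E' : Set (Sym2 V)} {T T' : Set V} (h : Disjoint T T') :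
    Disjoint (φ.carrierOn E T) (φ.carrierOn E' T') := by
  have hT := Set.disjoint_left.1 h
  rw [Set.disjoint_left]
  intro z hz hz'
  rcases hz with ⟨w, hw, rfl⟩ | ⟨e, -, he, hz⟩
  · exact hT hw (φ.pt_mem_carrierOn.1 hz')
  rcases hz' with ⟨w', hw', rfl⟩ | ⟨e', -, he', hz'⟩
  · exact hT (he _ (φ.mem_of_pt_mem _ e hz)) hw'
  · have hne : e ≠ e' := by
      rintro rfl
      obtain ⟨e, hh⟩ := e
      induction e with
      | _ a b => exact hT (he a (by simp)) (he' a (by simp))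
    obtain ⟨v, ⟨h1, h2⟩, -⟩ := φ.inter_subset e e' hne ⟨hz, hz'⟩
    exact hT (he v h1) (he' v h2)

theorem joinedIn_carrierOn_of_adj {E : Set (Sym2 V)} {T : Set V} {u v : V} (h : G.Adj u v)
    (hE : s(u, v) ∈ E) (hu : u ∈ T) (hv : v ∈ T) :
    JoinedIn (φ.carrierOn E T) (φ.pt u) (φ.pt v) := by
  refine (IsPlaneArc.joinedIn (φ.isPlaneArc u v h)).mono fun z hz => .inr ⟨_, hE, ?_, hz⟩
  intro w hw
  rcases Sym2.mem_iff.1 hw with rfl | rfl <;> assumption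

theorem joinedIn_carrierOn {T : Set V} (hT : G.IsConn T) {u v : V} (hu : u ∈ T) (hv : v ∈ T) :
    JoinedIn (φ.carrierOn Set.univ T) (φ.pt u) (φ.pt v) :=
  hT.2 (fun w => JoinedIn (φ.carrierOn Set.univ T) (φ.pt u) (φ.pt w))
    (fun _ hw _ hz hwz h => h.trans (φ.joinedIn_carrierOn_of_adj hwz trivial hw hz)) u hu v hv
    (.refl (φ.pt_mem_carrierOn.2 hu))

theorem isClosed_carrierOn [Finite V] (E : Set (Sym2 V)) (T : Set V) :
    IsClosed (φ.carrierOn E T) := by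
  have harc : ∀ e : G.edgeSet, IsClosed (φ.arc e) := by
    rintro ⟨e, he⟩
    induction e with
    | _ a b => exact (IsPlaneArc.isCompact (φ.isPlaneArc a b he)).isClosed
  refine (Set.toFinite _).isClosed.union ?_
  have : {z | ∃ e : G.edgeSet, (e : Sym2 V) ∈ E ∧ (∀ v ∈ (e : Sym2 V), v ∈ T) ∧ z ∈ φ.arc e} =
      ⋃ e ∈ {e : G.edgeSet | (e : Sym2 V) ∈ E ∧ (∀ v ∈ (e : Sym2 V), v ∈ T)}, φ.arc e := by
    ext z; simp [and_assoc]
  rw [this]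
  exact (Set.toFinite _).isClosed_biUnion fun e _ => harc e

theorem carrier_eq : φ.carrier = φ.carrierOn Set.univ Set.univ := by
  ext z; simp [carrier, carrierOn]

end PlaneEmbedding

/-! ### From drawings to excluded minors and noncrossing orders -/

/-- Three of the four degree-two branch sets suffice. A point `z₀` of the outer face is joined to a
vertex `b j` of each of them; together with one vertex from each hub, `z₀` forms the second class of
a drawing of `K₃,₃`. -/
theorem IsOuterplanar.isK24MinorFree [Finite V] (hG : G.IsOuterplanar) : G.IsK24MinorFree := by
  rintro ⟨B, hB, hdis, hadj⟩
  obtain ⟨φ, U, ⟨⟨z₀, hz₀, hU⟩, -⟩, hfr⟩ := hG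
  have hUo : IsOpen U := by
    rw [hU, φ.carrier_eq]
    exact (φ.isClosed_carrierOn _ _).isOpen_compl.connectedComponentIn
  have hz₀U : z₀ ∈ U := hU ▸ mem_connectedComponentIn hz₀
  have hUsub : U ⊆ φ.carrierᶜ := hU ▸ connectedComponentIn_subset _ _
  have hUp : IsPathConnected U := hUo.isConnected_iff_isPathConnected.1
    (hU ▸ isConnected_connectedComponentIn_iff.2 hz₀)
  have hC : ∀ w, G.IsConn (B w) := fun w => connected_induce_iff_isConn.1 (hB w)
  choose h hh using fun i : Fin 2 => (hC (.inl i)).1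
  choose b hb using fun j : Fin 3 => (hC (.inr j.castSucc)).1
  -- The vertex `b j` is only on the frontier of `U`. A small ball, missing every part of the
  -- drawing that avoids `b j`, bridges the gap.
  have hball : ∀ j, ∃ r > 0, Metric.ball (φ.pt (b j)) r ⊆ (φ.carrierOn Set.univ {b j}ᶜ)ᶜ := by
    intro j
    refine Metric.isOpen_iff.1 (φ.isClosed_carrierOn _ _).isOpen_compl _ ?_
    rw [Set.mem_compl_iff, φ.pt_mem_carrierOn]
    simp
  choose r hr hr' using hball
  let T : Fin 2 → Fin 3 → Set V := fun i j => B (.inl i) ∪ B (.inr j.castSucc)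
  let a : Fin 3 → ℂ := Fin.cons z₀ fun i => φ.pt (h i)
  let S : Fin 3 → Fin 3 → Set ℂ := Fin.cons (fun j => U ∪ Metric.ball (φ.pt (b j)) (r j))
    fun i j => φ.carrierOn Set.univ (T i j)
  have hbT : ∀ i j l, j ≠ l → b j ∉ T i l := by
    rintro i j l hjl (hm | hm)
    · exact Set.disjoint_left.1 (hdis _ _ (by simp)) hm (hb j)
    · exact Set.disjoint_left.1 (hdis _ _ (by simpa using hjl)) (hb j) hm
  refine not_drawing_K33 a (fun j => φ.pt (b j)) S ?_ ?_ ?_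
  · intro i j
    refine Fin.cases ?_ (fun i => ?_) i
    · obtain ⟨u, huU, hu⟩ := Metric.mem_closure_iff.1 (frontier_subset_closure (hfr (b j))) (r j) (hr j)
      have h1 : JoinedIn (U ∪ Metric.ball (φ.pt (b j)) (r j)) z₀ u :=
        (hUp.joinedIn _ hz₀U _ huU).mono Set.subset_union_left
      exact h1.trans ((((convex_ball _ _).isPathConnected ⟨_, Metric.mem_ball_self (hr j)⟩).joinedIn
        u (by rwa [Metric.mem_ball']) _ (Metric.mem_ball_self (hr j))).mono
          Set.subset_union_right)
    · obtain ⟨x, hx, y, hy, hxy⟩ := hadj (.inl i) (.inr j.castSucc) (by simp)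
      exact φ.joinedIn_carrierOn ((hC _).union (hC _) hx hy hxy) (.inl (hh i)) (.inr (hb j))
  · intro i j k l hik hjl
    obtain ⟨k, rfl⟩ := Fin.exists_succ_eq.2 (Fin.ne_zero_of_lt hik)
    revert hik
    refine Fin.cases (fun _ => ?_) (fun i hik => ?_) i
    · simp only [S, Fin.cons_zero, Fin.cons_succ]
      rw [Set.disjoint_left]
      rintro z (hz | hz) hz'
      · exact hUsub hz (φ.carrierOn_subset _ _ hz')
      · refine hr' j hz ?_
        have hsub : T k l ⊆ {b j}ᶜ := fun v hv hvb => hbT k j l hjl (by rwa [← Set.mem_singleton_iff.1 hvb])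
        rcases hz' with ⟨w, hw, rfl⟩ | ⟨e, -, he, hz⟩
        · exact .inl ⟨w, hsub hw, rfl⟩
        · exact .inr ⟨e, trivial, fun v hv => hsub (he v hv), hz⟩
    · simp only [S, Fin.cons_succ]
      have hik' : i ≠ k := by rintro rfl; exact lt_irrefl _ hik
      refine φ.disjoint_carrierOn ?_
      simp only [T, Set.disjoint_union_left, Set.disjoint_union_right]
      refine ⟨⟨hdis _ _ (by simpa using hik'), hdis _ _ (by simp)⟩, hdis _ _ (by simp),
        hdis _ _ (by simpa using hjl)⟩
  · intro i j
    refine Fin.cases ?_ (fun i => ?_) i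
    · simp only [a, Fin.cons_zero]
      rintro rfl
      exact hz₀ (.inl ⟨_, rfl⟩)
    · simp only [a, Fin.cons_succ]
      intro heq
      exact Set.disjoint_left.1 (hdis (.inl i) (.inr j.castSucc) (by simp)) (hh i)
        (φ.pt_injective heq ▸ hb j)


theorem mem_edges_getVert {u v : V} (P : G.Walk u v) {i : ℕ} (hi : i < P.length) :
    s(P.getVert i, P.getVert (i + 1)) ∈ P.edges := by
  induction P generalizing i with
  | nil => simp at hi
  | cons h P ih =>
    cases i with
    | zero => simp
    | succ i =>
      simp only [Walk.getVert_cons_succ, Walk.edges_cons, List.mem_cons]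
      exact .inr (ih (by simpa using hi))

/-- The vertices of an `xy`-outerplanar graph are ordered along the Hamilton path, and no two edges
cross in this order. -/
theorem IsPathOuterplanar.exists_isNoncrossing {x y : V} (hG : G.IsPathOuterplanar x y) :
    ∃ f : V → ℕ, Function.Injective f ∧ (∀ v, f x ≤ f v ∧ f v ≤ f y) ∧ G.IsNoncrossing f := by
  obtain ⟨φ, P, hP, hall, hball, hpt, harc⟩ := hG
  have hex : ∀ v, ∃ n ≤ P.length, P.getVert n = v := fun v => by
    obtain ⟨n, hn, hn'⟩ := Walk.mem_support_iff_exists_getVert.1 (hall v)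
    exact ⟨n, hn', hn⟩
  choose f hf hf' using hex
  have hinj : Function.Injective f := fun u v h => by rw [← hf' u, h, hf' v]
  have hfget : ∀ n ≤ P.length, f (P.getVert n) = n := fun n hn =>
    hP.getVert_injOn (hf _) hn (hf' _)
  have hfx : f x = 0 := by have := hfget 0 (Nat.zero_le _); rwa [P.getVert_zero] at this
  have hfy : f y = P.length := by have := hfget P.length le_rfl; rwa [P.getVert_length] at this
  refine ⟨f, hinj, fun v => ⟨by omega, by rw [hfy]; exact hf v⟩, ?_⟩
  intro a b c d hab hbc hcd hac hbd
  -- The crossing edges `ac` and `bd` are completed to a drawing of `K₅` on `a, b, c, d` and the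
  -- exterior point 2: `ab`, `bc`, `cd` run along the Hamilton path on the circle, `ad` is a
  -- straight chord, and 2 is reached through the exterior. Restricting to path edges keeps `C u v`
  -- on the circle.
  let E : Set (Sym2 V) := {e | e ∈ P.edges}
  let C : V → V → Set ℂ := fun u v => φ.carrierOn E {w | f u ≤ f w ∧ f w ≤ f v}
  have hCS : ∀ u v, C u v ⊆ Metric.sphere 0 1 := by
    rintro u v z (⟨w, -, rfl⟩ | ⟨e, he, -, hz⟩)
    · exact hpt w
    · exact harc e he hz
  have hCj : ∀ u v, f u ≤ f v → JoinedIn (C u v) (φ.pt u) (φ.pt v) := by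
    intro u v huv
    suffices H : ∀ k, f u + k ≤ f v → JoinedIn (C u v) (φ.pt u) (φ.pt (P.getVert (f u + k))) by
      have := H (f v - f u) (by omega)
      rwa [show f u + (f v - f u) = f v by omega, hf' v] at this
    intro k
    induction k with
    | zero =>
      intro _
      rw [add_zero, hf']
      exact .refl (φ.pt_mem_carrierOn.2 ⟨le_rfl, huv⟩)
    | succ k ih =>
      intro hk
      have hlt : f u + k < P.length := by have := hf v; omega
      refine (ih (by omega)).trans (φ.joinedIn_carrierOn_of_adj (P.adj_getVert_succ hlt) ?_ ?_ ?_)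
      · exact mem_edges_getVert P hlt
      · simp only [Set.mem_ofPred_eq]
        rw [hfget _ hlt.le]; omega
      · simp only [Set.mem_ofPred_eq]
        rw [show f u + (k + 1) = (f u + k) + 1 by rfl, hfget _ hlt]; omega
  let R : V → Set ℂ := fun v => {φ.pt v} ∪ {w | 1 < ‖w‖}
  let K : V → V → Set ℂ := fun u v => φ.carrierOn Set.univ {u, v}
  have hnorm : ∀ v, ‖φ.pt v‖ = 1 := fun v => by simpa using hpt v
  have hCR : ∀ u v w, (f w < f u ∨ f v < f w) → Disjoint (C u v) (R w) := by
    intro u v w hw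
    rw [Set.disjoint_left]
    rintro z hz (hz' | hz')
    · rw [Set.mem_singleton_iff] at hz'
      subst hz'
      have : f u ≤ f w ∧ f w ≤ f v := φ.pt_mem_carrierOn.1 hz
      omega
    · have := hCS u v hz
      simp only [mem_sphere_iff_norm, sub_zero, Set.mem_ofPred_eq] at this hz'
      linarith
  have hKR : ∀ u v w, w ≠ u → w ≠ v → Disjoint (K u v) (R w) := by
    intro u v w hu hv
    rw [Set.disjoint_left]
    rintro z hz (hz' | hz')
    · rw [Set.mem_singleton_iff] at hz'
      subst hz'
      have : w = u ∨ w = v := φ.pt_mem_carrierOn.1 hz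
      tauto
    · have := hball (φ.carrierOn_subset _ _ hz)
      simp only [mem_closedBall_iff_norm, sub_zero, Set.mem_ofPred_eq] at this hz'
      linarith
  have hKj : ∀ u v, G.Adj u v → JoinedIn (K u v) (φ.pt u) (φ.pt v) := fun u v h =>
    φ.joinedIn_carrierOn_of_adj h trivial (.inl rfl) (.inr rfl)
  have hne : ∀ {u v}, f u < f v → u ≠ v := fun h h' => by subst h'; exact lt_irrefl _ h
  -- The chord `ad` may meet the drawn edges `ac` and `bd`, with which it shares an end. It only has
  -- to avoid the path from `b` to `c` and the exterior curves at `b` and `c`.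
  have hseg : ∀ z ∈ segment ℝ (φ.pt a) (φ.pt d), 1 ≤ ‖z‖ → z = φ.pt a ∨ z = φ.pt d :=
    fun z hz h => segment_inter_sphere (hnorm a) (hnorm d) hz h
  have hLR : ∀ w, w ≠ a → w ≠ d → Disjoint (segment ℝ (φ.pt a) (φ.pt d)) (R w) := by
    intro w hwa hwd
    rw [Set.disjoint_left]
    rintro z hz (hz' | hz')
    · rw [Set.mem_singleton_iff] at hz'
      subst hz'
      rcases hseg _ hz (hnorm w).ge with h | h
      · exact hwa (φ.pt_injective h)
      · exact hwd (φ.pt_injective h)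
    · have h1 : segment ℝ (φ.pt a) (φ.pt d) ⊆ Metric.closedBall 0 1 :=
        (convex_closedBall _ _).segment_subset (by simp [hnorm]) (by simp [hnorm])
      have := h1 hz
      simp only [mem_closedBall_iff_norm, sub_zero, Set.mem_ofPred_eq] at this hz'
      linarith
  have hLC : Disjoint (segment ℝ (φ.pt a) (φ.pt d)) (C b c) := by
    rw [Set.disjoint_left]
    intro z hz hz'
    have h1 := hCS _ _ hz'
    simp only [mem_sphere_iff_norm, sub_zero] at h1
    rcases hseg z hz h1.ge with rfl | rfl <;>
    · have := φ.pt_mem_carrierOn.1 hz'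
      simp only [Set.mem_ofPred_eq] at this
      omega
  have hLj : JoinedIn (segment ℝ (φ.pt a) (φ.pt d)) (φ.pt a) (φ.pt d) :=
    ((convex_segment _ _).isPathConnected ⟨_, left_mem_segment ℝ _ _⟩).joinedIn _
      (left_mem_segment ℝ _ _) _ (right_mem_segment ℝ _ _)
  have hRj : ∀ v, JoinedIn (R v) (φ.pt v) 2 := fun v => joinedIn_exterior (hnorm v)
  have h2 : ∀ v, φ.pt v ≠ 2 := fun v h => by have := hnorm v; rw [h] at this; norm_num at this
  have hCC : Disjoint (C a b) (C c d) := φ.disjoint_carrierOn (Set.disjoint_left.2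
    fun w hw hw' => by simp only [Set.mem_ofPred_eq] at hw hw'; omega)
  have hKK : Disjoint (K a c) (K b d) := φ.disjoint_carrierOn (Set.disjoint_left.2 (by
    rintro w (rfl | rfl) (h | h)
    exacts [hne hab h, hne (by omega) h, hne hbc h.symm, hne hcd h]))
  clear_value C K R
  exact not_drawing_K5_of_list
    (φ.pt_injective.ne (hne (u := a) (v := b) (by omega)))
    (φ.pt_injective.ne (hne (u := a) (v := c) (by omega)))
    (φ.pt_injective.ne (hne (u := a) (v := d) (by omega)))
    (h2 a)
    (φ.pt_injective.ne (hne (u := b) (v := c) (by omega)))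
    (φ.pt_injective.ne (hne (u := b) (v := d) (by omega)))
    (h2 b)
    (φ.pt_injective.ne (hne (u := c) (v := d) (by omega)))
    (h2 c)
    (h2 d)
    (hCj a b hab.le) (hKj a c hac) (hLj) (hRj a) (hCj b c hbc.le) (hKj b d hbd) (hRj b) (hCj c d hcd.le) (hRj c) (hRj d)
    hCC
    (hCR a b c (by omega))
    (hCR a b d (by omega))
    hKK
    (hKR a c b (hne hab).symm (hne hbc))
    (hKR a c d (hne (by omega)).symm (hne hcd).symm)
    (hLC)
    (hLR b (hne hab).symm (hne (by omega)))
    (hLR c (hne (by omega)).symm (hne (by omega)))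
    (hCR b c a (by omega)).symm
    (hKR b d a (hne hab) (hne (by omega))).symm
    (hCR c d a (by omega)).symm
    (hCR b c d (by omega))
    (hKR b d c (hne hbc).symm (hne hcd))
    (hCR c d b (by omega)).symm

end SimpleGraph

/-! ### From noncrossing orders to drawings in the disk -/

/-- The rational parametrization of the unit circle without the point `-1`. -/
noncomputable def circlePt (t : ℝ) : ℂ := ⟨(1 - t ^ 2) / (1 + t ^ 2), 2 * t / (1 + t ^ 2)⟩

theorem continuous_circlePt : Continuous circlePt := by
  have h : ∀ t : ℝ, 1 + t ^ 2 ≠ 0 := fun t => by positivity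
  have : circlePt = fun t : ℝ => (((1 - t ^ 2) / (1 + t ^ 2) : ℝ) : ℂ) +
      ((2 * t / (1 + t ^ 2) : ℝ) : ℂ) * Complex.I := by
    funext t
    apply Complex.ext <;> simp only [circlePt, Complex.add_re, Complex.add_im, Complex.ofReal_re,
      Complex.ofReal_im, Complex.re_ofReal_mul, Complex.im_ofReal_mul, Complex.I_re, Complex.I_im] <;>
      ring
  rw [this]
  refine (Complex.continuous_ofReal.comp (Continuous.div (by fun_prop) (by fun_prop) h)).add
    ((Complex.continuous_ofReal.comp (Continuous.div (by fun_prop) (by fun_prop) h)).mul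
      continuous_const)

theorem norm_circlePt (t : ℝ) : ‖circlePt t‖ = 1 := by
  have h : (1 + t ^ 2) ≠ 0 := by positivity
  have : ‖circlePt t‖ ^ 2 = 1 := by
    rw [← Complex.normSq_eq_norm_sq, Complex.normSq_apply]
    simp only [circlePt]
    field_simp
    ring
  exact (pow_eq_one_iff_of_nonneg (norm_nonneg _) two_ne_zero).1 this

theorem circlePt_injective : Function.Injective circlePt := by
  have : ∀ t, (circlePt t).im / (1 + (circlePt t).re) = t := fun t => by
    have h : (1 + t ^ 2) ≠ 0 := by positivity
    simp only [circlePt]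
    field_simp
    ring
  intro s t h
  rw [← this s, ← this t, h]

/-- The orientation of the triangle with corners `circlePt m`, `circlePt n`, `z`. -/
noncomputable def circleDet (m n : ℝ) (z : ℂ) : ℝ :=
  ((circlePt n).re - (circlePt m).re) * (z.im - (circlePt m).im) -
    ((circlePt n).im - (circlePt m).im) * (z.re - (circlePt m).re)

/-- For `m < n` the sign is that of `(t - m) * (t - n)`: the side of the chord on which a point of
the circle lies can be read from the parameters. -/
theorem circleDet_circlePt (m n t : ℝ) : circleDet m n (circlePt t) =
    4 * (n - m) * ((t - m) * (t - n)) / ((1 + m ^ 2) * (1 + n ^ 2) * (1 + t ^ 2)) := by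
  have h1 : (1 + m ^ 2) ≠ 0 := by positivity
  have h2 : (1 + n ^ 2) ≠ 0 := by positivity
  have h3 : (1 + t ^ 2) ≠ 0 := by positivity
  simp only [circleDet, circlePt]
  field_simp
  ring

theorem circleDet_combo (m n : ℝ) {z w : ℂ} {a b : ℝ} (h : a + b = 1) :
    circleDet m n (a • z + b • w) = a * circleDet m n z + b * circleDet m n w := by
  obtain rfl : a = 1 - b := by linarith
  simp only [circleDet, Complex.add_re, Complex.add_im, Complex.real_smul, Complex.re_ofReal_mul,
    Complex.im_ofReal_mul]
  ring

/-- The curve joining the points with the numbers `m` and `n` on the circle: an arc of the circle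
for consecutive numbers and a chord otherwise. -/
noncomputable def circleArc (m n : ℕ) : Set ℂ :=
  if n = m + 1 ∨ m = n + 1 then circlePt '' segment ℝ (m : ℝ) n
  else segment ℝ (circlePt m) (circlePt n)

theorem circleArc_comm (m n : ℕ) : circleArc m n = circleArc n m := by
  simp only [circleArc, or_comm (a := n = m + 1), segment_symm ℝ (m : ℝ),
    segment_symm ℝ (circlePt m)]

theorem isPlaneArc_image_segment {E : Type*} [AddCommGroup E] [Module ℝ E] [TopologicalSpace E]
    [IsTopologicalAddGroup E] [ContinuousSMul ℝ E] {F : E → ℂ} (hF : Continuous F)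
    (hi : Function.Injective F) {a b : E} (hab : a ≠ b) :
    SimpleGraph.IsPlaneArc (F '' segment ℝ a b) (F a) (F b) := by
  refine ⟨fun t => F (AffineMap.lineMap a b (t : ℝ)), ?_, ?_, by simp, by simp, ?_⟩
  · exact hF.comp ((AffineMap.lineMap_continuous).comp continuous_subtype_val)
  · exact hi.comp ((AffineMap.lineMap_injective ℝ hab).comp Subtype.val_injective)
  · rw [segment_eq_image_lineMap, Set.image_image]
    ext z
    simp

theorem isPlaneArc_circleArc {m n : ℕ} (h : m ≠ n) :
    SimpleGraph.IsPlaneArc (circleArc m n) (circlePt m) (circlePt n) := by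
  have hmn : (m : ℝ) ≠ n := by exact_mod_cast h
  rw [circleArc]
  split_ifs
  · exact isPlaneArc_image_segment continuous_circlePt circlePt_injective hmn
  · simpa using isPlaneArc_image_segment (E := ℂ) continuous_id Function.injective_id
      (circlePt_injective.ne hmn)

theorem circleArc_subset (m n : ℕ) : circleArc m n ⊆ Metric.closedBall 0 1 := by
  rw [circleArc]
  split_ifs
  · rintro _ ⟨t, -, rfl⟩
    simp [norm_circlePt]
  · exact (convex_closedBall _ _).segment_subset (by simp [norm_circlePt]) (by simp [norm_circlePt])

theorem circleArc_succ_subset (m : ℕ) : circleArc m (m + 1) ⊆ Metric.sphere 0 1 := by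
  rw [circleArc, if_pos (.inl rfl)]
  rintro _ ⟨t, -, rfl⟩
  simp [norm_circlePt]

theorem mem_chord {m n : ℕ} {z : ℂ} (hz : z ∈ segment ℝ (circlePt m) (circlePt n))
    (h : ‖z‖ = 1) : z = circlePt m ∨ z = circlePt n :=
  segment_inter_sphere (norm_circlePt _) (norm_circlePt _) hz h.ge

theorem eq_of_circlePt_mem_circleArc {m n k : ℕ} (h : circlePt k ∈ circleArc m n) :
    k = m ∨ k = n := by
  rw [circleArc] at h
  split_ifs at h with hc
  · obtain ⟨t, ht, htk⟩ := h
    obtain rfl := circlePt_injective htk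
    rw [segment_eq_uIcc, Set.mem_uIcc] at ht
    norm_cast at ht
    omega
  · rcases mem_chord h (norm_circlePt _) with h | h
    · exact .inl (by exact_mod_cast circlePt_injective h)
    · exact .inr (by exact_mod_cast circlePt_injective h)

/-- The function `circleDet m n` is affine and vanishes at `z`. As the chords do not interleave, its
values at the ends of the chord from `k` to `l` do not have opposite signs. If `z` were interior to
that chord, both values would vanish and the chords would coincide. -/
theorem chord_inter {m n k l : ℕ} (hmn : m < n) (hkl : k < l) (hne : m ≠ k ∨ n ≠ l)
    (h1 : ¬ (m < k ∧ k < n ∧ n < l)) (h2 : ¬ (k < m ∧ m < l ∧ l < n)) {z : ℂ}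
    (hz : z ∈ segment ℝ (circlePt m) (circlePt n)) (hz' : z ∈ segment ℝ (circlePt k) (circlePt l)) :
    z = circlePt k ∨ z = circlePt l := by
  have hD : circleDet m n z = 0 := by
    obtain ⟨a, b, -, -, hab, rfl⟩ := hz
    rw [circleDet_combo _ _ hab, circleDet_circlePt, circleDet_circlePt]
    simp
  obtain ⟨a, b, ha, hb, hab, rfl⟩ := hz'
  rw [circleDet_combo _ _ hab] at hD
  rcases ha.eq_or_lt with rfl | ha
  · right; obtain rfl : b = 1 := by linarith
    simp
  rcases hb.eq_or_lt with rfl | hb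
  · left; obtain rfl : a = 1 := by linarith
    simp
  exfalso
  have hc : ∀ t : ℕ, ∃ P : ℝ, 0 < P ∧ circleDet m n (circlePt t) = P * ((t - m : ℝ) * (t - n)) := by
    intro t
    have : (0 : ℝ) < n - m := by rw [sub_pos]; exact_mod_cast hmn
    exact ⟨4 * (n - m) / ((1 + (m : ℝ) ^ 2) * (1 + (n : ℝ) ^ 2) * (1 + (t : ℝ) ^ 2)), by positivity,
      by rw [circleDet_circlePt]; ring⟩
  obtain ⟨P, hP, hP'⟩ := hc k
  obtain ⟨R, hR, hR'⟩ := hc l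
  rw [hP', hR'] at hD
  have haP := mul_pos ha hP
  have hbR := mul_pos hb hR
  have hD' : (a * P) * ((k - m : ℝ) * (k - n)) + (b * R) * ((l - m : ℝ) * (l - n)) = 0 := by
    linarith
  have hzero : ((k - m : ℝ) * (k - n)) = 0 ∧ ((l - m : ℝ) * (l - n)) = 0 := by
    have hs : (0 ≤ ((k - m : ℝ) * (k - n)) ∧ 0 ≤ ((l - m : ℝ) * (l - n))) ∨
        (((k - m : ℝ) * (k - n)) ≤ 0 ∧ ((l - m : ℝ) * (l - n)) ≤ 0) := by
      have hcast : ∀ {i j : ℕ}, i ≤ j → (i : ℝ) - j ≤ 0 ∧ 0 ≤ (j : ℝ) - i := fun h => by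
        constructor <;> simpa using h
      by_cases hin : m ≤ k ∧ l ≤ n
      · right
        exact ⟨mul_nonpos_of_nonneg_of_nonpos (hcast hin.1).2 (hcast (by omega)).1,
          mul_nonpos_of_nonneg_of_nonpos (hcast (by omega)).2 (hcast hin.2).1⟩
      · left
        have hside : ∀ t : ℕ, t ≤ m ∨ n ≤ t → 0 ≤ ((t - m : ℝ) * (t - n)) := by
          rintro t (ht | ht)
          · exact mul_nonneg_of_nonpos_of_nonpos (hcast ht).1 (hcast (by omega)).1
          · exact mul_nonneg (hcast (by omega)).2 (hcast ht).2
        exact ⟨hside k (by omega), hside l (by omega)⟩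
    rcases hs with ⟨h3, h4⟩ | ⟨h3, h4⟩
    · have := mul_nonneg haP.le h3
      have := mul_nonneg hbR.le h4
      exact ⟨(mul_eq_zero.1 (by linarith : (a * P) * ((k - m : ℝ) * (k - n)) = 0)).resolve_left
        haP.ne', (mul_eq_zero.1 (by linarith : (b * R) * ((l - m : ℝ) * (l - n)) = 0)).resolve_left
        hbR.ne'⟩
    · have := mul_nonpos_of_nonneg_of_nonpos haP.le h3
      have := mul_nonpos_of_nonneg_of_nonpos hbR.le h4
      exact ⟨(mul_eq_zero.1 (by linarith : (a * P) * ((k - m : ℝ) * (k - n)) = 0)).resolve_left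
        haP.ne', (mul_eq_zero.1 (by linarith : (b * R) * ((l - m : ℝ) * (l - n)) = 0)).resolve_left
        hbR.ne'⟩
  have e1 : k = m ∨ k = n := by
    rcases mul_eq_zero.1 hzero.1 with h | h <;> rw [sub_eq_zero] at h <;> norm_cast at h <;> tauto
  have e2 : l = m ∨ l = n := by
    rcases mul_eq_zero.1 hzero.2 with h | h <;> rw [sub_eq_zero] at h <;> norm_cast at h <;> tauto
  omega

/-- Arcs between consecutive numbers overlap at most in a common end, and a chord meets the circle
only in its ends, so `chord_inter` is needed only for two chords. -/
theorem circleArc_inter {m n k l : ℕ} (hmn : m < n) (hkl : k < l) (hne : m ≠ k ∨ n ≠ l)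
    (h1 : ¬ (m < k ∧ k < n ∧ n < l)) (h2 : ¬ (k < m ∧ m < l ∧ l < n)) {z : ℂ}
    (hz : z ∈ circleArc m n) (hz' : z ∈ circleArc k l) : ∃ j : ℕ, z = circlePt j := by
  rw [circleArc] at hz hz'
  split_ifs at hz with hc
  · obtain ⟨t, ht, rfl⟩ := hz
    split_ifs at hz' with hc'
    · obtain ⟨s, hs, hst⟩ := hz'
      obtain rfl := circlePt_injective hst
      rw [segment_eq_uIcc, Set.mem_uIcc] at ht hs
      obtain rfl : n = m + 1 := by omega
      obtain rfl : l = k + 1 := by omega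
      push_cast at ht hs
      rcases lt_or_gt_of_ne (show m ≠ k by omega) with h | h
      · have h' : (m : ℝ) + 1 ≤ k := by exact_mod_cast h
        exact ⟨k, congrArg _ (le_antisymm (by rcases ht with ht | ht <;> linarith)
          (by rcases hs with hs | hs <;> linarith))⟩
      · have h' : (k : ℝ) + 1 ≤ m := by exact_mod_cast h
        exact ⟨m, congrArg _ (le_antisymm (by rcases hs with hs | hs <;> linarith)
          (by rcases ht with ht | ht <;> linarith))⟩
    · rcases mem_chord hz' (norm_circlePt _) with h | h
      exacts [⟨_, h⟩, ⟨_, h⟩]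
  · split_ifs at hz' with hc'
    · obtain ⟨t, ht, rfl⟩ := hz'
      rcases mem_chord hz (norm_circlePt _) with h | h
      exacts [⟨_, h⟩, ⟨_, h⟩]
    · rcases chord_inter hmn hkl hne h1 h2 hz hz' with h | h
      exacts [⟨_, h⟩, ⟨_, h⟩]

namespace SimpleGraph

variable {V : Type*} {G : SimpleGraph V}

/-- The drawing of a graph in the unit disk given by an order without crossings. -/
noncomputable def circleEmbedding (G : SimpleGraph V) {f : V → ℕ} (hf : Function.Injective f)
    (hnc : G.IsNoncrossing f) : G.PlaneEmbedding where
  pt v := circlePt (f v)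
  arc e := Sym2.lift ⟨fun u v => circleArc (f u) (f v), fun _ _ => circleArc_comm _ _⟩ e
  pt_injective u v h := hf (by exact_mod_cast circlePt_injective h)
  isPlaneArc u v h := isPlaneArc_circleArc (hf.ne h.ne)
  mem_of_pt_mem := by
    rintro w ⟨e, he⟩ h
    induction e with
    | _ a b =>
      rcases eq_of_circlePt_mem_circleArc h with h | h
      · simp [hf h]
      · simp [hf h]
  inter_subset := by
    have key : ∀ e : Sym2 V, e ∈ G.edgeSet → ∃ u v, G.Adj u v ∧ f u < f v ∧ e = s(u, v) := by
      intro e he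
      induction e with
      | _ a b =>
        rcases lt_or_gt_of_ne (hf.ne (G.ne_of_adj he)) with h | h
        · exact ⟨a, b, he, h, rfl⟩
        · exact ⟨b, a, G.adj_symm he, h, Sym2.eq_swap⟩
    rintro ⟨e, he⟩ ⟨e', he'⟩ hne z ⟨hz, hz'⟩
    obtain ⟨a, b, hab, hlt, rfl⟩ := key e he
    obtain ⟨c, d, hcd, hlt', rfl⟩ := key e' he'
    have hne' : f a ≠ f c ∨ f b ≠ f d := by
      by_contra! h
      exact hne (by simp [hf h.1, hf h.2])
    change z ∈ circleArc (f a) (f b) at hz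
    change z ∈ circleArc (f c) (f d) at hz'
    obtain ⟨j, rfl⟩ := circleArc_inter hlt hlt' hne' (fun h => hnc a c b d h.1 h.2.1 h.2.2 hab hcd)
      (fun h => hnc c a d b h.1 h.2.1 h.2.2 hcd hab) hz hz'
    have h1 := eq_of_circlePt_mem_circleArc hz
    have h2 := eq_of_circlePt_mem_circleArc hz'
    have hj : ∃ v, f v = j ∧ (v = a ∨ v = b) := by
      rcases h1 with h | h
      exacts [⟨a, h.symm, .inl rfl⟩, ⟨b, h.symm, .inr rfl⟩]
    obtain ⟨v, rfl, hv⟩ := hj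
    refine ⟨v, ⟨by simpa using hv, ?_⟩, rfl⟩
    rcases h2 with h | h <;> simp [hf h]

theorem circleEmbedding_carrier_subset {f : V → ℕ} (hf : Function.Injective f)
    (hnc : G.IsNoncrossing f) :
    (G.circleEmbedding hf hnc).carrier ⊆ Metric.closedBall 0 1 := by
  rintro z (⟨v, rfl⟩ | hz)
  · simp [circleEmbedding, norm_circlePt]
  · obtain ⟨⟨e, he⟩, hz⟩ := Set.mem_iUnion.1 hz
    induction e with
    | _ a b => exact circleArc_subset _ _ hz

/-- The drawing lies in the closed disk, so the outer face contains the exterior of the disk, which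
is connected as the image of a half-plane under `exp`. Every vertex lies on the circle and is
approached radially from outside. -/
theorem isOuterplanar_of_isNoncrossing {f : V → ℕ} (hf : Function.Injective f)
    (hnc : G.IsNoncrossing f) : G.IsOuterplanar := by
  set φ := G.circleEmbedding hf hnc
  have hsub : {w : ℂ | 1 < ‖w‖} ⊆ φ.carrierᶜ := fun w hw hw' => by
    have := circleEmbedding_carrier_subset hf hnc hw'
    simp only [mem_closedBall_iff_norm, sub_zero, Set.mem_ofPred_eq] at this hw
    linarith
  have h2 : (2 : ℂ) ∈ {w : ℂ | 1 < ‖w‖} := by simp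
  have hpre : IsPreconnected {w : ℂ | 1 < ‖w‖} := by
    have h := (convex_halfSpace_re_gt 0).isPreconnected.image Complex.exp
      Complex.continuous_exp.continuousOn
    convert h using 1
    ext w
    constructor
    · intro hw
      have hw0 : w ≠ 0 := by rintro rfl; simp at hw; linarith
      exact ⟨Complex.log w, by simpa [Complex.log_re] using Real.log_pos hw, Complex.exp_log hw0⟩
    · rintro ⟨z, hz, rfl⟩
      simpa [Complex.norm_exp] using hz
  have hU := hpre.subset_connectedComponentIn h2 hsub
  refine ⟨φ, _, ⟨⟨2, hsub h2, rfl⟩, fun hb => ?_⟩, fun v => ?_⟩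
  · obtain ⟨R, hR⟩ := (hb.subset hU).subset_closedBall 0
    have : ((|R| + 2 : ℝ) : ℂ) ∈ {w : ℂ | 1 < ‖w‖} := by
      rw [Set.mem_ofPred_eq, Complex.norm_real, Real.norm_eq_abs]
      have := le_abs_self (|R| + 2)
      have := abs_nonneg R
      linarith
    have := hR this
    rw [mem_closedBall_iff_norm, sub_zero, Complex.norm_real, Real.norm_eq_abs] at this
    have := le_abs_self (|R| + 2)
    have := le_abs_self R
    linarith
  · have hv : ‖φ.pt v‖ = 1 := norm_circlePt _
    refine ⟨closure_mono hU ?_, fun hint => ?_⟩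
    · refine mem_closure_of_tendsto (f := fun t : ℝ => (t : ℂ) * φ.pt v) (b := nhdsWithin 1 (Set.Ioi 1))
        ?_ (Filter.eventually_of_mem self_mem_nhdsWithin fun t ht => ?_)
      · have : Continuous fun t : ℝ => (t : ℂ) * φ.pt v := by fun_prop
        have h := this.tendsto 1
        simp only [Complex.ofReal_one, one_mul] at h
        exact h.mono_left nhdsWithin_le_nhds
      · have ht' : (1 : ℝ) < t := ht
        rw [Set.mem_ofPred_eq, norm_mul, hv, mul_one, Complex.norm_real, Real.norm_eq_abs]
        exact ht'.trans_le (le_abs_self t)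
    · exact connectedComponentIn_subset _ _ (interior_subset hint) (.inl ⟨v, rfl⟩)

theorem isPathOuterplanar_of_isNoncrossing {f : V → ℕ} (hf : Function.Injective f)
    (hnc : G.IsNoncrossing f) {x y : V} (P : G.Walk x y) (hP : ∀ i, i ≤ P.length → f (P.getVert i) = i)
    (hall : ∀ v, v ∈ P.support) : G.IsPathOuterplanar x y := by
  refine ⟨G.circleEmbedding hf hnc, P, ?_, hall, circleEmbedding_carrier_subset hf hnc,
    fun v => by simp [circleEmbedding, norm_circlePt], ?_⟩
  · rw [← Walk.IsPath.getVert_injOn_iff]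
    intro i hi j hj hij
    rw [← hP i hi, ← hP j hj]
    exact congrArg f hij
  · rintro ⟨e, he⟩ heP
    obtain ⟨i, hi, rfl⟩ : ∃ i, i < P.length ∧ e = s(P.getVert i, P.getVert (i + 1)) := by
      clear hP hall
      change e ∈ P.edges at heP
      induction P with
      | nil => simp at heP
      | cons h P ih =>
        rw [Walk.edges_cons, List.mem_cons] at heP
        rcases heP with rfl | h
        · exact ⟨0, by simp⟩
        · obtain ⟨i, hi, h⟩ := ih h
          exact ⟨i + 1, by simpa using hi, by simpa using h⟩
    change circleArc _ _ ⊆ _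
    rw [hP i hi.le, hP (i + 1) hi]
    exact circleArc_succ_subset i


/-! ### Minors excluded by a noncrossing order -/

/-- Some edge of `G` joins `S` to `T`. -/
def Touch (G : SimpleGraph V) (S T : Set V) : Prop := ∃ a ∈ S, ∃ b ∈ T, G.Adj a b

theorem Touch.symm {S T : Set V} (h : G.Touch S T) : G.Touch T S := by
  obtain ⟨a, ha, b, hb, hab⟩ := h
  exact ⟨b, hb, a, ha, hab.symm⟩

theorem IsConn.union_of_touch {S T : Set V} (hS : G.IsConn S) (hT : G.IsConn T)
    (h : G.Touch S T) : G.IsConn (S ∪ T) := by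
  obtain ⟨a, ha, b, hb, hab⟩ := h
  exact hS.union hT ha hb hab

/-- In the order given by `f` no two edges of `G` with ends in `D` cross. -/
def IsNoncrossingOn (G : SimpleGraph V) (f : V → ℕ) (D : Set V) : Prop :=
  ∀ a ∈ D, ∀ b ∈ D, ∀ c ∈ D, ∀ d ∈ D, f a < f b → f b < f c → f c < f d → G.Adj a c → ¬ G.Adj b d

/-- Some edge `uu'` of `T` leaves the interval between `s` and `s'`, so it separates `s` from `s'`
in the order. Then `S` has an edge leaving the interval between `u` and `u'`, and these two edges
cross. -/
theorem IsNoncrossingOn.not_interleaved {f : V → ℕ} {D S T : Set V} (hnc : G.IsNoncrossingOn f D)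
    (hf : Set.InjOn f D) (hSD : S ⊆ D) (hTD : T ⊆ D) (hST : Disjoint S T) (hS : G.IsConn S)
    (hT : G.IsConn T) {s t s' t' : V} (hs : s ∈ S) (ht : t ∈ T) (hs' : s' ∈ S) (ht' : t' ∈ T)
    (h1 : f s < f t) (h2 : f t < f s') (h3 : f s' < f t') : False := by
  have hne : ∀ a ∈ S, ∀ b ∈ T, f a ≠ f b := fun a ha b hb h =>
    Set.disjoint_left.1 hST ha (hf (hSD ha) (hTD hb) h ▸ hb)
  obtain ⟨u, hu, u', hu', huu, hQu, hQu'⟩ := hT.exists_adj (Q := fun v => f s < f v ∧ f v < f s')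
    ht ht' ⟨h1, h2⟩ (by omega)
  have e1 := hne s hs u' hu'
  have e2 := hne s' hs' u' hu'
  rcases lt_or_gt_of_ne e2 with h | h
  · obtain ⟨v, hv, v', hv', hvv, hQv, hQv'⟩ := hS.exists_adj (Q := fun v => f u < f v ∧ f v < f u')
      hs' hs ⟨hQu.2, h⟩ (by omega)
    have d1 := hne v' hv' u hu
    have d2 := hne v' hv' u' hu'
    by_cases hlt : f v' < f u
    · exact hnc v' (hSD hv') u (hTD hu) v (hSD hv) u' (hTD hu') hlt hQv.1 hQv.2 hvv.symm huu
    · exact hnc u (hTD hu) v (hSD hv) u' (hTD hu') v' (hSD hv') hQv.1 hQv.2 (by omega) huu hvv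
  · obtain ⟨v, hv, v', hv', hvv, hQv, hQv'⟩ := hS.exists_adj (Q := fun v => f u' < f v ∧ f v < f u)
      hs hs' ⟨by omega, hQu.1⟩ (by omega)
    have d1 := hne v' hv' u hu
    have d2 := hne v' hv' u' hu'
    by_cases hlt : f v' < f u'
    · exact hnc v' (hSD hv') u' (hTD hu') v (hSD hv) u (hTD hu) hlt hQv.1 hQv.2 hvv.symm huu.symm
    · exact hnc u' (hTD hu') v (hSD hv) u (hTD hu) v' (hSD hv') hQv.1 hQv.2 (by omega) huu.symm hvv

/-- A minor `K_{2,2}` inside `D` rooted at `x` and `y`: the sets containing the roots form one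
side of the bipartition. -/
def HasRootedK22 (G : SimpleGraph V) (D : Set V) (x y : V) : Prop :=
  ∃ X Y A B : Set V, (X ⊆ D ∧ Y ⊆ D ∧ A ⊆ D ∧ B ⊆ D) ∧
    (G.IsConn X ∧ G.IsConn Y ∧ G.IsConn A ∧ G.IsConn B) ∧ (x ∈ X ∧ y ∈ Y) ∧
    (Disjoint X Y ∧ Disjoint X A ∧ Disjoint X B ∧ Disjoint Y A ∧ Disjoint Y B ∧ Disjoint A B) ∧
    G.Touch X A ∧ G.Touch Y A ∧ G.Touch X B ∧ G.Touch Y B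

/-- If some `b ∈ B` preceded some `a ∈ A`, then `x, b, a, y` would interleave `X ∪ A` with `Y ∪ B`.
So `A` precedes `B`, and by symmetry `B` precedes `A`. -/
theorem IsNoncrossingOn.not_hasRootedK22 {f : V → ℕ} {D : Set V} {x y : V}
    (hnc : G.IsNoncrossingOn f D) (hf : Set.InjOn f D)
    (hxy : ∀ v ∈ D, f x ≤ f v ∧ f v ≤ f y) : ¬ G.HasRootedK22 D x y := by
  rintro ⟨X, Y, A, B, ⟨hX, hY, hA, hB⟩, ⟨cX, cY, cA, cB⟩, ⟨hx, hy⟩,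
    ⟨dXY, dXA, dXB, dYA, dYB, dAB⟩, tXA, tYA, tXB, tYB⟩
  have key : ∀ A B : Set V, A ⊆ D → B ⊆ D → G.IsConn A → G.IsConn B → Disjoint X B →
      Disjoint Y A → Disjoint A B → G.Touch X A → G.Touch Y B → ∀ a ∈ A, ∀ b ∈ B, f a < f b := by
    intro A B hA hB cA cB dXB dYA dAB tXA tYB a ha b hb
    by_contra hlt
    have hd : Disjoint (X ∪ A) (Y ∪ B) := by
      simp only [Set.disjoint_union_left, Set.disjoint_union_right]
      exact ⟨⟨dXY, dYA.symm⟩, dXB, dAB⟩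
    have h1 : f x ≠ f b := fun h =>
      Set.disjoint_left.1 dXB hx (hf (hX hx) (hB hb) h ▸ hb)
    have h2 : f a ≠ f y := fun h =>
      Set.disjoint_left.1 dYA hy (hf (hA ha) (hY hy) h ▸ ha)
    have h3 : f a ≠ f b := fun h =>
      Set.disjoint_left.1 dAB ha (hf (hA ha) (hB hb) h ▸ hb)
    have h4 := hxy b (hB hb)
    have h5 := hxy a (hA ha)
    exact hnc.not_interleaved hf (Set.union_subset hX hA) (Set.union_subset hY hB) hd
      (cX.union_of_touch cA tXA) (cY.union_of_touch cB tYB) (.inl hx) (.inr hb) (.inr ha) (.inl hy)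
      (by omega) (by omega) (by omega)
  obtain ⟨a, ha⟩ := cA.1
  obtain ⟨b, hb⟩ := cB.1
  exact lt_asymm (key A B hA hB cA cB dXB dYA dAB tXA tYB a ha b hb)
    (key B A hB hA cB cA dXA dYB dAB.symm tXB tYA b hb a ha)

/-- Points `p ∈ P` and `q ∈ Q` cut the cyclic order into two arcs, and two of the three sets `S i`
have their representatives on the same arc. Joining one of these sets to `P` and the other to `Q`
gives interleaved sets. -/
theorem IsNoncrossingOn.not_K23 {f : V → ℕ} {D P Q : Set V} {S : Fin 3 → Set V}
    (hnc : G.IsNoncrossingOn f D) (hf : Set.InjOn f D) (hP : P ⊆ D) (hQ : Q ⊆ D)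
    (hS : ∀ i, S i ⊆ D) (cP : G.IsConn P) (cQ : G.IsConn Q) (cS : ∀ i, G.IsConn (S i))
    (dPQ : Disjoint P Q) (dP : ∀ i, Disjoint P (S i)) (dQ : ∀ i, Disjoint Q (S i))
    (dS : ∀ i j, i ≠ j → Disjoint (S i) (S j)) (tP : ∀ i, G.Touch P (S i))
    (tQ : ∀ i, G.Touch Q (S i)) : False := by
  have key : ∀ P Q : Set V, P ⊆ D → Q ⊆ D → G.IsConn P → G.IsConn Q → Disjoint P Q →
      (∀ i, Disjoint P (S i)) → (∀ i, Disjoint Q (S i)) → (∀ i, G.Touch P (S i)) →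
      (∀ i, G.Touch Q (S i)) → ∀ p ∈ P, ∀ q ∈ Q, f p < f q → False := by
    clear hP hQ cP cQ dPQ dP dQ tP tQ P Q
    intro P Q hP hQ cP cQ dPQ dP dQ tP tQ p hp q hq hpq
    choose s hs using fun i => (cS i).1
    have hps : ∀ i, f (s i) ≠ f p := fun i h =>
      Set.disjoint_right.1 (dP i) (hs i) (hf (hS i (hs i)) (hP hp) h ▸ hp)
    have hqs : ∀ i, f (s i) ≠ f q := fun i h =>
      Set.disjoint_right.1 (dQ i) (hs i) (hf (hS i (hs i)) (hQ hq) h ▸ hq)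
    have hss : ∀ i j, i ≠ j → f (s i) ≠ f (s j) := fun i j hij h =>
      Set.disjoint_right.1 (dS i j hij) (hs j) (hf (hS i (hs i)) (hS j (hs j)) h ▸ hs i)
    have H : ∀ i j, i ≠ j → f (s i) < f (s j) →
        ((f p < f (s i) ∧ f (s i) < f q) ↔ (f p < f (s j) ∧ f (s j) < f q)) → False := by
      intro i j hij hlt hiff
      have d1 : Disjoint (P ∪ S i) (Q ∪ S j) := by
        simp only [Set.disjoint_union_left, Set.disjoint_union_right]
        exact ⟨⟨dPQ, (dQ i).symm⟩, dP j, dS i j hij⟩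
      have d2 : Disjoint (P ∪ S j) (Q ∪ S i) := by
        simp only [Set.disjoint_union_left, Set.disjoint_union_right]
        exact ⟨⟨dPQ, (dQ j).symm⟩, dP i, (dS i j hij).symm⟩
      have c := fun i => cP.union_of_touch (cS i) (tP i)
      have c' := fun i => cQ.union_of_touch (cS i) (tQ i)
      have hPs := fun i => Set.union_subset hP (hS i)
      have hQs := fun i => Set.union_subset hQ (hS i)
      have e1 := hps i
      have e2 := hps j
      have e3 := hqs i
      have e4 := hqs j
      by_cases hin : f p < f (s i) ∧ f (s i) < f q
      · exact hnc.not_interleaved hf (hPs j) (hQs i) d2 (c j) (c' i) (.inl hp) (.inr (hs i))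
          (.inr (hs j)) (.inl hq) hin.1 hlt (by omega)
      · by_cases hi : f (s i) < f p
        · by_cases hj : f (s j) < f p
          · exact hnc.not_interleaved hf (hPs i) (hQs j) d1 (c i) (c' j) (.inr (hs i)) (.inr (hs j))
              (.inl hp) (.inl hq) hlt hj hpq
          · exact hnc.not_interleaved hf (hQs i) (hPs j) d2.symm (c' i) (c j) (.inr (hs i)) (.inl hp)
              (.inl hq) (.inr (hs j)) hi hpq (by omega)
        · exact hnc.not_interleaved hf (hPs i) (hQs j) d1 (c i) (c' j) (.inl hp) (.inl hq)
              (.inr (hs i)) (.inr (hs j)) hpq (by omega) hlt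
    have H' : ∀ i j, i ≠ j →
        ((f p < f (s i) ∧ f (s i) < f q) ↔ (f p < f (s j) ∧ f (s j) < f q)) → False := by
      intro i j hij hiff
      rcases lt_or_gt_of_ne (hss i j hij) with h | h
      · exact H i j hij h hiff
      · exact H j i hij.symm h hiff.symm
    have h01 := H' 0 1 (by decide)
    have h02 := H' 0 2 (by decide)
    have h12 := H' 1 2 (by decide)
    tauto
  obtain ⟨p, hp⟩ := cP.1
  obtain ⟨q, hq⟩ := cQ.1
  have hne : f p ≠ f q := fun h => Set.disjoint_left.1 dPQ hp (hf (hP hp) (hQ hq) h ▸ hq)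
  rcases lt_or_gt_of_ne hne with h | h
  · exact key P Q hP hQ cP cQ dPQ dP dQ tP tQ p hp q hq h
  · exact key Q P hQ hP cQ cP dPQ.symm dQ dP tQ tP q hq p hp h

/-- An edge between the first and the last vertex has nothing outside it to cross. -/
theorem IsNoncrossingOn.sup_edge {f : V → ℕ} {D : Set V} {x y : V}
    (hnc : G.IsNoncrossingOn f D) (hxy : ∀ v ∈ D, f x ≤ f v ∧ f v ≤ f y) :
    (G ⊔ edge x y).IsNoncrossingOn f D := by
  intro a ha b hb c hc d hd h1 h2 h3 hac hbd
  have e1 := hxy a ha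
  have e2 := hxy d hd
  rcases hac with hac | hac
  · rcases hbd with hbd | hbd
    · exact hnc a ha b hb c hc d hd h1 h2 h3 hac hbd
    · rcases (edge_adj ..).1 hbd with ⟨⟨rfl, rfl⟩ | ⟨rfl, rfl⟩, -⟩ <;> omega
  · rcases (edge_adj ..).1 hac with ⟨⟨rfl, rfl⟩ | ⟨rfl, rfl⟩, -⟩ <;> omega

/-! ### Sets attached at two vertices -/

/-- The set `C` is attached to the rest of the graph only at `x` and `y`. -/
def IsAttachedAt (G : SimpleGraph V) (C : Set V) (x y : V) : Prop :=
  x ∉ C ∧ y ∉ C ∧ ∀ u ∈ C, ∀ v, G.Adj u v → v ∈ C ∨ v = x ∨ v = y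

/-- `C` together with `x` and `y`. -/
abbrev withEnds (C : Set V) (x y : V) : Set V := C ∪ {x, y}

theorem mem_withEnds {C : Set V} {x y v : V} : v ∈ withEnds C x y ↔ v ∈ C ∨ v = x ∨ v = y := by
  simp only [withEnds, Set.mem_union, Set.mem_insert_iff, Set.mem_singleton_iff]

/-- An excursion of `B` out of `C ∪ {x, y}` leaves and returns through `x` or `y`, and the edge `xy`
replaces it. -/
theorem IsAttachedAt.isConn_inter {B C : Set V} {x y : V} (hC : G.IsAttachedAt C x y)
    (hxy : x ≠ y) (hB : G.IsConn B) (hne : (B ∩ withEnds C x y).Nonempty) :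
    (G ⊔ edge x y).IsConn (B ∩ withEnds C x y) := by
  refine ⟨hne, fun Q hQ => ?_⟩
  have hxD : x ∈ withEnds C x y := by simp
  have hyD : y ∈ withEnds C x y := by simp
  have hxyQ : x ∈ B → y ∈ B → (Q x ↔ Q y) := fun hx hy =>
    ⟨hQ x ⟨hx, hxD⟩ y ⟨hy, hyD⟩ (.inr ((edge_adj ..).2 ⟨.inl ⟨rfl, rfl⟩, hxy⟩)),
      hQ y ⟨hy, hyD⟩ x ⟨hx, hxD⟩ (.inr ((edge_adj ..).2 ⟨.inr ⟨rfl, rfl⟩, hxy.symm⟩))⟩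
  -- At outside vertices the extended property records that `Q` holds at an end lying in `B`. Both
  -- ends agree when both are in `B`, thanks to the edge `xy`.
  have H := hB.2 (fun v => (v ∈ withEnds C x y ∧ Q v) ∨
    (v ∉ withEnds C x y ∧ ((x ∈ B ∧ Q x) ∨ (y ∈ B ∧ Q y)))) ?_
  · rintro u ⟨hu, huD⟩ v ⟨hv, hvD⟩ h
    rcases H u hu v hv (.inl ⟨huD, h⟩) with h | h
    · exact h.2
    · exact absurd hvD h.1
  · have gate : ∀ u ∈ withEnds C x y, ∀ v, v ∉ withEnds C x y → G.Adj u v → u = x ∨ u = y := by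
      intro u hu v hv h
      rcases mem_withEnds.1 hu with hu | hu
      · exact absurd (mem_withEnds.2 (hC.2.2 u hu v h)) hv
      · exact hu
    intro u hu v hv huv
    rintro (⟨huD, h⟩ | ⟨huD, h⟩)
    · by_cases hvD : v ∈ withEnds C x y
      · exact .inl ⟨hvD, hQ u ⟨hu, huD⟩ v ⟨hv, hvD⟩ (.inl huv) h⟩
      · refine .inr ⟨hvD, ?_⟩
        rcases gate u huD v hvD huv with rfl | rfl
        · exact .inl ⟨hu, h⟩
        · exact .inr ⟨hu, h⟩
    · by_cases hvD : v ∈ withEnds C x y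
      · refine .inl ⟨hvD, ?_⟩
        rcases gate v hvD u huD huv.symm with rfl | rfl
        · rcases h with h | h
          · exact h.2
          · exact (hxyQ hv h.1).2 h.2
        · rcases h with h | h
          · exact (hxyQ h.1 hv).1 h.2
          · exact h.2
      · exact .inr ⟨hvD, h⟩

theorem IsAttachedAt.end_mem {B C : Set V} {x y : V} (hC : G.IsAttachedAt C x y)
    (hB : G.IsConn B) (hne : (B ∩ withEnds C x y).Nonempty) (hBC : ¬ B ⊆ C) : x ∈ B ∨ y ∈ B := by
  by_contra! hcon
  obtain ⟨b, hb, hbD⟩ := hne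
  have hbC : b ∈ C := by
    rcases mem_withEnds.1 hbD with h | rfl | rfl
    exacts [h, absurd hb hcon.1, absurd hb hcon.2]
  obtain ⟨b', hb', hb'C⟩ := Set.not_subset.1 hBC
  obtain ⟨u, hu, v, hv, huv, hQu, hQv⟩ := hB.exists_adj (Q := (· ∈ C)) hb hb' hbC hb'C
  rcases hC.2.2 u hQu v huv with h | rfl | rfl
  exacts [hQv h, hcon.1 hv, hcon.2 hv]

/-! ### How a `K_{2,4}` model can meet an ordered piece -/

/-- A model of `K_{2,4}`, with the branch sets `P`, `Q` of the vertices of degree four and the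
branch sets `S j` of the vertices of degree two. -/
structure IsK24Model (G : SimpleGraph V) (P Q : Set V) (S : Fin 4 → Set V) : Prop where
  conn_left : G.IsConn P
  conn_right : G.IsConn Q
  conn : ∀ j, G.IsConn (S j)
  disjoint_hubs : Disjoint P Q
  disjoint_left : ∀ j, Disjoint P (S j)
  disjoint_right : ∀ j, Disjoint Q (S j)
  disjoint : ∀ i j, i ≠ j → Disjoint (S i) (S j)
  touch_left : ∀ j, G.Touch P (S j)
  touch_right : ∀ j, G.Touch Q (S j)

theorem IsK24Model.symm {P Q : Set V} {S : Fin 4 → Set V} (h : G.IsK24Model P Q S) :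
    G.IsK24Model Q P S :=
  ⟨h.2, h.1, h.3, h.4.symm, h.6, h.5, h.7, h.9, h.8⟩

theorem isK24MinorFree_iff : G.IsK24MinorFree ↔ ∀ P Q S, ¬ G.IsK24Model P Q S := by
  constructor
  · intro h P Q S hm
    refine h ⟨Sum.elim ![P, Q] S, ?_, ?_, ?_⟩
    · rintro (i | j)
      · fin_cases i
        · exact connected_induce_iff_isConn.2 hm.conn_left
        · exact connected_induce_iff_isConn.2 hm.conn_right
      · exact connected_induce_iff_isConn.2 (hm.conn j)
    · have hl : ∀ i j, Disjoint ((![P, Q] : Fin 2 → Set V) i) (S j) := by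
        intro i j
        fin_cases i
        exacts [hm.disjoint_left j, hm.disjoint_right j]
      rintro (i | i) (j | j) hij
      · fin_cases i <;> fin_cases j <;>
          first | exact absurd rfl hij | exact hm.disjoint_hubs | exact hm.disjoint_hubs.symm
      · exact hl i j
      · exact (hl j i).symm
      · exact hm.disjoint i j (by simpa using hij)
    · have hl : ∀ i j, G.Touch ((![P, Q] : Fin 2 → Set V) i) (S j) := by
        intro i j
        fin_cases i
        exacts [hm.touch_left j, hm.touch_right j]
      rintro (i | i) (j | j) hij
      · simp at hij
      · exact hl i j
      · exact (hl j i).symm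
      · simp at hij
  · rintro h ⟨B, hB, hd, ha⟩
    have hC : ∀ w, G.IsConn (B w) := fun w => connected_induce_iff_isConn.1 (hB w)
    exact h (B (.inl 0)) (B (.inl 1)) (fun j => B (.inr j))
      ⟨hC _, hC _, fun _ => hC _, hd _ _ (by simp), fun _ => hd _ _ (by simp),
        fun _ => hd _ _ (by simp), fun i j hij => hd _ _ (by simpa using hij),
        fun _ => ha _ _ (by simp), fun _ => ha _ _ (by simp)⟩

/-- `C` is attached at `x` and `y`, and `C ∪ {x, y}` has an order from `x` to `y` without
crossings. -/
def IsOrderedPiece (G : SimpleGraph V) (C : Set V) (x y : V) : Prop :=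
  x ≠ y ∧ G.IsAttachedAt C x y ∧ ∃ f : V → ℕ, Set.InjOn f (withEnds C x y) ∧
    (∀ v ∈ withEnds C x y, f x ≤ f v ∧ f v ≤ f y) ∧ G.IsNoncrossingOn f (withEnds C x y)

namespace IsK24Model

variable {P Q : Set V} {S : Fin 4 → Set V}

/-- If a hub lay in `C`, all other branch sets would meet `C ∪ {x, y}`, and cutting them down to
this set would give a `K_{2,3}` after adding the edge `xy`, which does not affect noncrossing. -/
theorem not_hub_subset (h : G.IsK24Model P Q S) {C : Set V} {x y : V}
    (hC : G.IsOrderedPiece C x y) : ¬ P ⊆ C := by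
  intro hP
  obtain ⟨hxy, hat, f, hf, hfxy, hnc⟩ := hC
  have hPD : P ⊆ withEnds C x y := fun v hv => mem_withEnds.2 (.inl (hP hv))
  have hS : ∀ j, (S j ∩ withEnds C x y).Nonempty := by
    intro j
    obtain ⟨a, ha, b, hb, hab⟩ := h.touch_left j
    exact ⟨b, hb, mem_withEnds.2 (hat.2.2 a (hP ha) b hab)⟩
  -- Otherwise no `S j` lies inside `C`, so each of the disjoint sets `S 0`, `S 1`, `S 2` contains
  -- one of only two ends.
  have hQ : (Q ∩ withEnds C x y).Nonempty := by
    by_contra hQ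
    have hend : ∀ j, x ∈ S j ∨ y ∈ S j := by
      intro j
      refine hat.end_mem (h.conn j) (hS j) fun hSC => hQ ?_
      obtain ⟨a, ha, b, hb, hab⟩ := h.touch_right j
      exact ⟨a, ha, mem_withEnds.2 (hat.2.2 b (hSC hb) a hab.symm)⟩
    have d01 := Set.disjoint_left.1 (h.disjoint 0 1 (by decide))
    have d02 := Set.disjoint_left.1 (h.disjoint 0 2 (by decide))
    have d12 := Set.disjoint_left.1 (h.disjoint 1 2 (by decide))
    rcases hend 0 with h0 | h0 <;> rcases hend 1 with h1 | h1 <;> rcases hend 2 with h2 | h2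
    exacts [d01 h0 h1, d01 h0 h1, d02 h0 h2, d12 h1 h2, d12 h1 h2, d02 h0 h2, d01 h0 h1, d01 h0 h1]
  have tP : ∀ j, (G ⊔ edge x y).Touch (P ∩ withEnds C x y) (S j ∩ withEnds C x y) := by
    intro j
    obtain ⟨a, ha, b, hb, hab⟩ := h.touch_left j
    exact ⟨a, ⟨ha, hPD ha⟩, b, ⟨hb, mem_withEnds.2 (hat.2.2 a (hP ha) b hab)⟩, .inl hab⟩
  have tQ : ∀ j, (G ⊔ edge x y).Touch (Q ∩ withEnds C x y) (S j ∩ withEnds C x y) := by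
    intro j
    obtain ⟨a, ha, b, hb, hab⟩ := h.touch_right j
    by_cases hQC : Q ⊆ C
    · exact ⟨a, ⟨ha, mem_withEnds.2 (.inl (hQC ha))⟩, b,
        ⟨hb, mem_withEnds.2 (hat.2.2 a (hQC ha) b hab)⟩, .inl hab⟩
    by_cases hSC : S j ⊆ C
    · exact ⟨a, ⟨ha, mem_withEnds.2 (hat.2.2 b (hSC hb) a hab.symm)⟩, b,
        ⟨hb, mem_withEnds.2 (.inl (hSC hb))⟩, .inl hab⟩
    -- Neither set lies in `C`, so each contains an end. The ends differ by disjointness, and the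
    -- added edge `xy` joins the sets.
    have hxD : x ∈ withEnds C x y := by simp
    have hyD : y ∈ withEnds C x y := by simp
    have dQ := Set.disjoint_left.1 (h.disjoint_right j)
    rcases hat.end_mem h.conn_right hQ hQC with h1 | h1 <;>
      rcases hat.end_mem (h.conn j) (hS j) hSC with h2 | h2
    · exact absurd h2 (dQ h1)
    · exact ⟨x, ⟨h1, hxD⟩, y, ⟨h2, hyD⟩, .inr ((edge_adj ..).2 ⟨.inl ⟨rfl, rfl⟩, hxy⟩)⟩
    · exact ⟨y, ⟨h1, hyD⟩, x, ⟨h2, hxD⟩, .inr ((edge_adj ..).2 ⟨.inr ⟨rfl, rfl⟩, hxy.symm⟩)⟩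
    · exact absurd h2 (dQ h1)
  obtain ⟨p, hp⟩ := h.conn_left.1
  have e : Fin 3 ↪ Fin 4 := Fin.castSuccEmb
  exact (hnc.sup_edge hfxy).not_K23 hf (P := P ∩ withEnds C x y) (Q := Q ∩ withEnds C x y)
    (S := fun j => S (e j) ∩ withEnds C x y) Set.inter_subset_right Set.inter_subset_right
    (fun _ => Set.inter_subset_right) (hat.isConn_inter hxy h.conn_left ⟨p, hp, hPD hp⟩)
    (hat.isConn_inter hxy h.conn_right hQ) (fun j => hat.isConn_inter hxy (h.conn _) (hS _))
    (h.disjoint_hubs.mono Set.inter_subset_left Set.inter_subset_left)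
    (fun j => (h.disjoint_left _).mono Set.inter_subset_left Set.inter_subset_left)
    (fun j => (h.disjoint_right _).mono Set.inter_subset_left Set.inter_subset_left)
    (fun i j hij => (h.disjoint _ _ (e.injective.ne hij)).mono Set.inter_subset_left
      Set.inter_subset_left) (fun j => tP _) (fun j => tQ _)

/-- Both hubs reach the branch set inside `C` but neither lies in `C`, so each holds one of the two
ends. -/
theorem end_mem_of_subset (h : G.IsK24Model P Q S) {C : Set V} {x y : V}
    (hC : G.IsOrderedPiece C x y) {j : Fin 4} (hj : S j ⊆ C) :
    (x ∈ P ∧ y ∈ Q) ∨ (y ∈ P ∧ x ∈ Q) := by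
  have hm : ∀ {P Q}, G.IsK24Model P Q S → x ∈ P ∨ y ∈ P := by
    intro P Q h
    obtain ⟨a, ha, b, hb, hab⟩ := h.touch_left j
    exact hC.2.1.end_mem h.conn_left ⟨a, ha, mem_withEnds.2 (hC.2.1.2.2 b (hj hb) a hab.symm)⟩
      (h.not_hub_subset hC)
  have d := Set.disjoint_left.1 h.disjoint_hubs
  rcases hm h with h1 | h1 <;> rcases hm h.symm with h2 | h2
  exacts [absurd h2 (d h1), .inl ⟨h1, h2⟩, .inr ⟨h1, h2⟩, absurd h2 (d h1)]

/-- Two branch sets in `C`, together with the traces of the hubs that hold the ends, would form a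
rooted `K_{2,2}`. -/
theorem eq_of_subset (h : G.IsK24Model P Q S) {C : Set V} {x y : V}
    (hC : G.IsOrderedPiece C x y) {i j : Fin 4} (hi : S i ⊆ C) (hj : S j ⊆ C) : i = j := by
  by_contra hij
  have key : ∀ {P Q}, G.IsK24Model P Q S → x ∈ P → y ∈ Q → False := by
    intro P Q h hx hy
    obtain ⟨hxy, hat, f, hf, hfxy, hnc⟩ := hC
    have hxD : x ∈ withEnds C x y := by simp
    have hyD : y ∈ withEnds C x y := by simp
    have hsub : ∀ {T : Set V}, T ⊆ C → T ⊆ withEnds C x y := fun hT v hv =>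
      mem_withEnds.2 (.inl (hT hv))
    have htouch : ∀ {P Q k}, G.IsK24Model P Q S → S k ⊆ C →
        (G ⊔ edge x y).Touch (P ∩ withEnds C x y) (S k) := by
      intro P Q k h hk
      obtain ⟨a, ha, b, hb, hab⟩ := h.touch_left k
      exact ⟨a, ⟨ha, mem_withEnds.2 (hat.2.2 b (hk hb) a hab.symm)⟩, b, hb, .inl hab⟩
    have hmono : ∀ k, (G ⊔ edge x y).IsConn (S k) := fun k =>
      ⟨(h.conn k).1, fun R hR => (h.conn k).2 R fun u hu v hv huv => hR u hu v hv (.inl huv)⟩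
    exact (hnc.sup_edge hfxy).not_hasRootedK22 hf hfxy ⟨P ∩ withEnds C x y, Q ∩ withEnds C x y,
      S i, S j, ⟨Set.inter_subset_right, Set.inter_subset_right, hsub hi, hsub hj⟩,
      ⟨hat.isConn_inter hxy h.conn_left ⟨x, hx, hxD⟩, hat.isConn_inter hxy h.conn_right ⟨y, hy, hyD⟩,
        hmono i, hmono j⟩, ⟨⟨hx, hxD⟩, hy, hyD⟩,
      ⟨h.disjoint_hubs.mono Set.inter_subset_left Set.inter_subset_left,
        (h.disjoint_left _).mono_left Set.inter_subset_left,
        (h.disjoint_left _).mono_left Set.inter_subset_left,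
        (h.disjoint_right _).mono_left Set.inter_subset_left,
        (h.disjoint_right _).mono_left Set.inter_subset_left, h.disjoint i j hij⟩,
      htouch h hi, htouch h.symm hi, htouch h hj, htouch h.symm hj⟩
  rcases h.end_mem_of_subset hC hi with ⟨h1, h2⟩ | ⟨h1, h2⟩
  · exact key h h1 h2
  · exact key h.symm h2 h1

end IsK24Model


/-! ### Replacing pieces by paths of length two -/

/-- The vertices of `G` outside `W` are distributed over disjoint ordered pieces, each attached at
two vertices of `W`. -/
structure IsPieceDecomposition {ι : Type*} (G : SimpleGraph V) (W : Set V) (C : ι → Set V)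
    (x y : ι → V) : Prop where
  left_mem : ∀ i, x i ∈ W
  right_mem : ∀ i, y i ∈ W
  notMem : ∀ i, ∀ v ∈ C i, v ∉ W
  disjoint : ∀ i j, i ≠ j → Disjoint (C i) (C j)
  cover : ∀ v, v ∈ W ∨ ∃ i, v ∈ C i
  piece : ∀ i, G.IsOrderedPiece (C i) (x i) (y i)

namespace IsPieceDecomposition

variable {ι : Type*} {W : Set V} {C : ι → Set V} {x y : ι → V}

/-- The set of vertices of the reduced graph, in which each piece is replaced by a single vertex,
corresponding to the set `T`; the vertex of the piece `i` goes to a set inside the piece if there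
is one (that is, if `N i` holds), and to the set containing `x i` otherwise. -/
def reduce (W : Set V) (C : ι → Set V) (x : ι → V) (N : ι → Prop) (T : Set V) : Set (W ⊕ ι) :=
  {w | (∃ v : W, (v : V) ∈ T ∧ w = .inl v) ∨ ∃ i, (T ⊆ C i ∨ ¬ N i ∧ x i ∈ T) ∧ w = .inr i}

theorem inl_mem_reduce {N : ι → Prop} {T : Set V} {v : W} :
    .inl v ∈ reduce W C x N T ↔ (v : V) ∈ T := by
  simp [reduce]

theorem inr_mem_reduce {N : ι → Prop} {T : Set V} {i : ι} :
    .inr i ∈ reduce W C x N T ↔ (T ⊆ C i ∨ ¬ N i ∧ x i ∈ T) := by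
  simp [reduce]

/-- `H` contains the graph obtained from `G` by replacing every piece by a path of length two. -/
structure IsReduction (G : SimpleGraph V) (W : Set V) (x y : ι → V) (H : SimpleGraph (W ⊕ ι)) :
    Prop where
  adj_left : ∀ i (v : W), (v : V) = x i → H.Adj (.inl v) (.inr i)
  adj_right : ∀ i (v : W), (v : V) = y i → H.Adj (.inl v) (.inr i)
  adj : ∀ u v : W, G.Adj u v → H.Adj (.inl u) (.inl v) ∨
    ∃ i, ((u : V) = x i ∧ (v : V) = y i) ∨ ((u : V) = y i ∧ (v : V) = x i)

variable {H : SimpleGraph (W ⊕ ι)}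

/-- By `hN`, a piece with both ends in `T` contributes its vertex, so a passage of `T` through the
piece becomes a path of length two. A set inside a single piece becomes a single vertex. -/
theorem isConn_reduce (hd : G.IsPieceDecomposition W C x y) (hH : IsReduction G W x y H)
    {N : ι → Prop} {T : Set V} (hT : G.IsConn T) (hN : ∀ i, x i ∈ T → y i ∈ T → ¬ N i) :
    H.IsConn (reduce W C x N T) := by
  by_cases hin : ∃ i, T ⊆ C i
  · obtain ⟨i, hi⟩ := hin
    have : reduce W C x N T = {.inr i} := by
      ext w
      rcases w with v | j
      · rw [inl_mem_reduce]
        simp only [Set.mem_singleton_iff, reduceCtorEq, iff_false]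
        exact fun hv => hd.notMem i v (hi hv) v.2
      · rw [inr_mem_reduce]
        simp only [Set.mem_singleton_iff, Sum.inr.injEq]
        constructor
        · rintro (h | h)
          · by_contra hij
            obtain ⟨t, ht⟩ := hT.1
            exact Set.disjoint_left.1 (hd.disjoint j i hij) (h ht) (hi ht)
          · exact absurd (hd.left_mem j) (hd.notMem i _ (hi h.2))
        · rintro rfl
          exact .inl hi
    rw [this]
    exact isConn_singleton _
  push Not at hin
  have hpiece : ∀ i u v, u ∈ C i → G.Adj u v → v ∈ C i ∨ v = x i ∨ v = y i := fun i u v hu h =>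
    (hd.piece i).2.1.2.2 u hu v h
  refine ⟨?_, fun R hR => ?_⟩
  · obtain ⟨t, ht⟩ := hT.1
    rcases hd.cover t with h | ⟨i, hi⟩
    · exact ⟨.inl ⟨t, h⟩, inl_mem_reduce.2 ht⟩
    · rcases (hd.piece i).2.1.end_mem hT ⟨t, ht, .inl hi⟩ (hin i) with h | h
      · exact ⟨.inl ⟨x i, hd.left_mem i⟩, inl_mem_reduce.2 h⟩
      · exact ⟨.inl ⟨y i, hd.right_mem i⟩, inl_mem_reduce.2 h⟩
  -- the property on `V` corresponding to `R`
  let X : ι → W := fun i => ⟨x i, hd.left_mem i⟩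
  let Y : ι → W := fun i => ⟨y i, hd.right_mem i⟩
  have hXY : ∀ i, x i ∈ T → y i ∈ T → (R (.inl (X i)) ↔ R (.inl (Y i))) := by
    intro i hx hy
    have hi : Sum.inr i ∈ reduce W C x N T := inr_mem_reduce.2 (.inr ⟨hN i hx hy, hx⟩)
    have hX : Sum.inl (X i) ∈ reduce W C x N T := inl_mem_reduce.2 hx
    have hY : Sum.inl (Y i) ∈ reduce W C x N T := inl_mem_reduce.2 hy
    have aX := hH.adj_left i (X i) rfl
    have aY := hH.adj_right i (Y i) rfl
    exact ⟨fun h => hR _ hi _ hY aY.symm (hR _ hX _ hi aX h),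
      fun h => hR _ hi _ hX aX.symm (hR _ hY _ hi aY h)⟩
  let Z : V → Prop := fun v => (∃ w : W, (w : V) = v ∧ R (.inl w)) ∨
    ∃ i, v ∈ C i ∧ ((x i ∈ T ∧ R (.inl (X i))) ∨ (y i ∈ T ∧ R (.inl (Y i))))
  have hZW : ∀ w : W, Z w ↔ R (.inl w) := by
    intro w
    constructor
    · rintro (⟨w', hw', h⟩ | ⟨i, hi, -⟩)
      · rwa [← Subtype.ext hw']
      · exact absurd w.2 (hd.notMem i _ hi)
    · exact fun h => .inl ⟨w, rfl, h⟩
  have hZC : ∀ i, ∀ v ∈ C i, Z v ↔ ((x i ∈ T ∧ R (.inl (X i))) ∨ (y i ∈ T ∧ R (.inl (Y i)))) := by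
    intro i v hv
    constructor
    · rintro (⟨w', hw', -⟩ | ⟨j, hj, h⟩)
      · exact absurd w'.2 (hw' ▸ hd.notMem i _ hv)
      · obtain rfl : i = j := by
          by_contra hij
          exact Set.disjoint_left.1 (hd.disjoint i j hij) hv hj
        exact h
    · exact fun h => .inr ⟨i, hv, h⟩
  have hends : ∀ i, (x i ∈ T ∧ R (.inl (X i))) ∨ (y i ∈ T ∧ R (.inl (Y i))) →
      ∀ v : W, (v : V) ∈ T → (v : V) = x i ∨ (v : V) = y i → R (.inl v) := by
    rintro i h v hv (hvx | hvy)
    · obtain rfl : v = X i := Subtype.ext hvx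
      rcases h with h | h
      · exact h.2
      · exact (hXY i hv h.1).2 h.2
    · obtain rfl : v = Y i := Subtype.ext hvy
      rcases h with h | h
      · exact (hXY i h.1 hv).1 h.2
      · exact h.2
  have hZ := hT.2 Z (by
    intro u hu v hv huv h
    rcases hd.cover u with huW | ⟨i, hi⟩
    · lift u to W using huW
      rw [hZW] at h
      rcases hd.cover v with hvW | ⟨i, hi⟩
      · lift v to W using hvW
        rw [hZW]
        rcases hH.adj u v huv with hadj | ⟨i, ⟨h1, h2⟩ | ⟨h1, h2⟩⟩
        · exact hR _ (inl_mem_reduce.2 hu) _ (inl_mem_reduce.2 hv) hadj h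
        · obtain rfl : u = X i := Subtype.ext h1
          obtain rfl : v = Y i := Subtype.ext h2
          exact (hXY i hu hv).1 h
        · obtain rfl : u = Y i := Subtype.ext h1
          obtain rfl : v = X i := Subtype.ext h2
          exact (hXY i hv hu).2 h
      · rw [hZC i v hi]
        rcases hpiece i v u hi huv.symm with h' | h' | h'
        · exact absurd u.2 (hd.notMem i _ h')
        · obtain rfl : u = X i := Subtype.ext h'
          exact .inl ⟨hu, h⟩
        · obtain rfl : u = Y i := Subtype.ext h'
          exact .inr ⟨hu, h⟩
    · rw [hZC i u hi] at h
      rcases hd.cover v with hvW | ⟨j, hj⟩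
      · lift v to W using hvW
        rw [hZW]
        refine hends i h v hv ((hpiece i u v hi huv).resolve_left fun h' => hd.notMem i _ h' v.2)
      · have hvi : v ∈ C i := by
          rcases hpiece i u v hi huv with h' | h' | h'
          · exact h'
          · exact absurd (hd.left_mem i) (h' ▸ hd.notMem j _ hj)
          · exact absurd (hd.right_mem i) (h' ▸ hd.notMem j _ hj)
        rwa [hZC i v hvi])
  have hR1 : ∀ w ∈ reduce W C x N T, R w → ∃ v : W, (v : V) ∈ T ∧ R (.inl v) := by
    rintro (v | i) hw h
    · exact ⟨v, inl_mem_reduce.1 hw, h⟩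
    · have hx := ((inr_mem_reduce.1 hw).resolve_left (hin i)).2
      exact ⟨X i, hx, hR _ hw _ (inl_mem_reduce.2 hx) (hH.adj_left i (X i) rfl).symm h⟩
  intro a ha b hb hRa
  obtain ⟨v, hv, hRv⟩ := hR1 a ha hRa
  have hall : ∀ w : W, (w : V) ∈ T → R (.inl w) := fun w hw =>
    (hZW w).1 (hZ v hv w hw ((hZW v).2 hRv))
  rcases b with w | i
  · exact hall w (inl_mem_reduce.1 hb)
  · have hx := ((inr_mem_reduce.1 hb).resolve_left (hin i)).2
    exact hR _ (inl_mem_reduce.2 hx) _ hb (hH.adj_left i (X i) rfl) (hall (X i) hx)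

/-- The case to settle is that the contact of `T` and `T'` is lost inside a piece. If neither set
lies in it, one end belongs to `T` and the other to `T'`. The vertex of the piece goes to the set
containing `x i` and is adjacent to the other end. -/
theorem touch_reduce (hd : G.IsPieceDecomposition W C x y) (hH : IsReduction G W x y H)
    {N : ι → Prop} {T T' : Set V} (hT : G.IsConn T) (hT' : G.IsConn T') (hdis : Disjoint T T')
    (htouch : G.Touch T T') (hTC : ∀ i, ¬ T ⊆ C i) (hN : ∀ i, N i → x i ∉ T' ∧ y i ∉ T') :
    H.Touch (reduce W C x N T) (reduce W C x N T') := by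
  have hpiece : ∀ i u v, u ∈ C i → G.Adj u v → v ∈ C i ∨ v = x i ∨ v = y i := fun i u v hu h =>
    (hd.piece i).2.1.2.2 u hu v h
  have hend := fun i => (hd.piece i).2.1.end_mem hT (hBC := hTC i)
  obtain ⟨a, ha, b, hb, hab⟩ := htouch
  let X : ι → W := fun i => ⟨x i, hd.left_mem i⟩
  let Y : ι → W := fun i => ⟨y i, hd.right_mem i⟩
  by_cases hin : ∃ i, T' ⊆ C i
  · obtain ⟨i, hi⟩ := hin
    have haD := hpiece i b a (hi hb) hab.symm
    have hb' : Sum.inr i ∈ reduce W C x N T' := inr_mem_reduce.2 (.inl hi)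
    rcases hend i ⟨a, ha, mem_withEnds.2 haD⟩ with h | h
    · exact ⟨.inl (X i), inl_mem_reduce.2 h, _, hb', hH.adj_left i _ rfl⟩
    · exact ⟨.inl (Y i), inl_mem_reduce.2 h, _, hb', hH.adj_right i _ rfl⟩
  push Not at hin
  have hend' := fun i => (hd.piece i).2.1.end_mem hT' (hBC := hin i)
  have hsplit : ∀ i, (x i ∈ T ∧ y i ∈ T') ∨ (y i ∈ T ∧ x i ∈ T') →
      H.Touch (reduce W C x N T) (reduce W C x N T') := by
    rintro i (⟨h1, h2⟩ | ⟨h1, h2⟩)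
    · exact ⟨.inr i, inr_mem_reduce.2 (.inr ⟨fun h => (hN i h).2 h2, h1⟩), .inl (Y i),
        inl_mem_reduce.2 h2, (hH.adj_right i _ rfl).symm⟩
    · exact ⟨.inl (Y i), inl_mem_reduce.2 h1, .inr i,
        inr_mem_reduce.2 (.inr ⟨fun h => (hN i h).1 h2, h2⟩), hH.adj_right i _ rfl⟩
  have hsplit' : ∀ i, a ∈ withEnds (C i) (x i) (y i) → b ∈ withEnds (C i) (x i) (y i) →
      H.Touch (reduce W C x N T) (reduce W C x N T') := by
    intro i h1 h2
    have d := Set.disjoint_left.1 hdis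
    rcases hend i ⟨a, ha, h1⟩ with h | h <;> rcases hend' i ⟨b, hb, h2⟩ with h' | h'
    · exact absurd h' (d h)
    · exact hsplit i (.inl ⟨h, h'⟩)
    · exact hsplit i (.inr ⟨h, h'⟩)
    · exact absurd h' (d h)
  rcases hd.cover a with haW | ⟨i, hi⟩
  · rcases hd.cover b with hbW | ⟨i, hi⟩
    · lift a to W using haW
      lift b to W using hbW
      rcases hH.adj a b hab with h | ⟨i, ⟨h1, h2⟩ | ⟨h1, h2⟩⟩
      · exact ⟨_, inl_mem_reduce.2 ha, _, inl_mem_reduce.2 hb, h⟩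
      · exact hsplit i (.inl ⟨h1 ▸ ha, h2 ▸ hb⟩)
      · exact hsplit i (.inr ⟨h1 ▸ ha, h2 ▸ hb⟩)
    · exact hsplit' i (mem_withEnds.2 (hpiece i b a hi hab.symm)) (.inl hi)
  · exact hsplit' i (.inl hi) (mem_withEnds.2 (hpiece i a b hi hab))

/-- A model of `K_{2,4}` in `G` yields one in the graph with all pieces replaced by paths. -/
theorem exists_isK24Model (hd : G.IsPieceDecomposition W C x y) (hH : IsReduction G W x y H)
    {P Q : Set V} {S : Fin 4 → Set V} (h : G.IsK24Model P Q S) :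
    ∃ P' Q' S', H.IsK24Model P' Q' S' := by
  -- The vertices of these pieces are reserved for the branch sets inside them. The ends of such a
  -- piece lie in different hubs, so no branch set needs its vertex as a connection.
  let N : ι → Prop := fun i => ∃ j, S j ⊆ C i
  have hP : ∀ i, ¬ P ⊆ C i := fun i => h.not_hub_subset (hd.piece i)
  have hQ : ∀ i, ¬ Q ⊆ C i := fun i => h.symm.not_hub_subset (hd.piece i)
  have hNend : ∀ i, N i → (x i ∈ P ∧ y i ∈ Q) ∨ (y i ∈ P ∧ x i ∈ Q) := fun i ⟨j, hj⟩ =>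
    h.end_mem_of_subset (hd.piece i) hj
  have dPQ := Set.disjoint_left.1 h.disjoint_hubs
  have hNS : ∀ j i, N i → x i ∉ S j ∧ y i ∉ S j := by
    intro j i hN
    have dP := Set.disjoint_left.1 (h.disjoint_left j)
    have dQ := Set.disjoint_left.1 (h.disjoint_right j)
    rcases hNend i hN with ⟨h1, h2⟩ | ⟨h1, h2⟩
    · exact ⟨dP h1, dQ h2⟩
    · exact ⟨dQ h2, dP h1⟩
  have hdis : ∀ T T', Disjoint T T' → (∀ i, T ⊆ C i → N i) → (∀ i, T' ⊆ C i → N i) →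
      (∀ i, T ⊆ C i → ¬ T' ⊆ C i) → Disjoint (reduce W C x N T) (reduce W C x N T') := by
    intro T T' hTT h1 h2 h3
    rw [Set.disjoint_left]
    rintro (v | i) hv hv'
    · exact Set.disjoint_left.1 hTT (inl_mem_reduce.1 hv) (inl_mem_reduce.1 hv')
    · rcases inr_mem_reduce.1 hv with h | h <;> rcases inr_mem_reduce.1 hv' with h' | h'
      · exact h3 i h h'
      · exact h'.1 (h1 i h)
      · exact h.1 (h2 i h')
      · exact Set.disjoint_left.1 hTT h.2 h'.2
  have hPN : ∀ i, P ⊆ C i → N i := fun i h => absurd h (hP i)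
  have hQN : ∀ i, Q ⊆ C i → N i := fun i h => absurd h (hQ i)
  have hSN : ∀ j i, S j ⊆ C i → N i := fun j i h => ⟨j, h⟩
  refine ⟨reduce W C x N P, reduce W C x N Q, fun j => reduce W C x N (S j), ?_⟩
  refine ⟨hd.isConn_reduce hH h.conn_left fun i hx hy hN => ?_,
    hd.isConn_reduce hH h.conn_right fun i hx hy hN => ?_,
    fun j => hd.isConn_reduce hH (h.conn j) fun i hx hy hN => (hNS j i hN).1 hx,
    hdis _ _ h.disjoint_hubs hPN hQN fun i h' => absurd h' (hP i),
    fun j => hdis _ _ (h.disjoint_left j) hPN (hSN j) fun i h' => absurd h' (hP i),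
    fun j => hdis _ _ (h.disjoint_right j) hQN (hSN j) fun i h' => absurd h' (hQ i),
    fun i j hij => hdis _ _ (h.disjoint i j hij) (hSN i) (hSN j)
      fun k h1 h2 => hij (h.eq_of_subset (hd.piece k) h1 h2),
    fun j => hd.touch_reduce hH h.conn_left (h.conn j) (h.disjoint_left j) (h.touch_left j) hP (hNS j),
    fun j => hd.touch_reduce hH h.conn_right (h.conn j) (h.disjoint_right j) (h.touch_right j) hQ
      (hNS j)⟩
  · rcases hNend i hN with ⟨-, h2⟩ | ⟨-, h2⟩
    exacts [dPQ hy h2, dPQ hx h2]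
  · rcases hNend i hN with ⟨h1, -⟩ | ⟨h1, -⟩
    exacts [dPQ h1 hx, dPQ h1 hy]

end IsPieceDecomposition


/-! ### The three kinds of graphs are `K_{2,4}`-minor-free -/

theorem Subgraph.IsPathOuterplanar.isOrderedPiece {H : G.Subgraph} {x y : V}
    (h : H.IsPathOuterplanar x y) (hxy : x ≠ y)
    (hadj : ∀ u ∈ H.verts, ∀ v, u ≠ x → u ≠ y → G.Adj u v → H.Adj u v) :
    G.IsOrderedPiece (H.verts \ {x, y}) x y := by
  classical
  obtain ⟨hx, hy, hpo⟩ := h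
  obtain ⟨f, hf, hfxy, hnc⟩ := hpo.exists_isNoncrossing
  have hD : withEnds (H.verts \ {x, y}) x y = H.verts := by
    ext v
    rw [mem_withEnds]
    simp only [Set.mem_sdiff, Set.mem_insert_iff, Set.mem_singleton_iff]
    constructor
    · rintro (h | rfl | rfl)
      exacts [h.1, hx, hy]
    · tauto
  refine ⟨hxy, ⟨by simp, by simp, ?_⟩, fun v => if h : v ∈ H.verts then f ⟨v, h⟩ else 0, ?_, ?_, ?_⟩
  · rintro u ⟨hu, huxy⟩ v huv
    simp only [Set.mem_insert_iff, Set.mem_singleton_iff, not_or] at huxy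
    have := (hadj u hu v huxy.1 huxy.2 huv).snd_mem
    simp only [Set.mem_sdiff, Set.mem_insert_iff, Set.mem_singleton_iff]
    tauto
  · rw [hD]
    intro u hu v hv huv
    simp only [dif_pos hu, dif_pos hv] at huv
    exact congrArg Subtype.val (hf huv)
  · rw [hD]
    intro v hv
    simp only [dif_pos hv, dif_pos hx, dif_pos hy]
    exact hfxy _
  · rw [hD]
    intro a ha b hb c hc d hd
    simp only [dif_pos ha, dif_pos hb, dif_pos hc, dif_pos hd]
    intro h1 h2 h3 hac hbd
    -- The only edge of `G` on these vertices that may be missing from `H` is `xy`. It spans the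
    -- whole order, so it takes part in no crossing.
    have hH : ∀ u (hu : u ∈ H.verts) v (hv : v ∈ H.verts), G.Adj u v →
        f ⟨x, hx⟩ < f ⟨u, hu⟩ ∨ f ⟨v, hv⟩ < f ⟨y, hy⟩ → f ⟨u, hu⟩ < f ⟨v, hv⟩ → H.Adj u v := by
      intro u hu v hv huv hor hlt
      by_cases hux : u = x ∨ u = y
      · by_cases hvx : v = x ∨ v = y
        · exfalso
          have := (hfxy ⟨y, hy⟩).1
          rcases hux with rfl | rfl <;> rcases hvx with rfl | rfl <;> omega
        · push Not at hvx
          exact (hadj v hv u hvx.1 hvx.2 huv.symm).symm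
      · push Not at hux
        exact hadj u hu v hux.1 hux.2 huv
    have h4 := hfxy ⟨a, ha⟩
    have h5 := hfxy ⟨d, hd⟩
    exact hnc ⟨a, ha⟩ ⟨b, hb⟩ ⟨c, hc⟩ ⟨d, hd⟩ h1 h2 h3
      (hH a ha c hc hac (.inr (by omega)) (by omega)) (hH b hb d hd hbd (.inl (by omega)) (by omega))

theorem isK24MinorFree_of_card_lt [Finite V] (h : Nat.card V < 6) : G.IsK24MinorFree := by
  rintro ⟨B, hB, hd, -⟩
  choose b hb using fun w => (connected_induce_iff_isConn.1 (hB w)).1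
  have hinj : Function.Injective b := fun w w' hww => by
    by_contra hne
    exact Set.disjoint_left.1 (hd w w' hne) (hb w) (hww ▸ hb w')
  have := Nat.card_le_card_of_injective b hinj
  simp at this
  omega

/-- The reduced graph has the two ends and one vertex per piece, five in all, whereas a model needs
six disjoint branch sets. So even the complete graph serves as the reduction. -/
theorem IsTriplePathOuterplanarUnion.isK24MinorFree (hG : G.IsTriplePathOuterplanarUnion) :
    G.IsK24MinorFree := by
  obtain ⟨x, y, H, hH, hcard, hinter, htop⟩ := hG
  -- For `x = y` the first and last positions coincide, leaving one vertex instead of three.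
  have hxy : x ≠ y := by
    rintro rfl
    obtain ⟨hx, hy, hpo⟩ := hH 0
    obtain ⟨f, hf, hfxy, -⟩ := hpo.exists_isNoncrossing
    have hsub : (H 0).verts ⊆ {x} := fun v hv => by
      have := hf (le_antisymm (hfxy ⟨v, hv⟩).1 (hfxy ⟨v, hv⟩).2)
      simpa using (congrArg Subtype.val this).symm
    have := Set.ncard_le_ncard hsub
    have := hcard 0
    simp at *
    omega
  have hmem : ∀ i j v, v ∈ (H i).verts → v ∈ (H j).verts → v ≠ x → v ≠ y → i = j := by
    intro i j v hi hj hx hy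
    by_contra hij
    have : v ∈ (H i).verts ∩ (H j).verts := ⟨hi, hj⟩
    rw [hinter i j hij] at this
    simp [hx, hy] at this
  have hAdj : ∀ u v, u ≠ x → u ≠ y → G.Adj u v → ∃ i, (H i).Adj u v := by
    intro u v hux huy huv
    have huv' : (⊤ : G.Subgraph).Adj u v := huv
    rcases htop with h | ⟨hadj, h⟩
    · rw [← h] at huv'
      simpa only [Subgraph.iSup_adj] using huv'
    · rw [← h, Subgraph.sup_adj] at huv'
      rcases huv' with h | h
      · simpa only [Subgraph.iSup_adj] using h
      · simp only [subgraphOfAdj_adj, Sym2.eq_iff] at h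
        rcases h with ⟨rfl, -⟩ | ⟨-, rfl⟩
        exacts [absurd rfl hux, absurd rfl huy]
  have hverts : ∀ v, v = x ∨ v = y ∨ ∃ i, v ∈ (H i).verts := by
    intro v
    have hv : v ∈ (⊤ : G.Subgraph).verts := trivial
    rcases htop with h | ⟨hadj, h⟩
    · rw [← h] at hv
      right; right; simpa only [Subgraph.verts_iSup, Set.mem_iUnion] using hv
    · rw [← h, Subgraph.verts_sup] at hv
      rcases hv with h | h
      · right; right; simpa only [Subgraph.verts_iSup, Set.mem_iUnion] using h
      · simp at h; tauto
  have hd : G.IsPieceDecomposition {x, y} (fun i => (H i).verts \ {x, y}) (fun _ => x)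
      (fun _ => y) := by
    refine ⟨by simp, by simp, fun i v hv => hv.2, ?_, ?_, ?_⟩
    · intro i j hij
      rw [Set.disjoint_left]
      rintro v ⟨hv, hv'⟩ ⟨hw, -⟩
      simp only [Set.mem_insert_iff, Set.mem_singleton_iff, not_or] at hv'
      exact hij (hmem i j v hv hw hv'.1 hv'.2)
    · intro v
      by_cases hv : v ∈ ({x, y} : Set V)
      · exact .inl hv
      · right
        have hv' := hv
        simp only [Set.mem_insert_iff, Set.mem_singleton_iff, not_or] at hv'
        obtain ⟨i, hi⟩ := ((hverts v).resolve_left hv'.1).resolve_left hv'.2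
        exact ⟨i, hi, hv⟩
    · intro i
      refine (hH i).isOrderedPiece hxy fun u hu v hux huy huv => ?_
      obtain ⟨j, hj⟩ := hAdj u v hux huy huv
      obtain rfl := hmem i j u hu hj.fst_mem hux huy
      exact hj
  rw [isK24MinorFree_iff]
  intro P Q S hm
  obtain ⟨P', Q', S', hm'⟩ := hd.exists_isK24Model (H := ⊤)
    ⟨by simp, by simp, fun u v h => .inl (by simpa using (fun h' : u = v => h.ne (congrArg _ h')))⟩ hm
  refine isK24MinorFree_iff.1 (isK24MinorFree_of_card_lt ?_) P' Q' S' hm'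
  rw [Nat.card_sum, Nat.card_coe_set_eq, Set.ncard_pair hxy]
  simp

/-- The pieces are the interiors of the inserted graphs, and the reduced graph is exactly
`G₀.subdivide F`. -/
theorem IsPathOuterplanarReplacement.isK24MinorFree {W : Set V} {G₀ : SimpleGraph W}
    {F : Set (Sym2 W)} (hF : G₀.IsSubdividable F) (hG : G.IsPathOuterplanarReplacement G₀ F) :
    G.IsK24MinorFree := by
  obtain ⟨H, hH, hinter, hcover, hadj⟩ := hG
  have hex : ∀ e : F, ∃ x y : W, (e : Sym2 W) = s(x, y) := by
    rintro ⟨e, he⟩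
    induction e with
    | _ a b => exact ⟨a, b, rfl⟩
  choose x y hxy using hex
  have hHe : ∀ e : F, (H e).IsPathOuterplanar (x e) (y e) ∧
      (H e).verts ∩ W = {(x e : V), (y e : V)} := by
    intro e
    have h : s(x e, y e) ∈ F := hxy e ▸ e.2
    have he : e = ⟨s(x e, y e), h⟩ := Subtype.ext (hxy e)
    have := hH (x e) (y e) h
    rwa [← he] at this
  have hne : ∀ e, (x e : V) ≠ y e := by
    intro e h
    have := hF.1 e.2
    rw [hxy e, Subtype.ext h] at this
    exact G₀.loopless.irrefl _ this
  have hW : ∀ e v, v ∈ (H e).verts → (v ∈ W ↔ v = x e ∨ v = y e) := by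
    intro e v hv
    have : v ∈ (H e).verts ∩ W ↔ v ∈ ({(x e : V), (y e : V)} : Set V) := by rw [(hHe e).2]
    simpa [hv] using this
  have hA : ∀ u v, G.Adj u v ↔ ((G₀.deleteEdges F).map (Function.Embedding.subtype (· ∈ W))).Adj u v ∨
      ∃ e, (H e).Adj u v := by
    intro u v
    conv_lhs => rw [hadj]
    simp
  have hd : G.IsPieceDecomposition W (fun e => (H e).verts \ {(x e : V), (y e : V)})
      (fun e => (x e : V)) (fun e => (y e : V)) := by
    have hn : ∀ e, ∀ v ∈ (H e).verts \ {(x e : V), (y e : V)}, v ∉ W := by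
      rintro e v ⟨hv, hv'⟩ hvW
      exact hv' (by simpa using (hW e v hv).1 hvW)
    refine ⟨fun e => (x e).2, fun e => (y e).2, hn, ?_, ?_, ?_⟩
    · intro e f hef
      rw [Set.disjoint_left]
      intro v hv hv'
      exact hn e v hv (hinter e f hef ⟨hv.1, hv'.1⟩)
    · intro v
      by_cases hv : v ∈ W
      · exact .inl hv
      · right
        have : v ∈ W ∪ ⋃ e, (H e).verts := hcover ▸ trivial
        obtain ⟨e, he⟩ := Set.mem_iUnion.1 (this.resolve_left hv)
        refine ⟨e, he, ?_⟩
        rintro (rfl | rfl)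
        exacts [hv (x e).2, hv (y e).2]
    · intro e
      refine (hHe e).1.isOrderedPiece (hne e) fun u hu v hux huy huv => ?_
      have huW : u ∉ W := fun h => by
        rcases (hW e u hu).1 h with h | h
        exacts [hux h, huy h]
      rcases (hA u v).1 huv with h | ⟨f, hf⟩
      · obtain ⟨a, b, -, ha, -⟩ := (map_adj ..).1 h
        exact absurd (ha ▸ a.2) huW
      · by_cases hef : e = f
        · subst hef; exact hf
        · exact absurd (hinter e f hef ⟨hu, hf.fst_mem⟩) huW
  have hR : IsPieceDecomposition.IsReduction G W (fun e => (x e : V)) (fun e => (y e : V))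
      (G₀.subdivide F) := by
    refine ⟨?_, ?_, ?_⟩
    · intro e v hv
      change v ∈ (e : Sym2 W)
      rw [hxy e, Subtype.ext hv]
      simp
    · intro e v hv
      change v ∈ (e : Sym2 W)
      rw [hxy e, Subtype.ext hv]
      simp
    · intro u v huv
      rcases (hA u v).1 huv with h | ⟨e, he⟩
      · left
        obtain ⟨a, b, hab, ha, hb⟩ := (map_adj ..).1 h
        obtain rfl : a = u := Subtype.ext ha
        obtain rfl : b = v := Subtype.ext hb
        rw [deleteEdges_adj] at hab
        exact hab
      · right
        refine ⟨e, ?_⟩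
        have h1 := (hW e u he.fst_mem).1 u.2
        have h2 := (hW e v he.snd_mem).1 v.2
        have h3 := huv.ne
        rcases h1 with h1 | h1 <;> rcases h2 with h2 | h2
        · exact absurd (h1.trans h2.symm) h3
        · exact .inl ⟨h1, h2⟩
        · exact .inr ⟨h1, h2⟩
        · exact absurd (h1.trans h2.symm) h3
  rw [isK24MinorFree_iff]
  intro P Q S hm
  obtain ⟨P', Q', S', hm'⟩ := hd.exists_isK24Model hR hm
  exact isK24MinorFree_iff.1 hF.2 P' Q' S' hm'


/-! ### Separations, components and paths in a block -/

/-- A set whose only way out is `p` must fill the rest of the graph, since otherwise `p` would be a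
cutvertex. -/
theorem IsBlock.eq_or_mem (hG : G.IsBlock) {D : Set V} {p : V} (hD : D.Nonempty) (hp : p ∉ D)
    (h : ∀ u ∈ D, ∀ v, G.Adj u v → v ∈ D ∨ v = p) (w : V) : w ∈ D ∨ w = p := by
  obtain ⟨d, hd⟩ := hD
  have hdp : d ∈ ({p}ᶜ : Set V) := fun h => hp (h ▸ hd)
  by_contra! hw
  have hc : G.IsConn {p}ᶜ := by
    have := (⟨⟨d, hdp⟩⟩ : Nonempty ({p}ᶜ : Set V))
    exact connected_induce_iff_isConn.1 ⟨hG.2 p⟩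
  obtain ⟨u, hu, v, hv, huv, hQu, hQv⟩ := hc.exists_adj (Q := (· ∈ D)) hdp (b := w) hw.2 hd hw.1
  exact (h u hQu v huv).elim hQv hv

theorem Connected.mem_of_closed (hG : G.Connected) {D : Set V} (hD : D.Nonempty)
    (h : ∀ u ∈ D, ∀ v, G.Adj u v → v ∈ D) (w : V) : w ∈ D := by
  obtain ⟨d, hd⟩ := hD
  obtain ⟨p⟩ := hG.preconnected d w
  induction p with
  | nil => exact hd
  | cons hadj _ ih => exact ih (h _ hd _ hadj)

/-- The component of `c` in the subgraph induced by `U`. -/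
theorem exists_component (G : SimpleGraph V) {U : Set V} {c : V} (hc : c ∈ U) :
    ∃ E ⊆ U, c ∈ E ∧ G.IsConn E ∧ ∀ u ∈ E, ∀ v ∈ U, G.Adj u v → v ∈ E := by
  let E : Set V := {v | v ∈ U ∧ ∀ Q : V → Prop,
    (∀ u ∈ U, ∀ v ∈ U, G.Adj u v → Q u → Q v) → Q c → Q v}
  have hE : ∀ u ∈ E, ∀ v ∈ U, G.Adj u v → v ∈ E := fun u hu v hv huv =>
    ⟨hv, fun Q hQ hQc => hQ u hu.1 v hv huv (hu.2 Q hQ hQc)⟩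
  have hcE : c ∈ E := ⟨hc, fun _ _ h => h⟩
  refine ⟨E, fun v hv => hv.1, hcE, ⟨⟨c, hcE⟩, fun Q hQ => ?_⟩, hE⟩
  have key : ∀ v ∈ E, (v ∈ E ∧ (Q v ↔ Q c)) := fun v hv =>
    hv.2 (fun v => v ∈ E ∧ (Q v ↔ Q c)) (fun u hu v hv huv h =>
      have hv' := hE u h.1 v hv huv
      ⟨hv', ⟨fun hQv => h.2.1 (hQ v hv' u h.1 huv.symm hQv),
        fun hQc => hQ u h.1 v hv' huv (h.2.2 hQc)⟩⟩) ⟨hcE, Iff.rfl⟩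
  exact fun u hu v hv h => (key v hv).2.2 ((key u hu).2.1 h)

theorem IsConn.exists_isPath {S : Set V} (hS : G.IsConn S) {a b : V} (ha : a ∈ S) (hb : b ∈ S) :
    ∃ p : G.Walk a b, p.IsPath ∧ ∀ v ∈ p.support, v ∈ S := by
  obtain ⟨p, hp⟩ := (connected_induce_iff_isConn.2 hS).preconnected.exists_isPath ⟨a, ha⟩ ⟨b, hb⟩
  refine ⟨p.map (Embedding.induce S).toHom, hp.map
    (Embedding.induce (G := G) S).injective, fun v hv => ?_⟩
  obtain ⟨n, rfl, -⟩ := Walk.mem_support_iff_exists_getVert.1 hv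
  exact (Walk.getVert_map (Embedding.induce S).toHom p n) ▸ (p.getVert n).2

theorem isConn_image_Icc {g : ℕ → V} {i j : ℕ} (hij : i ≤ j)
    (h : ∀ k, i ≤ k → k < j → G.Adj (g k) (g (k + 1))) : G.IsConn (g '' Set.Icc i j) := by
  induction j, hij using Nat.le_induction with
  | base => simpa using isConn_singleton _
  | succ j hij ih =>
    have : g '' Set.Icc i (j + 1) = g '' Set.Icc i j ∪ {g (j + 1)} := by
      rw [← Set.image_singleton, ← Set.image_union]
      congr 1
      ext k
      simp only [Set.mem_Icc, Set.mem_union, Set.mem_singleton_iff]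
      omega
    rw [this]
    exact (ih fun k h1 h2 => h k h1 (by omega)).union (isConn_singleton _)
      ⟨j, ⟨hij, le_rfl⟩, rfl⟩ rfl (h j hij (by omega))

/-- `C` is a connected set attached to the rest of the graph at `x` and `y` only. -/
def IsSide (G : SimpleGraph V) (C : Set V) (x y : V) : Prop :=
  x ≠ y ∧ G.IsConn C ∧ G.IsAttachedAt C x y

theorem IsSide.symm {C : Set V} {x y : V} (h : G.IsSide C x y) : G.IsSide C y x :=
  ⟨h.1.symm, h.2.1, h.2.2.2.1, h.2.2.1, fun u hu v huv => by
    have := h.2.2.2.2 u hu v huv; tauto⟩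

theorem IsSide.exists_adj_left (hG : G.IsBlock) {C : Set V} {x y : V} (h : G.IsSide C x y) :
    ∃ u ∈ C, G.Adj u x := by
  by_contra! hcon
  have := hG.eq_or_mem h.2.1.1 h.2.2.2.1 (fun u hu v huv => by
    rcases h.2.2.2.2 u hu v huv with h | rfl | rfl
    exacts [.inl h, absurd huv (hcon u hu), .inr rfl]) x
  exact this.elim h.2.2.1 h.1

theorem IsSide.exists_adj_right (hG : G.IsBlock) {C : Set V} {x y : V} (h : G.IsSide C x y) :
    ∃ u ∈ C, G.Adj u y := h.symm.exists_adj_left hG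

theorem mem_getVert_image {u v : V} {P : G.Walk u v} {i j : ℕ} {w : V}
    (h : w ∈ P.getVert '' Set.Icc i j) : w ∈ P.support := by
  obtain ⟨k, -, rfl⟩ := h
  exact P.getVert_mem_support k

theorem disjoint_getVert_image {u v : V} {P : G.Walk u v} (hP : P.IsPath) {i j k l : ℕ}
    (hjk : j < k) (hl : l ≤ P.length) :
    Disjoint (P.getVert '' Set.Icc i j) (P.getVert '' Set.Icc k l) := by
  rw [Set.disjoint_left]
  rintro _ ⟨a, ha, rfl⟩ ⟨b, hb, hab⟩
  have := hP.getVert_injOn (show b ≤ P.length from hb.2.trans hl)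
    (show a ≤ P.length by have := ha.2; have := hb.1; have := hb.2; omega) hab
  have := ha.2; have := hb.1
  omega

theorem isConn_getVert_image {u v : V} (P : G.Walk u v) {i j : ℕ} (hij : i ≤ j)
    (hj : j ≤ P.length) : G.IsConn (P.getVert '' Set.Icc i j) :=
  isConn_image_Icc hij fun _ _ hk => P.adj_getVert_succ (by omega)

/-- A path with an outside connected set attached at two nonconsecutive vertices contains a rooted
`K_{2,2}`. -/
theorem hasRootedK22_of_attached {D : Set V} {x y : V} {P : G.Walk x y} (hP : P.IsPath)
    (hPD : ∀ v ∈ P.support, v ∈ D) {E : Set V} (hED : E ⊆ D) (hE : G.IsConn E)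
    (hPE : ∀ v ∈ P.support, v ∉ E) {i j : ℕ} (hij : i + 1 < j) (hj : j ≤ P.length) {u u' : V}
    (hu : u ∈ E) (hu' : u' ∈ E) (hi : G.Adj (P.getVert i) u) (hj' : G.Adj (P.getVert j) u') :
    G.HasRootedK22 D x y := by
  have hsub : ∀ i j, P.getVert '' Set.Icc i j ⊆ D := fun i j v hv => hPD v (mem_getVert_image hv)
  have hdE : ∀ i j, Disjoint (P.getVert '' Set.Icc i j) E := fun i j =>
    Set.disjoint_left.2 fun v hv => hPE v (mem_getVert_image hv)
  refine ⟨P.getVert '' Set.Icc 0 i, P.getVert '' Set.Icc j P.length,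
    P.getVert '' Set.Icc (i + 1) (j - 1), E, ⟨hsub _ _, hsub _ _, hsub _ _, hED⟩,
    ⟨isConn_getVert_image P (Nat.zero_le _) (by omega), isConn_getVert_image P hj le_rfl,
      isConn_getVert_image P (by omega) (by omega), hE⟩,
    ⟨⟨0, ⟨le_rfl, Nat.zero_le _⟩, P.getVert_zero⟩, ⟨P.length, ⟨hj, le_rfl⟩, P.getVert_length⟩⟩,
    ⟨disjoint_getVert_image hP (by omega) le_rfl, disjoint_getVert_image hP (by omega) (by omega),
      hdE _ _, (disjoint_getVert_image hP (by omega) le_rfl).symm, hdE _ _, hdE _ _⟩,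
    ⟨_, ⟨i, ⟨Nat.zero_le _, le_rfl⟩, rfl⟩, _, ⟨i + 1, ⟨le_rfl, by omega⟩, rfl⟩,
      P.adj_getVert_succ (by omega)⟩,
    ⟨_, ⟨j, ⟨le_rfl, hj⟩, rfl⟩, _, ⟨j - 1, ⟨by omega, le_rfl⟩, rfl⟩, ?_⟩,
    ⟨_, ⟨i, ⟨Nat.zero_le _, le_rfl⟩, rfl⟩, u, hu, hi⟩,
    ⟨_, ⟨j, ⟨le_rfl, hj⟩, rfl⟩, u', hu', hj'⟩⟩
  have := P.adj_getVert_succ (show j - 1 < P.length by omega)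
  rw [show j - 1 + 1 = j by omega] at this
  exact this.symm

/-- A path with two crossing chords contains a rooted `K_{2,2}`. -/
theorem hasRootedK22_of_crossing {D : Set V} {x y : V} {P : G.Walk x y} (hP : P.IsPath)
    (hPD : ∀ v ∈ P.support, v ∈ D) {i j k l : ℕ} (hij : i < j) (hjk : j < k) (hkl : k < l)
    (hl : l ≤ P.length) (hik : G.Adj (P.getVert i) (P.getVert k))
    (hjl : G.Adj (P.getVert j) (P.getVert l)) : G.HasRootedK22 D x y := by
  have hsub : ∀ i j, P.getVert '' Set.Icc i j ⊆ D := fun i j v hv => hPD v (mem_getVert_image hv)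
  -- The middle part `i + 1, …, j` reaches the initial segment along the path and the final one by
  -- the chord `jl`. The part `k, …, l - 1` reaches the initial segment by the chord `ik` and the
  -- final one along the path.
  refine ⟨P.getVert '' Set.Icc 0 i, P.getVert '' Set.Icc l P.length,
    P.getVert '' Set.Icc (i + 1) j, P.getVert '' Set.Icc k (l - 1),
    ⟨hsub _ _, hsub _ _, hsub _ _, hsub _ _⟩,
    ⟨isConn_getVert_image P (Nat.zero_le _) (by omega), isConn_getVert_image P hl le_rfl,
      isConn_getVert_image P (by omega) (by omega), isConn_getVert_image P (by omega) (by omega)⟩,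
    ⟨⟨0, ⟨le_rfl, Nat.zero_le _⟩, P.getVert_zero⟩, ⟨P.length, ⟨hl, le_rfl⟩, P.getVert_length⟩⟩,
    ⟨disjoint_getVert_image hP (by omega) le_rfl, disjoint_getVert_image hP (by omega) (by omega),
      disjoint_getVert_image hP (by omega) (by omega),
      (disjoint_getVert_image hP (by omega) le_rfl).symm,
      (disjoint_getVert_image hP (by omega) le_rfl).symm,
      disjoint_getVert_image hP (by omega) (by omega)⟩,
    ⟨_, ⟨i, ⟨Nat.zero_le _, le_rfl⟩, rfl⟩, _, ⟨i + 1, ⟨le_rfl, by omega⟩, rfl⟩,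
      P.adj_getVert_succ (by omega)⟩,
    ⟨_, ⟨l, ⟨le_rfl, hl⟩, rfl⟩, _, ⟨j, ⟨by omega, le_rfl⟩, rfl⟩, hjl.symm⟩,
    ⟨_, ⟨i, ⟨Nat.zero_le _, le_rfl⟩, rfl⟩, _, ⟨k, ⟨le_rfl, by omega⟩, rfl⟩, hik⟩,
    ⟨_, ⟨l, ⟨le_rfl, hl⟩, rfl⟩, _, ⟨l - 1, ⟨by omega, le_rfl⟩, rfl⟩, ?_⟩⟩
  have := P.adj_getVert_succ (show l - 1 < P.length by omega)
  rw [show l - 1 + 1 = l by omega] at this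
  exact this.symm

/-- A path can be extended through an outside connected set attached at two consecutive vertices. -/
theorem exists_longer_path {x y : V} {P : G.Walk x y} (hP : P.IsPath) {E : Set V}
    (hE : G.IsConn E) (hPE : ∀ v ∈ P.support, v ∉ E) {i : ℕ} (hi : i < P.length) {u u' : V}
    (hu : u ∈ E) (hu' : u' ∈ E) (hiu : G.Adj (P.getVert i) u)
    (hiu' : G.Adj (P.getVert (i + 1)) u') :
    ∃ P' : G.Walk x y, P'.IsPath ∧ P.length < P'.length ∧
      ∀ v ∈ P'.support, v ∈ P.support ∨ v ∈ E := by
  obtain ⟨m, hm, hmE⟩ := hE.exists_isPath hu hu'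
  let P' : G.Walk x y := (P.take i).append (.cons hiu (m.append (.cons hiu'.symm (P.drop (i + 1)))))
  have hsupp : P'.support = P.support.take (i + 1) ++ (m.support ++ P.support.drop (i + 1)) := by
    simp only [P', Walk.support_append, Walk.support_cons, List.tail_cons]
    rw [Walk.support_take, Walk.drop_support_eq_support_drop_min,
      min_eq_left (by omega)]
  refine ⟨P', ?_, ?_, ?_⟩
  · rw [Walk.isPath_def, hsupp]
    have hnd := P.isPath_def.1 hP
    have hnd' := hnd
    rw [← List.take_append_drop (i + 1) P.support] at hnd'
    rw [List.nodup_append] at hnd' ⊢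
    refine ⟨hnd'.1, ?_, ?_⟩
    · rw [List.nodup_append]
      refine ⟨m.isPath_def.1 hm, hnd'.2.1, fun a ha b hb hab => ?_⟩
      exact hPE b (List.mem_of_mem_drop hb) (hab ▸ hmE a ha)
    · intro a ha b hb hab
      rcases List.mem_append.1 hb with hb | hb
      · exact hPE a (List.mem_of_mem_take ha) (hab ▸ hmE b hb)
      · exact hnd'.2.2 a ha b hb hab
  · have h1 := congrArg List.length hsupp
    simp only [Walk.length_support, List.length_append, List.length_take, List.length_drop] at h1
    omega
  · intro v hv
    rw [hsupp, List.mem_append, List.mem_append] at hv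
    rcases hv with hv | hv | hv
    exacts [.inl (List.mem_of_mem_take hv), .inr (hmE v hv), .inl (List.mem_of_mem_drop hv)]

/-! ### Sides without a rooted `K_{2,2}` -/

/-- A side without rooted `K_{2,2}` has a Hamilton path between its ends without crossing chords. -/
theorem IsSide.exists_hamilton_path [Finite V] (hG : G.IsBlock) {C : Set V} {x y : V}
    (hC : G.IsSide C x y) (hr : ¬ G.HasRootedK22 (withEnds C x y) x y) :
    ∃ P : G.Walk x y, P.IsPath ∧ ∀ v, v ∈ P.support ↔ v ∈ withEnds C x y := by
  classical
  have := Fintype.ofFinite V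
  have hxy := hC.1
  -- A longest path is Hamiltonian. A component of what it misses has at least two neighbours on it
  -- because `G` is a block: two consecutive ones allow a longer path, two others give a rooted
  -- `K_{2,2}`.
  let L : Set ℕ := {n | ∃ P : G.Walk x y, P.IsPath ∧ (∀ v ∈ P.support, v ∈ withEnds C x y) ∧
    P.length = n}
  have hL : L.Nonempty := by
    obtain ⟨a, ha, hax⟩ := hC.exists_adj_left hG
    obtain ⟨b, hb, hby⟩ := hC.exists_adj_right hG
    have hx : G.IsConn ({x} ∪ C ∪ {y}) :=
      ((isConn_singleton x).union hC.2.1 rfl ha hax.symm).union (isConn_singleton y) (.inr hb) rfl hby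
    obtain ⟨P, hP, hPD⟩ := hx.exists_isPath (a := x) (b := y) (by simp) (by simp)
    refine ⟨_, P, hP, fun v hv => ?_, rfl⟩
    have := hPD v hv
    simp only [Set.mem_union, Set.mem_singleton_iff] at this
    rw [mem_withEnds]; tauto
  have hbdd : BddAbove L := ⟨Fintype.card V, by
    rintro n ⟨P, hP, -, rfl⟩
    exact hP.length_lt.le⟩
  obtain ⟨P, hP, hPD, hPl⟩ := Nat.sSup_mem hL hbdd
  have hmax : ∀ P' : G.Walk x y, P'.IsPath → (∀ v ∈ P'.support, v ∈ withEnds C x y) →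
      P'.length ≤ P.length := fun P' h1 h2 => hPl ▸ le_csSup hbdd ⟨P', h1, h2, rfl⟩
  refine ⟨P, hP, fun v => ⟨hPD v, fun hv => ?_⟩⟩
  by_contra hvP
  have hvC : v ∈ C := by
    rcases mem_withEnds.1 hv with h | rfl | rfl
    exacts [h, absurd P.start_mem_support hvP, absurd P.end_mem_support hvP]
  obtain ⟨E, hEU, hvE, hE, hEc⟩ := G.exists_component (U := C \ {v | v ∈ P.support}) ⟨hvC, hvP⟩
  have hPE : ∀ v ∈ P.support, v ∉ E := fun v hv h => (hEU h).2 hv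
  have hnbr : ∀ u ∈ E, ∀ w, G.Adj u w → w ∉ E → w ∈ P.support := by
    intro u hu w huw hw
    by_contra hwP
    refine hw (hEc u hu w ⟨?_, hwP⟩ huw)
    rcases hC.2.2.2.2 u (hEU hu).1 w huw with h | rfl | rfl
    exacts [h, absurd P.start_mem_support hwP, absurd P.end_mem_support hwP]
  have hother : ∀ p ∈ P.support, ∃ q ∈ P.support, q ≠ p ∧ ∃ u ∈ E, G.Adj q u := by
    intro p hp
    by_contra! hcon
    have H := hG.eq_or_mem ⟨v, hvE⟩ (hPE p hp) (fun u hu w huw => by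
      by_cases hw : w ∈ E
      · exact .inl hw
      · right
        by_contra hwp
        exact hcon w (hnbr u hu w huw hw) hwp u hu huw.symm)
    have hx := (H x).resolve_left (hPE x P.start_mem_support)
    have hy := (H y).resolve_left (hPE y P.end_mem_support)
    exact hxy (hx.trans hy.symm)
  obtain ⟨p, hp, -, u, hu, hpu⟩ := hother x P.start_mem_support
  obtain ⟨q, hq, hqp, u', hu', hqu⟩ := hother p hp
  obtain ⟨i, rfl, hi⟩ := Walk.mem_support_iff_exists_getVert.1 hp
  obtain ⟨j, rfl, hj⟩ := Walk.mem_support_iff_exists_getVert.1 hq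
  have key : ∀ i j u u', i < j → j ≤ P.length → u ∈ E → u' ∈ E → G.Adj (P.getVert i) u →
      G.Adj (P.getVert j) u' → False := by
    intro i j u u' hij hj hu hu' hiu hju
    by_cases hj1 : j = i + 1
    · subst hj1
      obtain ⟨P', hP', hlt, hsub⟩ := exists_longer_path hP hE hPE (by omega) hu hu' hiu hju
      exact absurd (hmax P' hP' fun w hw => (hsub w hw).elim (hPD w) fun h =>
        mem_withEnds.2 (.inl (hEU h).1)) (by omega)
    · exact hr (hasRootedK22_of_attached hP hPD (fun w hw => mem_withEnds.2 (.inl (hEU hw).1)) hE hPE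
        (by omega) hj hu hu' hiu hju)
  have hij : i ≠ j := fun h => hqp (h ▸ rfl)
  rcases lt_or_gt_of_ne hij with h | h
  · exact key i j u u' h hj hu hu' hpu hqu
  · exact key j i u' u h hi hu' hu hqu hpu

/-- A side without rooted `K_{2,2}` is `xy`-outerplanar. -/
theorem IsSide.isPathOuterplanar [Finite V] (hG : G.IsBlock) {C : Set V} {x y : V}
    (hC : G.IsSide C x y) (hr : ¬ G.HasRootedK22 (withEnds C x y) x y) :
    ((⊤ : G.Subgraph).induce (withEnds C x y)).IsPathOuterplanar x y := by
  obtain ⟨P, hP, hPD⟩ := hC.exists_hamilton_path hG hr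
  have hx : x ∈ withEnds C x y := by simp
  have hy : y ∈ withEnds C x y := by simp
  suffices h : (G.induce (withEnds C x y)).IsPathOuterplanar ⟨x, hx⟩ ⟨y, hy⟩ by
    refine ⟨hx, hy, ?_⟩
    rw [induce_eq_coe_induce_top] at h
    exact h
  have hex : ∀ v : withEnds C x y, ∃ n ≤ P.length, P.getVert n = v := fun v => by
    obtain ⟨n, hn, hn'⟩ := Walk.mem_support_iff_exists_getVert.1 ((hPD v).2 v.2)
    exact ⟨n, hn', hn⟩
  choose f hf hf' using hex
  obtain ⟨P', hlen, hget⟩ : ∃ P' : (G.induce (withEnds C x y)).Walk ⟨x, hx⟩ ⟨y, hy⟩,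
      P'.length = P.length ∧ ∀ i, (P'.getVert i : V) = P.getVert i := by
    have hmap := P.map_induce (s := withEnds C x y) (fun v hv => (hPD v).1 hv)
    exact ⟨P.induce (withEnds C x y) (fun v hv => (hPD v).1 hv),
      (Walk.length_map _ _).symm.trans (congrArg Walk.length hmap),
      fun i => (Walk.getVert_map _ _ _).symm.trans (congrArg (fun q => q.getVert i) hmap)⟩
  refine isPathOuterplanar_of_isNoncrossing (f := f) ?_ ?_ P' ?_ ?_
  · intro u v h
    apply Subtype.ext
    rw [← hf' u, h, hf' v]
  · intro a b c d h1 h2 h3 hac hbd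
    refine hr (hasRootedK22_of_crossing hP (fun v hv => (hPD v).1 hv) h1 h2 h3 (hf d) ?_ ?_)
    · rw [hf', hf']; exact hac
    · rw [hf', hf']; exact hbd
  · intro i hi
    refine hP.getVert_injOn (hf _) (show i ≤ P.length by omega) ?_
    rw [hf', hget]
  · intro v
    rw [Walk.mem_support_iff_exists_getVert]
    exact ⟨f v, Subtype.ext (by rw [hget, hf']), by rw [hlen]; exact hf v⟩


/-! ### Several sides at the same pair of vertices -/

theorem withEnds_comm (C : Set V) (x y : V) : withEnds C x y = withEnds C y x := by
  rw [withEnds, withEnds, Set.pair_comm]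

theorem HasRootedK22.symm {D : Set V} {x y : V} (h : G.HasRootedK22 D x y) :
    G.HasRootedK22 D y x := by
  obtain ⟨X, Y, A, B, ⟨h1, h2, h3, h4⟩, ⟨c1, c2, c3, c4⟩, ⟨hx, hy⟩, ⟨d1, d2, d3, d4, d5, d6⟩,
    t1, t2, t3, t4⟩ := h
  exact ⟨Y, X, A, B, ⟨h2, h1, h3, h4⟩, ⟨c2, c1, c3, c4⟩, ⟨hy, hx⟩, ⟨d1.symm, d4, d5, d2, d3, d6⟩,
    t2, t1, t4, t3⟩

theorem IsSide.isOrderedPiece [Finite V] (hG : G.IsBlock) {C : Set V} {x y : V}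
    (hC : G.IsSide C x y) (hr : ¬ G.HasRootedK22 (withEnds C x y) x y) :
    G.IsOrderedPiece C x y := by
  have h := (hC.isPathOuterplanar hG hr).isOrderedPiece hC.1 (fun u hu v hux huy huv => by
    have huC : u ∈ C := by
      rcases mem_withEnds.1 hu with h | h | h
      exacts [h, absurd h hux, absurd h huy]
    exact ⟨hu, mem_withEnds.2 (hC.2.2.2.2 u huC v huv), huv⟩)
  have : ((⊤ : G.Subgraph).induce (withEnds C x y)).verts \ {x, y} = C := by
    ext v
    rw [Subgraph.induce_verts, Set.mem_sdiff, mem_withEnds, Set.mem_insert_iff,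
      Set.mem_singleton_iff]
    have h1 : v ∈ C → v ≠ x := fun hv h => hC.2.2.1 (h ▸ hv)
    have h2 : v ∈ C → v ≠ y := fun hv h => hC.2.2.2.1 (h ▸ hv)
    tauto
  rwa [this] at h

/-- Stands in for a missing side, so that the result on two pieces also covers one side or none. -/
theorem isOrderedPiece_empty {x y : V} (hxy : x ≠ y) : G.IsOrderedPiece ∅ x y := by
  classical
  refine ⟨hxy, ⟨by simp, by simp, by simp⟩, fun v => if v = x then 0 else 1, ?_, ?_, ?_⟩
  · intro u hu v hv huv
    rw [mem_withEnds] at hu hv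
    simp only [Set.mem_empty_iff_false, false_or] at hu hv
    rcases hu with rfl | rfl <;> rcases hv with rfl | rfl <;> simp_all
  · intro v hv
    rw [mem_withEnds] at hv
    simp only [Set.mem_empty_iff_false, false_or] at hv
    rcases hv with rfl | rfl <;> simp [hxy.symm]
  · intro a _ b _ c _ d _ h1 h2 h3
    have h : (if d = x then 0 else 1) ≤ 1 := by split_ifs <;> omega
    dsimp only at h1 h2 h3
    omega

/-- Two ordered pieces with the same ends form an outerplanar graph. -/
theorem isOuterplanar_of_two_pieces {C C' : Set V} {x y : V} (h : G.IsOrderedPiece C x y)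
    (h' : G.IsOrderedPiece C' x y)
    (hcover : ∀ v, v ∈ withEnds C x y ∨ v ∈ C') : G.IsOuterplanar := by
  classical
  obtain ⟨hxy, ⟨hx, hy, hat⟩, f, hf, hfxy, hnc⟩ := h
  obtain ⟨-, ⟨hx', hy', hat'⟩, g, hg, hgxy, hnc'⟩ := h'
  have hyD : y ∈ withEnds C x y := by simp
  have hyD' : y ∈ withEnds C' x y := by simp
  have hxD : x ∈ withEnds C x y := by simp
  have hxD' : x ∈ withEnds C' x y := by simp
  have hsub' : ∀ v ∈ C', v ∈ withEnds C' x y := fun v hv => mem_withEnds.2 (.inl hv)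
  -- The first piece is listed from `x` to `y`, then the interior of the second backwards from `y`
  -- to `x`. The subtraction is not truncated, because `g v ≤ g y` on the second piece.
  let F : V → ℕ := fun v => if v ∈ C' then f y + 1 + (g y - g v) else f v
  have hF1 : ∀ v ∈ C', F v = f y + 1 + (g y - g v) ∧ g v ≤ g y := fun v hv =>
    ⟨if_pos hv, (hgxy v (hsub' v hv)).2⟩
  have hF2 : ∀ v, v ∉ C' → F v = f v ∧ f x ≤ f v ∧ f v ≤ f y ∧ v ∈ withEnds C x y := fun v hv =>
    have h := (hcover v).resolve_right hv
    ⟨if_neg hv, (hfxy v h).1, (hfxy v h).2, h⟩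
  refine isOuterplanar_of_isNoncrossing (f := F) ?_ ?_
  · intro u v huv
    by_cases hu : u ∈ C' <;> by_cases hv : v ∈ C'
    · have h1 := hF1 u hu
      have h2 := hF1 v hv
      exact hg (hsub' u hu) (hsub' v hv) (by omega)
    · have h1 := hF1 u hu
      have h2 := hF2 v hv
      omega
    · have h1 := hF2 u hu
      have h2 := hF1 v hv
      omega
    · have h1 := hF2 u hu
      have h2 := hF2 v hv
      exact hf h1.2.2.2 h2.2.2.2 (by omega)
  · intro a b c d hab hbc hcd hac hbd
    -- If the last vertex `d` is in `C'`, so is `c`, and the neighbours `a` and `b` are in `C' ∪ {x,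
    -- y}`. The crossing then appears, reversed, in the order `g`. Otherwise all four vertices are
    -- in the first piece.
    by_cases hd : d ∈ C'
    · have hFd := hF1 d hd
      have hFx := hF2 x hx'
      have hFy := hF2 y hy'
      have hb : b ∈ C' ∨ b = y := by
        rcases hat' d hd b hbd.symm with h | rfl | rfl
        · exact .inl h
        · by_cases ha : a ∈ C'
          · have := hF1 a ha; omega
          · have := hF2 a ha; omega
        · exact .inr rfl
      have hbF : g b ≤ g y ∧ (F b = f y + 1 + (g y - g b) ∨ (b = y ∧ F b = f y)) := by
        rcases hb with hb | rfl
        · exact ⟨(hF1 b hb).2, .inl (hF1 b hb).1⟩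
        · exact ⟨le_rfl, .inr ⟨rfl, hFy.1⟩⟩
      have hc : c ∈ C' := by
        by_contra hc
        have := hF2 c hc
        omega
      have hFc := hF1 c hc
      have hbD : b ∈ withEnds C' x y := mem_withEnds.2 (by tauto)
      have hgdc : g d < g c := by omega
      have hgcb : g c < g b := by
        rcases hbF.2 with h | ⟨rfl, -⟩
        · omega
        · exact lt_of_le_of_ne hFc.2 fun h => hy' (hg (hsub' c hc) hyD' h ▸ hc)
      rcases hat' c hc a hac.symm with ha | rfl | rfl
      · have hFa := hF1 a ha
        exact hnc' d (hsub' d hd) c (hsub' c hc) b hbD a (hsub' a ha) hgdc hgcb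
          (by rcases hbF.2 with h | ⟨-, h⟩ <;> omega) hbd.symm hac.symm
      · have h1 := (hgxy d (hsub' d hd)).1
        have h2 : g a ≠ g d := fun h => hx' (hg hxD' (hsub' d hd) h ▸ hd)
        exact hnc' a hxD' d (hsub' d hd) c (hsub' c hc) b hbD (by omega) hgdc hgcb hac hbd.symm
      · have hba : g b ≠ g a := fun h => by
          have := hg hbD hyD' h
          subst this
          omega
        exact hnc' d (hsub' d hd) c (hsub' c hc) b hbD a hyD' hgdc hgcb (by omega) hbd.symm
          hac.symm
    · have hFd := hF2 d hd
      have hlow : ∀ v, F v < F d → v ∉ C' := fun v hv hvC => by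
        have := hF1 v hvC; omega
      have hFa := hF2 a (hlow a (by omega))
      have hFb := hF2 b (hlow b (by omega))
      have hFc := hF2 c (hlow c (by omega))
      exact hnc a hFa.2.2.2 b hFb.2.2.2 c hFc.2.2.2 d hFd.2.2.2 (by omega) (by omega) (by omega)
        hac hbd

theorem IsAttachedAt.subset_of_isConn {C E : Set V} {x y : V} (hC : G.IsAttachedAt C x y)
    (hE : G.IsConn E) (hx : x ∉ E) (hy : y ∉ E) {v : V} (hvE : v ∈ E) (hvC : v ∈ C) : E ⊆ C := by
  by_contra hEC
  rcases hC.end_mem hE ⟨v, hvE, mem_withEnds.2 (.inl hvC)⟩ hEC with h | h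
  exacts [hx h, hy h]

/-- The sides at `x` and `y` are the components of `G - {x, y}`. -/
theorem IsSide.eq_or_disjoint {C C' : Set V} {x y : V} (h : G.IsSide C x y)
    (h' : G.IsSide C' x y) : C = C' ∨ Disjoint C C' := by
  by_cases hd : Disjoint C C'
  · exact .inr hd
  · obtain ⟨v, hv, hv'⟩ := Set.not_disjoint_iff.1 hd
    exact .inl (Set.Subset.antisymm
      (h'.2.2.subset_of_isConn h.2.1 h.2.2.1 h.2.2.2.1 hv hv')
      (h.2.2.subset_of_isConn h'.2.1 h'.2.2.1 h'.2.2.2.1 hv' hv))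

theorem exists_isSide (G : SimpleGraph V) {x y v : V} (hxy : x ≠ y) (hx : v ≠ x) (hy : v ≠ y) :
    ∃ E, v ∈ E ∧ G.IsSide E x y := by
  obtain ⟨E, hE, hv, hc, hcl⟩ := G.exists_component (U := {x, y}ᶜ) (c := v) (by simp [hx, hy])
  refine ⟨E, hv, hxy, hc, fun h => hE h (by simp), fun h => hE h (by simp), fun u hu w huw => ?_⟩
  by_cases hw : w ∈ ({x, y}ᶜ : Set V)
  · exact .inl (hcl u hu w hw huw)
  · right
    by_contra h
    push Not at h
    exact hw (by simp [h.1, h.2])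

/-- In a block both ends have neighbours in the side, so the set determines its pair of ends. -/
theorem IsSide.ends_eq (hG : G.IsBlock) {C : Set V} {x y x' y' : V} (h : G.IsSide C x y)
    (h' : G.IsSide C x' y') : (x = x' ∧ y = y') ∨ (x = y' ∧ y = x') := by
  have key : ∀ {x y}, G.IsSide C x y → x = x' ∨ x = y' := by
    intro x y h
    obtain ⟨u, hu, hux⟩ := h.exists_adj_left hG
    exact (h'.2.2.2.2 u hu x hux).resolve_left h.2.2.1
  have h1 := key h
  have h2 := key h.symm
  have h3 := h.1
  rcases h1 with rfl | rfl <;> rcases h2 with rfl | rfl <;> tauto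

/-- The sets of a rooted `K_{2,2}` in a side avoid the ends except for the roots. -/
theorem HasRootedK22.exists_subset {C : Set V} {x y : V}
    (h : G.HasRootedK22 (withEnds C x y) x y) :
    ∃ X Y A B : Set V, (X ⊆ C ∪ {x} ∧ Y ⊆ C ∪ {y} ∧ A ⊆ C ∧ B ⊆ C) ∧
    (G.IsConn X ∧ G.IsConn Y ∧ G.IsConn A ∧ G.IsConn B) ∧ (x ∈ X ∧ y ∈ Y) ∧
    (Disjoint X Y ∧ Disjoint X A ∧ Disjoint X B ∧ Disjoint Y A ∧ Disjoint Y B ∧ Disjoint A B) ∧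
    G.Touch X A ∧ G.Touch Y A ∧ G.Touch X B ∧ G.Touch Y B := by
  obtain ⟨X, Y, A, B, ⟨h1, h2, h3, h4⟩, hc, ⟨hx, hy⟩, hd, ht⟩ := h
  have dXY := Set.disjoint_left.1 hd.1
  have dXA := Set.disjoint_left.1 hd.2.1
  have dXB := Set.disjoint_left.1 hd.2.2.1
  have dYA := Set.disjoint_left.1 hd.2.2.2.1
  have dYB := Set.disjoint_left.1 hd.2.2.2.2.1
  refine ⟨X, Y, A, B, ⟨fun v hv => ?_, fun v hv => ?_, fun v hv => ?_, fun v hv => ?_⟩, hc,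
    ⟨hx, hy⟩, hd, ht⟩
  · rcases mem_withEnds.1 (h1 hv) with h | rfl | rfl
    exacts [.inl h, .inr rfl, absurd hy (dXY hv)]
  · rcases mem_withEnds.1 (h2 hv) with h | rfl | rfl
    exacts [.inl h, absurd hv (dXY hx), .inr rfl]
  · rcases mem_withEnds.1 (h3 hv) with h | rfl | rfl
    exacts [h, absurd hv (dXA hx), absurd hv (dYA hy)]
  · rcases mem_withEnds.1 (h4 hv) with h | rfl | rfl
    exacts [h, absurd hv (dXB hx), absurd hv (dYB hy)]

theorem forall_fin_four_ne {p : Fin 4 → Fin 4 → Prop} (hs : ∀ i j, p i j → p j i) (h01 : p 0 1)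
    (h02 : p 0 2) (h03 : p 0 3) (h12 : p 1 2) (h13 : p 1 3) (h23 : p 2 3) :
    ∀ i j, i ≠ j → p i j := by
  have key : ∀ i j, i < j → p i j := by
    intro i j
    fin_cases i <;> fin_cases j <;>
      first | (intro h; exact absurd h (by decide)) | (intro; assumption)
  intro i j hij
  rcases lt_or_gt_of_ne hij with h | h
  exacts [key i j h, hs _ _ (key j i h)]

theorem isK24Model_of_list {P Q A B C D : Set V} (cP : G.IsConn P) (cQ : G.IsConn Q)
    (cA : G.IsConn A) (cB : G.IsConn B) (cC : G.IsConn C) (cD : G.IsConn D) (dPQ : Disjoint P Q)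
    (dP : Disjoint P A ∧ Disjoint P B ∧ Disjoint P C ∧ Disjoint P D)
    (dQ : Disjoint Q A ∧ Disjoint Q B ∧ Disjoint Q C ∧ Disjoint Q D)
    (dA : Disjoint A B ∧ Disjoint A C ∧ Disjoint A D) (dB : Disjoint B C ∧ Disjoint B D)
    (dC : Disjoint C D) (tP : G.Touch P A ∧ G.Touch P B ∧ G.Touch P C ∧ G.Touch P D)
    (tQ : G.Touch Q A ∧ G.Touch Q B ∧ G.Touch Q C ∧ G.Touch Q D) :
    G.IsK24Model P Q ![A, B, C, D] := by
  have key : ∀ p : Set V → Prop, p A → p B → p C → p D → ∀ j, p ((![A, B, C, D] : Fin 4 → Set V) j) := by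
    intro p hA hB hC hD j
    fin_cases j
    exacts [hA, hB, hC, hD]
  exact ⟨cP, cQ, key _ cA cB cC cD, dPQ, key (Disjoint P) dP.1 dP.2.1 dP.2.2.1 dP.2.2.2,
    key (Disjoint Q) dQ.1 dQ.2.1 dQ.2.2.1 dQ.2.2.2,
    forall_fin_four_ne (fun _ _ h => h.symm) dA.1 dA.2.1 dA.2.2 dB.1 dB.2 dC,
    key (G.Touch P) tP.1 tP.2.1 tP.2.2.1 tP.2.2.2, key (G.Touch Q) tQ.1 tQ.2.1 tQ.2.2.1 tQ.2.2.2⟩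

theorem IsSide.touch_left (hG : G.IsBlock) {C X : Set V} {x y : V} (h : G.IsSide C x y)
    (hx : x ∈ X) : G.Touch X C := by
  obtain ⟨u, hu, hux⟩ := h.exists_adj_left hG
  exact ⟨x, hx, u, hu, hux.symm⟩

theorem IsSide.touch_right (hG : G.IsBlock) {C Y : Set V} {x y : V} (h : G.IsSide C x y)
    (hy : y ∈ Y) : G.Touch Y C := h.symm.touch_left hG hy

/-- With four sides at the same pair of vertices there is a minor `K_{2,4}`. -/
theorem IsK24MinorFree.not_four_sides (hG : G.IsBlock) (hf : G.IsK24MinorFree) {x y : V}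
    {A B C D : Set V} (hA : G.IsSide A x y) (hB : G.IsSide B x y) (hC : G.IsSide C x y)
    (hD : G.IsSide D x y) (dA : Disjoint A B ∧ Disjoint A C ∧ Disjoint A D)
    (dB : Disjoint B C ∧ Disjoint B D) (dC : Disjoint C D) : False := by
  have hx : ∀ {A}, G.IsSide A x y → Disjoint {x} A := fun h =>
    Set.disjoint_singleton_left.2 h.2.2.1
  have hy : ∀ {A}, G.IsSide A x y → Disjoint {y} A := fun h =>
    Set.disjoint_singleton_left.2 h.2.2.2.1
  exact isK24MinorFree_iff.1 hf {x} {y} _ (isK24Model_of_list (isConn_singleton x)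
    (isConn_singleton y) hA.2.1 hB.2.1 hC.2.1 hD.2.1 (Set.disjoint_singleton.2 hA.1)
    ⟨hx hA, hx hB, hx hC, hx hD⟩ ⟨hy hA, hy hB, hy hC, hy hD⟩ dA dB dC
    ⟨hA.touch_left hG rfl, hB.touch_left hG rfl, hC.touch_left hG rfl, hD.touch_left hG rfl⟩
    ⟨hA.touch_right hG rfl, hB.touch_right hG rfl, hC.touch_right hG rfl, hD.touch_right hG rfl⟩)

/-- A set disjoint from two disjoint sides at the same pair of vertices has no rooted `K_{2,2}` at
that pair. -/
theorem IsK24MinorFree.not_hasRootedK22_of_disjoint_sides (hG : G.IsBlock) (hf : G.IsK24MinorFree)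
    {x y : V} {A B C : Set V} (hB : G.IsSide B x y) (hC : G.IsSide C x y)
    (dAB : Disjoint A B) (dAC : Disjoint A C) (dBC : Disjoint B C) :
    ¬ G.HasRootedK22 (withEnds A x y) x y := by
  intro hr
  obtain ⟨X, Y, S, T, ⟨h1, h2, h3, h4⟩, ⟨c1, c2, c3, c4⟩, ⟨hx, hy⟩, ⟨d1, d2, d3, d4, d5, d6⟩,
    t1, t2, t3, t4⟩ := hr.exists_subset
  have e1 : ∀ {B}, G.IsSide B x y → Disjoint A B → Disjoint X B := fun hB hd =>
    (Set.disjoint_union_left.2 ⟨hd, Set.disjoint_singleton_left.2 hB.2.2.1⟩).mono_left h1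
  have e2 : ∀ {B}, G.IsSide B x y → Disjoint A B → Disjoint Y B := fun hB hd =>
    (Set.disjoint_union_left.2 ⟨hd, Set.disjoint_singleton_left.2 hB.2.2.2.1⟩).mono_left h2
  exact isK24MinorFree_iff.1 hf X Y _ (isK24Model_of_list c1 c2 c3 c4 hB.2.1 hC.2.1 d1
    ⟨d2, d3, e1 hB dAB, e1 hC dAC⟩ ⟨d4, d5, e2 hB dAB, e2 hC dAC⟩
    ⟨d6, dAB.mono_left h3, dAC.mono_left h3⟩ ⟨dAB.mono_left h4, dAC.mono_left h4⟩ dBC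
    ⟨t1, t3, hB.touch_left hG hx, hC.touch_left hG hx⟩
    ⟨t2, t4, hB.touch_right hG hy, hC.touch_right hG hy⟩)

theorem IsConn.union_of_mem {S T : Set V} (hS : G.IsConn S) (hT : G.IsConn T) {a : V} (ha : a ∈ S)
    (ha' : a ∈ T) : G.IsConn (S ∪ T) := by
  refine ⟨hS.1.mono Set.subset_union_left, fun Q hQ => ?_⟩
  have h1 := hS.2 Q (fun u hu v hv => hQ u (.inl hu) v (.inl hv))
  have h2 := hT.2 Q (fun u hu v hv => hQ u (.inr hu) v (.inr hv))
  rintro u (hu | hu) v (hv | hv) h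
  · exact h1 u hu v hv h
  · exact h2 a ha' v hv (h1 u hu a ha h)
  · exact h1 a ha v hv (h2 u hu a ha' h)
  · exact h2 u hu v hv h

theorem Touch.mono_left {S S' T : Set V} (h : G.Touch S T) (hS : S ⊆ S') : G.Touch S' T := by
  obtain ⟨a, ha, b, hb, hab⟩ := h
  exact ⟨a, hS ha, b, hb, hab⟩

/-- Of two disjoint sides at the same pair of vertices, at most one has a rooted `K_{2,2}`. -/
theorem IsK24MinorFree.not_two_rooted (hf : G.IsK24MinorFree)
    {x y : V} {C D : Set V} (hC : G.IsSide C x y) (hD : G.IsSide D x y) (hd : Disjoint C D)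
    (hr : G.HasRootedK22 (withEnds C x y) x y) (hr' : G.HasRootedK22 (withEnds D x y) x y) :
    False := by
  obtain ⟨X, Y, A, B, ⟨h1, h2, h3, h4⟩, ⟨c1, c2, c3, c4⟩, ⟨hx, hy⟩, ⟨d1, d2, d3, d4, d5, d6⟩,
    t1, t2, t3, t4⟩ := hr.exists_subset
  obtain ⟨X', Y', A', B', ⟨h1', h2', h3', h4'⟩, ⟨c1', c2', c3', c4'⟩, ⟨hx', hy'⟩,
    ⟨d1', d2', d3', d4', d5', d6'⟩, t1', t2', t3', t4'⟩ := hr'.exists_subset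
  have hxy : Disjoint ({x} : Set V) {y} := Set.disjoint_singleton.2 hC.1
  have hxC : Disjoint ({x} : Set V) C := Set.disjoint_singleton_left.2 hC.2.2.1
  have hyC : Disjoint ({y} : Set V) C := Set.disjoint_singleton_left.2 hC.2.2.2.1
  have hxD : Disjoint ({x} : Set V) D := Set.disjoint_singleton_left.2 hD.2.2.1
  have hyD : Disjoint ({y} : Set V) D := Set.disjoint_singleton_left.2 hD.2.2.2.1
  have e1 : Disjoint (C ∪ {x}) D := Set.disjoint_union_left.2 ⟨hd, hxD⟩
  have e2 : Disjoint (C ∪ {y}) D := Set.disjoint_union_left.2 ⟨hd, hyD⟩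
  have e3 : Disjoint (D ∪ {x}) C := Set.disjoint_union_left.2 ⟨hd.symm, hxC⟩
  have e4 : Disjoint (D ∪ {y}) C := Set.disjoint_union_left.2 ⟨hd.symm, hyC⟩
  have e5 : Disjoint (C ∪ {x}) (D ∪ {y}) := Set.disjoint_union_right.2
    ⟨e1, Set.disjoint_union_left.2 ⟨hyC.symm, hxy⟩⟩
  have e6 : Disjoint (C ∪ {y}) (D ∪ {x}) := Set.disjoint_union_right.2
    ⟨e2, Set.disjoint_union_left.2 ⟨hxC.symm, hxy.symm⟩⟩
  refine isK24MinorFree_iff.1 hf (X ∪ X') (Y ∪ Y') _ (isK24Model_of_list (c1.union_of_mem c1' hx hx')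
    (c2.union_of_mem c2' hy hy') c3 c4 c3' c4' ?_ ?_ ?_ ⟨d6, hd.mono h3 h3', hd.mono h3 h4'⟩
    ⟨hd.mono h4 h3', hd.mono h4 h4'⟩ d6' ?_ ?_)
  · simp only [Set.disjoint_union_left, Set.disjoint_union_right]
    exact ⟨⟨d1, (e6.mono h2 h1').symm⟩, e5.mono h1 h2', d1'⟩
  · simp only [Set.disjoint_union_left]
    exact ⟨⟨d2, e3.mono h1' h3⟩, ⟨d3, e3.mono h1' h4⟩, ⟨e1.mono h1 h3', d2'⟩, e1.mono h1 h4', d3'⟩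
  · simp only [Set.disjoint_union_left]
    exact ⟨⟨d4, e4.mono h2' h3⟩, ⟨d5, e4.mono h2' h4⟩, ⟨e2.mono h2 h3', d4'⟩, e2.mono h2 h4', d5'⟩
  · exact ⟨t1.mono_left Set.subset_union_left, t3.mono_left Set.subset_union_left,
      t1'.mono_left Set.subset_union_right, t3'.mono_left Set.subset_union_right⟩
  · exact ⟨t2.mono_left Set.subset_union_left, t4.mono_left Set.subset_union_left,
      t2'.mono_left Set.subset_union_right, t4'.mono_left Set.subset_union_right⟩

/-- A `K_{2,4}`-minor-free block with three sides at the same pair of vertices is the union of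
three `xy`-outerplanar graphs. -/
theorem isTriplePathOuterplanarUnion_of_three_sides [Finite V] (hG : G.IsBlock)
    (hf : G.IsK24MinorFree) {x y : V} {C : Fin 3 → Set V} (hC : ∀ i, G.IsSide (C i) x y)
    (hd : ∀ i j, i ≠ j → Disjoint (C i) (C j)) : G.IsTriplePathOuterplanarUnion := by
  have hcover : ∀ v, v = x ∨ v = y ∨ ∃ i, v ∈ C i := by
    intro v
    by_contra! hv
    obtain ⟨E, hvE, hE⟩ := G.exists_isSide (hC 0).1 hv.1 hv.2.1
    have hEC : ∀ i, Disjoint (C i) E := fun i =>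
      ((hC i).eq_or_disjoint hE).resolve_left fun h => hv.2.2 i (h ▸ hvE)
    exact hf.not_four_sides hG (hC 0) (hC 1) (hC 2) hE
      ⟨hd 0 1 (by decide), hd 0 2 (by decide), hEC 0⟩ ⟨hd 1 2 (by decide), hEC 1⟩ (hEC 2)
  have hr : ∀ i, ¬ G.HasRootedK22 (withEnds (C i) x y) x y := by
    intro i
    obtain ⟨j, k, hij, hik, hjk⟩ : ∃ j k : Fin 3, i ≠ j ∧ i ≠ k ∧ j ≠ k := by
      fin_cases i
      exacts [⟨1, 2, by decide⟩, ⟨0, 2, by decide⟩, ⟨0, 1, by decide⟩]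
    exact hf.not_hasRootedK22_of_disjoint_sides hG (hC j) (hC k) (hd i j hij) (hd i k hik)
      (hd j k hjk)
  -- Induced subgraphs already contain a possible edge `xy`, so the union is all of `G` without
  -- adding it.
  refine ⟨x, y, fun i => (⊤ : G.Subgraph).induce (withEnds (C i) x y),
    fun i => (hC i).isPathOuterplanar hG (hr i), fun i => ?_, fun i j hij => ?_, .inl ?_⟩
  · obtain ⟨c, hc⟩ := (hC i).2.1.1
    have hsub : ({c, x, y} : Set V) ⊆ withEnds (C i) x y := by
      rintro v (rfl | h)
      exacts [.inl hc, .inr h]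
    have h3 : ({c, x, y} : Set V).ncard = 3 := by
      rw [Set.ncard_eq_three]
      exact ⟨c, x, y, fun h => (hC i).2.2.1 (h ▸ hc), fun h => (hC i).2.2.2.1 (h ▸ hc), (hC i).1, rfl⟩
    have := Set.ncard_le_ncard hsub (Set.toFinite _)
    rw [h3] at this
    exact this
  · change withEnds (C i) x y ∩ withEnds (C j) x y = {x, y}
    rw [withEnds, withEnds, ← Set.inter_union_distrib_right, (hd i j hij).inter_eq, Set.empty_union]
  · have hmem : ∀ v, ∃ i, v ∈ withEnds (C i) x y := by
      intro v
      rcases hcover v with h | h | ⟨i, h⟩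
      exacts [⟨0, mem_withEnds.2 (.inr (.inl h))⟩, ⟨0, mem_withEnds.2 (.inr (.inr h))⟩,
        ⟨i, .inl h⟩]
    ext u v
    · simp only [Subgraph.verts_iSup, Set.mem_iUnion, Subgraph.induce_verts, Subgraph.verts_top,
        Set.mem_univ, iff_true]
      exact hmem u
    · simp only [Subgraph.iSup_adj, Subgraph.induce_adj, Subgraph.top_adj]
      refine ⟨fun ⟨i, h⟩ => h.2.2, fun huv => ?_⟩
      have key : ∀ u v, G.Adj u v → (∃ i, u ∈ C i) → ∃ i, u ∈ withEnds (C i) x y ∧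
          v ∈ withEnds (C i) x y := by
        rintro u v huv ⟨i, hi⟩
        exact ⟨i, .inl hi, mem_withEnds.2 ((hC i).2.2.2.2 u hi v huv)⟩
      by_cases hu : ∃ i, u ∈ C i
      · obtain ⟨i, h1, h2⟩ := key u v huv hu
        exact ⟨i, h1, h2, huv⟩
      by_cases hv : ∃ i, v ∈ C i
      · obtain ⟨i, h1, h2⟩ := key v u huv.symm hv
        exact ⟨i, h2, h1, huv⟩
      refine ⟨0, mem_withEnds.2 ?_, mem_withEnds.2 ?_, huv⟩
      · have := hcover u; tauto
      · have := hcover v; tauto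

/-- If no side at `x`, `y` has a rooted `K_{2,2}` and there are at most two sides, then the graph is
outerplanar. -/
theorem isOuterplanar_of_not_hasRootedK22 [Finite V] (hG : G.IsBlock) {x y : V} (hxy : x ≠ y)
    (hr : ∀ C, G.IsSide C x y → ¬ G.HasRootedK22 (withEnds C x y) x y)
    (h3 : ∀ A B C, G.IsSide A x y → G.IsSide B x y → G.IsSide C x y → Disjoint A B →
      Disjoint A C → Disjoint B C → False) : G.IsOuterplanar := by
  by_cases h1 : ∀ v, v ∈ withEnds (∅ : Set V) x y
  · exact isOuterplanar_of_two_pieces (isOrderedPiece_empty hxy) (isOrderedPiece_empty hxy)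
      fun v => .inl (h1 v)
  push Not at h1
  obtain ⟨a, ha⟩ := h1
  simp only [mem_withEnds, Set.mem_empty_iff_false, false_or, not_or] at ha
  obtain ⟨A, haA, hA⟩ := G.exists_isSide hxy ha.1 ha.2
  have pA := hA.isOrderedPiece hG (hr A hA)
  by_cases h2 : ∀ v, v ∈ withEnds A x y
  · exact isOuterplanar_of_two_pieces pA (isOrderedPiece_empty hxy)
      fun v => .inl (h2 v)
  push Not at h2
  obtain ⟨b, hb⟩ := h2
  simp only [mem_withEnds, not_or] at hb
  obtain ⟨B, hbB, hB⟩ := G.exists_isSide hxy hb.2.1 hb.2.2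
  have dAB := (hA.eq_or_disjoint hB).resolve_left fun h => hb.1 (h ▸ hbB)
  refine isOuterplanar_of_two_pieces pA (hB.isOrderedPiece hG (hr B hB)) fun c => ?_
  by_contra! hc
  simp only [mem_withEnds, not_or] at hc
  obtain ⟨C, hcC, hC⟩ := G.exists_isSide hxy hc.1.2.1 hc.1.2.2
  exact h3 A B C hA hB hC dAB ((hA.eq_or_disjoint hC).resolve_left fun h => hc.1.1 (h ▸ hcC))
    ((hB.eq_or_disjoint hC).resolve_left fun h => hc.2 (h ▸ hcC))


/-! ### Minimal skeletons -/

/-- Every component of `G - W` is attached to `W` at exactly two vertices, and has no rooted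
`K_{2,2}`. -/
def IsSkeleton (G : SimpleGraph V) (W : Set V) : Prop :=
  ∀ C, G.IsConn C → Disjoint C W → (∀ u ∈ C, ∀ v, G.Adj u v → v ∈ C ∨ v ∈ W) →
    ∃ x ∈ W, ∃ y ∈ W, G.IsSide C x y ∧ ¬ G.HasRootedK22 (withEnds C x y) x y

theorem isSkeleton_univ (G : SimpleGraph V) : G.IsSkeleton Set.univ := fun _ hC hd _ =>
  absurd hC.1 (by rw [Set.disjoint_univ.1 hd]; exact Set.not_nonempty_empty)

theorem IsSkeleton.exists_isSide {W : Set V} (hW : G.IsSkeleton W) {v : V} (hv : v ∉ W) :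
    ∃ C, v ∈ C ∧ Disjoint C W ∧ ∃ x ∈ W, ∃ y ∈ W, G.IsSide C x y := by
  obtain ⟨C, hCW, hvC, hC, hcl⟩ := G.exists_component (U := Wᶜ) hv
  have hd : Disjoint C W := Set.disjoint_left.2 fun z hz hz' => hCW hz hz'
  obtain ⟨x, hx, y, hy, h, -⟩ := hW C hC hd fun u hu w huw => by
    by_cases hw : w ∈ W
    exacts [.inr hw, .inl (hcl u hu w hw huw)]
  exact ⟨C, hvC, hd, x, hx, y, hy, h⟩

theorem IsSkeleton.not_hasRootedK22 (hG : G.IsBlock) {W C : Set V} (hW : G.IsSkeleton W) {x y : V}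
    (hC : G.IsSide C x y) (hd : Disjoint C W) (hx : x ∈ W) (hy : y ∈ W) :
    ¬ G.HasRootedK22 (withEnds C x y) x y := by
  obtain ⟨x', -, y', -, h, hr⟩ := hW C hC.2.1 hd fun u hu v huv => by
    rcases hC.2.2.2.2 u hu v huv with h | rfl | rfl
    exacts [.inl h, .inr hx, .inr hy]
  rcases hC.ends_eq hG h with ⟨rfl, rfl⟩ | ⟨rfl, rfl⟩
  · exact hr
  · intro hr'
    rw [withEnds_comm] at hr'
    exact hr hr'.symm

/-- Deleting from `W` its part in `E` merges everything in `E` into the single component `E`, which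
is admissible by hypothesis. Any other component is an old one, and its ends avoid `E` because edges
leave `E` only towards `s` and `t`. -/
theorem IsSkeleton.diff (hG : G.IsBlock) {W E : Set V} (hW : G.IsSkeleton W) {s t : V}
    (hE : G.IsSide E s t) (hs : s ∈ W) (ht : t ∈ W)
    (hr : ¬ G.HasRootedK22 (withEnds E s t) s t) : G.IsSkeleton (W \ E) := by
  intro C hC hd hcl
  have hd' := Set.disjoint_left.1 hd
  by_cases hCE : Disjoint C E
  · have hCE' := Set.disjoint_left.1 hCE
    have hCW : ∀ v ∈ C, v ∉ W := fun v hv hvW => hd' hv ⟨hvW, hCE' hv⟩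
    obtain ⟨x, hx, y, hy, h, hr'⟩ := hW C hC (Set.disjoint_left.2 hCW) fun u hu v huv =>
      (hcl u hu v huv).imp_right fun h => h.1
    have key : ∀ {x y}, G.IsSide C x y → x ∉ E := by
      intro x y h hxE
      obtain ⟨u, hu, hux⟩ := h.exists_adj_left hG
      rcases hE.2.2.2.2 x hxE u hux.symm with h | rfl | rfl
      exacts [hCE' hu h, hCW _ hu hs, hCW _ hu ht]
    exact ⟨x, ⟨hx, key h⟩, y, ⟨hy, key h.symm⟩, h, hr'⟩
  · obtain ⟨v, hv, hvE⟩ := Set.not_disjoint_iff.1 hCE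
    have h1 : C ⊆ E := hE.2.2.subset_of_isConn hC (fun h => hd' h ⟨hs, hE.2.2.1⟩)
      (fun h => hd' h ⟨ht, hE.2.2.2.1⟩) hv hvE
    have h2 : E ⊆ C := fun w hw => hE.2.1.2 (· ∈ C) (fun u _ w hw huw hu =>
      (hcl u hu w huw).resolve_right fun h => h.2 hw) v hvE w hw hv
    obtain rfl := Set.Subset.antisymm h1 h2
    exact ⟨s, ⟨hs, hE.2.2.1⟩, t, ⟨ht, hE.2.2.2.1⟩, hE, hr⟩

/-- Otherwise `W \ E` would be a smaller skeleton, still containing `s` and `t`. -/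
theorem IsSkeleton.disjoint_of_minimal [Finite V] (hG : G.IsBlock) {W E : Set V}
    (hW : G.IsSkeleton W) (hmin : ∀ W', 2 ≤ W'.ncard → G.IsSkeleton W' → W.ncard ≤ W'.ncard)
    {s t : V} (hE : G.IsSide E s t) (hs : s ∈ W) (ht : t ∈ W)
    (hr : ¬ G.HasRootedK22 (withEnds E s t) s t) : Disjoint E W := by
  by_contra hd
  obtain ⟨v, hv, hvW⟩ := Set.not_disjoint_iff.1 hd
  have h1 : ({s, t} : Set V) ⊆ W \ E := by
    rintro z (rfl | rfl)
    exacts [⟨hs, hE.2.2.1⟩, ⟨ht, hE.2.2.2.1⟩]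
  have h2 := Set.ncard_le_ncard h1 (Set.toFinite _)
  rw [Set.ncard_pair hE.1] at h2
  have h3 := hmin _ h2 (hW.diff hG hE hs ht hr)
  have h4 : W \ E ⊂ W := ⟨Set.sdiff_subset, fun h => (h hvW).2 hv⟩
  have := Set.ncard_lt_ncard h4 (Set.toFinite _)
  omega

theorem IsConn.of_sup_edge {S : Set V} {x y : V} (h : (G ⊔ edge x y).IsConn S)
    (hxy : x ∉ S ∨ y ∉ S) : G.IsConn S := by
  refine ⟨h.1, fun Q hQ => h.2 Q fun u hu v hv huv => hQ u hu v hv ?_⟩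
  rcases huv with huv | huv
  · exact huv
  · rw [edge_adj] at huv
    rcases huv.1 with ⟨rfl, rfl⟩ | ⟨rfl, rfl⟩ <;> tauto

/-- Given a rooted `K_{2,2}` at `a`, `b` in the side containing `c` whose second hub avoids `c`,
the set `{a, b, c}` is not a skeleton unless there are three sides at a pair of vertices. -/
theorem IsSkeleton.three_aux (hG : G.IsBlock) {a b c : V} (hac : a ≠ c) (hbc : b ≠ c)
    (hW : G.IsSkeleton {a, b, c})
    (h3 : ∀ x y A B C, G.IsSide A x y → G.IsSide B x y → G.IsSide C x y → Disjoint A B →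
      Disjoint A C → Disjoint B C → False) {E X Y A B : Set V} (hE : G.IsSide E a b) (hcE : c ∈ E)
    (hA : A ⊆ E) (hB : B ⊆ E)
    (hconn : G.IsConn X ∧ G.IsConn Y ∧ G.IsConn A ∧ G.IsConn B) (hx : a ∈ X ∧ b ∈ Y)
    (hdis : Disjoint X Y ∧ Disjoint X A ∧ Disjoint X B ∧ Disjoint Y A ∧ Disjoint Y B ∧
      Disjoint A B)
    (tXA : G.Touch X A) (tYA : G.Touch Y A) (tXB : G.Touch X B) (tYB : G.Touch Y B)
    (hcY : c ∉ Y) : False := by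
  have haY : a ∉ Y := Set.disjoint_left.1 hdis.1 hx.1
  have hbX : b ∉ X := Set.disjoint_right.1 hdis.1 hx.2
  have hend : ∀ {Z S C : Set V} {p q : V}, G.IsSide C p q → G.IsConn Z → S ⊆ C → G.Touch Z S →
      ¬ Z ⊆ C → p ∈ Z ∨ q ∈ Z := by
    rintro Z S C p q hC hZ hSC ⟨z, hz, s, hs, hzs⟩ hZC
    exact hC.2.2.end_mem hZ ⟨z, hz, mem_withEnds.2 (hC.2.2.2.2 s (hSC hs) z hzs.symm)⟩ hZC
  -- The component of `G - {a, b, c}` around `S` is reached by `Y`, whose only element among `a, b,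
  -- c` is `b`; so it is attached at `b`. Its other end is not `a`, since a side at `a` and `b`
  -- meeting `E` equals `E` and contains `c`.
  have key : ∀ {S : Set V}, S ⊆ E → G.IsConn S → G.Touch Y S → c ∉ S →
      ∃ C, S ⊆ C ∧ Disjoint C {a, b, c} ∧ G.IsSide C b c := by
    intro S hSE hS htY hcS
    have hSW : ∀ v ∈ S, v ∉ ({a, b, c} : Set V) := by
      rintro v hv (rfl | rfl | rfl)
      exacts [hE.2.2.1 (hSE hv), hE.2.2.2.1 (hSE hv), hcS hv]
    obtain ⟨v, hv⟩ := hS.1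
    obtain ⟨C, hvC, hCW, p, hp, q, hq, hC⟩ := hW.exists_isSide (hSW v hv)
    have hCW' := Set.disjoint_left.1 hCW
    have hSC : S ⊆ C := hC.2.2.subset_of_isConn hS (fun h => hSW p h hp) (fun h => hSW q h hq) hv hvC
    refine ⟨C, hSC, hCW, ?_⟩
    have fin : ∀ {p q}, G.IsSide C p q → p ∈ ({a, b, c} : Set V) → q ∈ ({a, b, c} : Set V) →
        p ∈ Y → G.IsSide C b c := by
      intro p q hC hp hq hpY
      have hpb : p = b := by
        rcases hp with rfl | rfl | rfl
        exacts [absurd hpY haY, rfl, absurd hpY hcY]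
      subst hpb
      rcases hq with rfl | rfl | rfl
      · exfalso
        rcases hC.symm.eq_or_disjoint hE with rfl | h
        · exact hCW' hcE (by simp)
        · exact Set.disjoint_left.1 h hvC (hSE hv)
      · exact absurd rfl hC.1
      · exact hC
    rcases hend hC hconn.2.1 hSC htY fun h => hCW' (h hx.2) (by simp) with h | h
    exacts [fin hC hp hq h, fin hC.symm hq hp h]
  have hcX : ∀ {S : Set V}, S ⊆ E → G.IsConn S → G.Touch Y S → G.Touch X S → c ∉ S → c ∈ X := by
    intro S hSE hS htY htX hcS
    obtain ⟨C, hSC, hCW, hC⟩ := key hSE hS htY hcS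
    exact (hend hC hconn.1 hSC htX fun h =>
      Set.disjoint_left.1 hCW (h hx.1) (by simp)).resolve_left hbX
  -- At least one of `A` and `B` avoids `c`. Its component is attached at `b` and `c`, and `X`,
  -- which avoids `b`, must enter through `c`.
  have hcX : c ∈ X := by
    by_cases hcA : c ∈ A
    · exact hcX hB hconn.2.2.2 tYB tXB (Set.disjoint_left.1 hdis.2.2.2.2.2 hcA)
    · exact hcX hA hconn.2.2.1 tYA tXA hcA
  obtain ⟨C, hAC, hCW, hC⟩ := key hA hconn.2.2.1 tYA (Set.disjoint_left.1 hdis.2.1 hcX)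
  obtain ⟨D, hBD, hDW, hD⟩ := key hB hconn.2.2.2 tYB (Set.disjoint_left.1 hdis.2.2.1 hcX)
  -- If `A` and `B` lie in one component, the traces of `X` and `Y` complete them to a rooted
  -- `K_{2,2}` there, which a skeleton forbids. If not, their components and the side containing `a`
  -- are three sides at `b` and `c`.
  rcases hC.eq_or_disjoint hD with rfl | hCD
  · refine hW.not_hasRootedK22 hG hC.symm hCW (by simp) (by simp) ⟨X ∩ withEnds C c b,
      Y ∩ withEnds C c b, A, B, ⟨Set.inter_subset_right, Set.inter_subset_right,
      hAC.trans Set.subset_union_left, hBD.trans Set.subset_union_left⟩,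
      ⟨?_, ?_, hconn.2.2.1, hconn.2.2.2⟩, ⟨⟨hcX, by simp⟩, ⟨hx.2, by simp⟩⟩,
      ⟨hdis.1.mono Set.inter_subset_left Set.inter_subset_left,
        hdis.2.1.mono_left Set.inter_subset_left, hdis.2.2.1.mono_left Set.inter_subset_left,
        hdis.2.2.2.1.mono_left Set.inter_subset_left,
        hdis.2.2.2.2.1.mono_left Set.inter_subset_left, hdis.2.2.2.2.2⟩, ?_⟩
    · exact (hC.symm.2.2.isConn_inter hbc.symm hconn.1 ⟨c, hcX, by simp⟩).of_sup_edge
        (.inr fun h => hbX h.1)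
    · exact (hC.symm.2.2.isConn_inter hbc.symm hconn.2.1 ⟨b, hx.2, by simp⟩).of_sup_edge
        (.inl fun h => hcY h.1)
    · have htouch : ∀ {Z S : Set V}, G.Touch Z S → S ⊆ C → G.Touch (Z ∩ withEnds C c b) S := by
        rintro Z S ⟨z, hz, s, hs, hzs⟩ hSC
        exact ⟨z, ⟨hz, mem_withEnds.2 (hC.symm.2.2.2.2 s (hSC hs) z hzs.symm)⟩, s, hs, hzs⟩
      exact ⟨htouch tXA hAC, htouch tYA hAC, htouch tXB hBD, htouch tYB hBD⟩
  · have hab : a ≠ b := hE.1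
    obtain ⟨F, haF, hF⟩ := G.exists_isSide hbc hab hac
    have hne : ∀ {C}, Disjoint C {a, b, c} → G.IsSide C b c → Disjoint C F := fun hCW hC =>
      (hC.eq_or_disjoint hF).resolve_left fun h =>
        Set.disjoint_left.1 hCW (h ▸ haF) (by simp)
    exact h3 b c C D F hC hD hF hCD (hne hCW hC) (hne hDW hD)

/-- The side at `a`, `b` through `c` meets the skeleton, so minimality gives it a rooted `K_{2,2}`.
The vertex `c` avoids one of its hubs, and exchanging `a` and `b` if necessary makes this the
second. -/
theorem IsSkeleton.not_three (hG : G.IsBlock) {a b c : V} (hab : a ≠ b) (hac : a ≠ c) (hbc : b ≠ c)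
    (hW : G.IsSkeleton {a, b, c})
    (hM : ∀ s t E, G.IsSide E s t → s ∈ ({a, b, c} : Set V) → t ∈ ({a, b, c} : Set V) →
      ¬ G.HasRootedK22 (withEnds E s t) s t → Disjoint E {a, b, c})
    (h3 : ∀ x y A B C, G.IsSide A x y → G.IsSide B x y → G.IsSide C x y → Disjoint A B →
      Disjoint A C → Disjoint B C → False) : False := by
  obtain ⟨E, hcE, hE⟩ := G.exists_isSide hab hac.symm hbc.symm
  have hr : G.HasRootedK22 (withEnds E a b) a b := by
    by_contra hr
    exact Set.disjoint_left.1 (hM a b E hE (by simp) (by simp) hr) hcE (by simp)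
  obtain ⟨X, Y, A, B, ⟨-, -, hA, hB⟩, hc, hx, hd, t1, t2, t3, t4⟩ := hr.exists_subset
  by_cases hcY : c ∈ Y
  · exact IsSkeleton.three_aux hG hbc hac (by rwa [Set.insert_comm]) h3 hE.symm hcE hA hB
      ⟨hc.2.1, hc.1, hc.2.2⟩ hx.symm ⟨hd.1.symm, hd.2.2.2.1, hd.2.2.2.2.1, hd.2.1, hd.2.2.1,
        hd.2.2.2.2.2⟩ t2 t1 t4 t3 (Set.disjoint_right.1 hd.1 hcY)
  · exact hW.three_aux hG hac hbc h3 hE hcE hA hB hc hx hd t1 t2 t3 t4 hcY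

/-! ### The torso and its virtual edges -/

/-- The graph on `W` with, in addition to the edges of `G`, an edge `uv` for every component of
`G - W` attached at `u` and `v`. -/
def torso (G : SimpleGraph V) (W : Set V) : SimpleGraph W where
  Adj u v := u ≠ v ∧ (G.Adj u v ∨ ∃ C, Disjoint C W ∧ G.IsSide C u v)
  symm := ⟨fun _ _ h => ⟨h.1.symm, h.2.imp (fun h => h.symm) fun ⟨C, hd, h⟩ => ⟨C, hd, h.symm⟩⟩⟩
  loopless := ⟨fun _ h => h.1 rfl⟩

/-- The edges of the torso spanned by the components of `G - W`. -/
def virtualEdges (G : SimpleGraph V) (W : Set V) : Set (Sym2 W) :=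
  {e | ∃ C, Disjoint C W ∧ ∀ u v : W, e = s(u, v) → G.IsSide C u v}

theorem mem_virtualEdges {W C : Set V} {u v : W} (hd : Disjoint C W) (hC : G.IsSide C u v) :
    s(u, v) ∈ G.virtualEdges W := by
  refine ⟨C, hd, fun u' v' h => ?_⟩
  rcases Sym2.eq_iff.1 h with ⟨rfl, rfl⟩ | ⟨rfl, rfl⟩
  exacts [hC, hC.symm]

theorem virtualEdges_subset (G : SimpleGraph V) (W : Set V) :
    G.virtualEdges W ⊆ (G.torso W).edgeSet := by
  intro e
  induction e with
  | _ u v =>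
    rintro ⟨C, hd, hC⟩
    have := hC u v rfl
    exact ⟨fun h => this.1 (congrArg _ h), .inr ⟨C, hd, this⟩⟩

/-- A separator of the torso also separates `G`. With at most one vertex this contradicts that `G`
is a block; with two it gives two sides that meet `W`, hence by `hM` two disjoint sides with a
rooted `K_{2,2}`. -/
theorem IsSkeleton.torso_isVertexConnected [Finite V] (hG : G.IsBlock) (hf : G.IsK24MinorFree)
    {W : Set V} (hW : G.IsSkeleton W) (hcard : 4 ≤ W.ncard)
    (hM : ∀ s t E, G.IsSide E s t → s ∈ W → t ∈ W →
      ¬ G.HasRootedK22 (withEnds E s t) s t → Disjoint E W) :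
    (G.torso W).IsVertexConnected 3 := by
  classical
  refine ⟨by rw [Nat.card_coe_set_eq]; omega, fun S hS => connected_induce_iff_isConn.2 ⟨?_, ?_⟩⟩
  · by_contra! h
    have h1 : (S : Set W) = Set.univ := Set.compl_empty_iff.1 h
    have h2 : (S : Set W).ncard = W.ncard := by rw [h1, Set.ncard_univ, Nat.card_coe_set_eq]
    rw [Set.ncard_coe_finset] at h2
    omega
  intro Q hQ u hu v hv hQu
  by_contra hQv
  have hu : u ∉ S := hu
  have hv : v ∉ S := hv
  have hQ : ∀ a b, a ∉ S → b ∉ S → (G.torso W).Adj a b → Q a → Q b := fun a b ha hb =>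
    hQ a ha b hb
  -- The part of the torso satisfying `Q`, together with the components of `G - W` attached to it.
  -- Edges of `G` leave `D` only towards `S`.
  let D : Set V := {z | (∃ w : W, w = z ∧ w ∉ S ∧ Q w) ∨
    ∃ (C : Set V) (p q : W), Disjoint C W ∧ G.IsSide C p q ∧ z ∈ C ∧ p ∉ S ∧ Q p}
  have hDW : ∀ w : W, (w : V) ∈ D → w ∉ S ∧ Q w := by
    rintro w (⟨w', h, h'⟩ | ⟨C, p, q, hd, -, hw, -⟩)
    · obtain rfl := Subtype.ext h
      exact h'
    · exact absurd w.2 (Set.disjoint_left.1 hd hw)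
  have huD : (u : V) ∈ D := .inl ⟨u, rfl, hu, hQu⟩
  have hvD : (v : V) ∉ D := fun h => hQv (hDW v h).2
  have hcl : ∀ z ∈ D, ∀ z', G.Adj z z' → z' ∈ D ∨ ∃ s ∈ S, z' = s := by
    rintro z (⟨w, rfl, hw, hQw⟩ | ⟨C, p, q, hd, hC, hz, hp, hQp⟩) z' hzz'
    · by_cases hz' : z' ∈ W
      · by_cases hS' : (⟨z', hz'⟩ : W) ∈ S
        · exact .inr ⟨_, hS', rfl⟩
        · exact .inl (.inl ⟨⟨z', hz'⟩, rfl, hS', hQ _ _ hw hS'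
            ⟨fun h => hzz'.ne (congrArg Subtype.val h), .inl hzz'⟩ hQw⟩)
      · obtain ⟨C, hz'C, hd, x, hx, y, hy, hC⟩ := hW.exists_isSide hz'
        left; right
        rcases hC.2.2.2.2 z' hz'C w hzz'.symm with h | h | h
        · exact absurd w.2 (Set.disjoint_left.1 hd h)
        · exact ⟨C, w, ⟨y, hy⟩, hd, h ▸ hC, hz'C, hw, hQw⟩
        · exact ⟨C, w, ⟨x, hx⟩, hd, h ▸ hC.symm, hz'C, hw, hQw⟩
    · rcases hC.2.2.2.2 z hz z' hzz' with h | rfl | rfl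
      · exact .inl (.inr ⟨C, p, q, hd, hC, h, hp, hQp⟩)
      · exact .inl (.inl ⟨p, rfl, hp, hQp⟩)
      · by_cases hq : q ∈ S
        · exact .inr ⟨q, hq, rfl⟩
        · exact .inl (.inl ⟨q, rfl, hq, hQ p q hp hq
            ⟨fun h => hC.1 (congrArg _ h), .inr ⟨C, hd, hC⟩⟩ hQp⟩)
  have hcases : S.card = 0 ∨ S.card = 1 ∨ S.card = 2 := by omega
  rcases hcases with h0 | h1 | h2
  · rw [Finset.card_eq_zero] at h0
    subst h0
    exact hvD (hG.1.mem_of_closed ⟨_, huD⟩ (fun z hz z' h => (hcl z hz z' h).resolve_right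
      (by simp)) v)
  · obtain ⟨p, rfl⟩ := Finset.card_eq_one.1 h1
    rcases hG.eq_or_mem ⟨_, huD⟩ (p := p) (fun h => (hDW p h).1 (by simp))
      (fun z hz z' h => (hcl z hz z' h).imp_right (by simp)) v with h | h
    · exact hvD h
    · exact hv (by simp [Subtype.ext h])
  · obtain ⟨s, t, hst, rfl⟩ := Finset.card_eq_two.1 h2
    have hst' : (s : V) ≠ t := fun h => hst (Subtype.ext h)
    have hne : ∀ w : W, w ∉ ({s, t} : Finset W) → (w : V) ≠ s ∧ (w : V) ≠ t := fun w hw =>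
      ⟨fun h => hw (by simp [Subtype.ext h]), fun h => hw (by simp [Subtype.ext h])⟩
    obtain ⟨E, huE, hE⟩ := G.exists_isSide hst' (hne u hu).1 (hne u hu).2
    obtain ⟨E', hvE', hE'⟩ := G.exists_isSide hst' (hne v hv).1 (hne v hv).2
    have hED : E ⊆ D := fun w hw => hE.2.1.2 (· ∈ D) (fun z _ z' hz'E h hz => by
      rcases hcl z hz z' h with h | ⟨w, hw, rfl⟩
      · exact h
      · rw [Finset.mem_insert, Finset.mem_singleton] at hw
        rcases hw with rfl | rfl
        exacts [absurd hz'E hE.2.2.1, absurd hz'E hE.2.2.2.1]) u huE w hw huD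
    have hd : Disjoint E E' := (hE.eq_or_disjoint hE').resolve_left fun h =>
      hvD (hED (h ▸ hvE'))
    refine hf.not_two_rooted hE hE' hd ?_ ?_ <;> by_contra hr
    · exact Set.disjoint_left.1 (hM s t E hE s.2 t.2 hr) huE u.2
    · exact Set.disjoint_left.1 (hM s t E' hE' s.2 t.2 hr) hvE' v.2

theorem isConn_biUnion {V' : Type*} {H : SimpleGraph V'} {β : V' → Set V}
    (hc : ∀ a, G.IsConn (β a)) (ht : ∀ a b, H.Adj a b → G.Touch (β a) (β b)) {T : Set V'}
    (hT : H.IsConn T) : G.IsConn (⋃ a ∈ T, β a) := by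
  have hsub : ∀ {a}, a ∈ T → β a ⊆ ⋃ a ∈ T, β a := fun ha => Set.subset_biUnion_of_mem ha
  obtain ⟨a, ha⟩ := hT.1
  refine ⟨(hc a).1.mono (hsub ha), fun Q hQ => ?_⟩
  have hin : ∀ {a}, a ∈ T → ∀ u ∈ β a, ∀ v ∈ β a, Q u → Q v := fun ha =>
    (hc _).2 Q fun u hu v hv => hQ u (hsub ha hu) v (hsub ha hv)
  intro u hu v hv hQu
  obtain ⟨a, ha, hu⟩ := Set.mem_iUnion₂.1 hu
  obtain ⟨b, hb, hv⟩ := Set.mem_iUnion₂.1 hv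
  obtain ⟨z, hz, hQz⟩ := hT.2 (fun a => ∃ z ∈ β a, Q z) (fun a ha b hb hab ⟨z, hz, hQz⟩ => by
    obtain ⟨p, hp, q, hq, hpq⟩ := ht a b hab
    exact ⟨q, hq, hQ p (hsub ha hp) q (hsub hb hq) hpq (hin ha z hz p hp hQz)⟩) a ha b hb
    ⟨u, hu, hQu⟩
  exact hin hb z hz v hv hQz

/-- A graph with a `K_{2,4}`-minor-free supergraph in the minor order is `K_{2,4}`-minor-free. -/
theorem IsK24MinorFree.of_branchSets {V' : Type*} {H : SimpleGraph V'} {β : V' → Set V}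
    (hf : G.IsK24MinorFree) (hc : ∀ a, G.IsConn (β a))
    (hd : ∀ a b, a ≠ b → Disjoint (β a) (β b))
    (ht : ∀ a b, H.Adj a b → G.Touch (β a) (β b)) : H.IsK24MinorFree := by
  rw [isK24MinorFree_iff] at hf ⊢
  intro P Q S h
  have hdis : ∀ {T T' : Set V'}, Disjoint T T' → Disjoint (⋃ a ∈ T, β a) (⋃ a ∈ T', β a) := by
    intro T T' hTT
    simp only [Set.disjoint_iUnion_left, Set.disjoint_iUnion_right]
    exact fun a ha b hb => hd _ _ fun h => Set.disjoint_left.1 hTT hb (h ▸ ha)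
  have htouch : ∀ {T T' : Set V'}, H.Touch T T' → G.Touch (⋃ a ∈ T, β a) (⋃ a ∈ T', β a) := by
    rintro T T' ⟨a, ha, b, hb, hab⟩
    obtain ⟨p, hp, q, hq, hpq⟩ := ht a b hab
    exact ⟨p, Set.mem_biUnion ha hp, q, Set.mem_biUnion hb hq, hpq⟩
  exact hf (⋃ a ∈ P, β a) (⋃ a ∈ Q, β a) (fun i => ⋃ a ∈ S i, β a)
    ⟨isConn_biUnion hc ht h.conn_left, isConn_biUnion hc ht h.conn_right,
      fun i => isConn_biUnion hc ht (h.conn i), hdis h.disjoint_hubs,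
      fun i => hdis (h.disjoint_left i), fun i => hdis (h.disjoint_right i),
      fun i j hij => hdis (h.disjoint i j hij), fun i => htouch (h.touch_left i),
      fun i => htouch (h.touch_right i)⟩

/-- Each subdividing vertex is contracted into one chosen end of its edge. -/
theorem IsK24MinorFree.of_subdivide {F : Set (Sym2 V)} (h : (G.subdivide F).IsK24MinorFree) :
    G.IsK24MinorFree := by
  let o : F → V := fun e => e.1.out.1
  have ho : ∀ e : F, o e ∈ e.1 := fun e => Sym2.out_fst_mem e.1
  refine h.of_branchSets (β := fun w => {z | z = .inl w ∨ ∃ e, z = .inr e ∧ o e = w}) ?_ ?_ ?_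
  · intro w
    refine ⟨⟨.inl w, .inl rfl⟩, fun Q hQ => ?_⟩
    have key : ∀ z, (z = .inl w ∨ ∃ e, z = .inr e ∧ o e = w) → (Q z ↔ Q (.inl w)) := by
      rintro z (rfl | ⟨e, rfl, rfl⟩)
      · rfl
      · exact ⟨hQ (.inr e) (.inr ⟨e, rfl, rfl⟩) (.inl (o e)) (.inl rfl) (ho e),
          hQ (.inl (o e)) (.inl rfl) (.inr e) (.inr ⟨e, rfl, rfl⟩) (ho e)⟩
    exact fun u hu v hv hQu => (key v hv).2 ((key u hu).1 hQu)
  · intro a b hab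
    refine Set.disjoint_left.2 ?_
    rintro z (rfl | ⟨e, rfl, rfl⟩) (h | ⟨f, h, h'⟩)
    · exact hab (Sum.inl_injective h)
    · cases h
    · cases h
    · obtain rfl := Sum.inr_injective h
      exact hab h'
  · intro a b hab
    by_cases hF : s(a, b) ∈ F
    · have h1 := ho ⟨s(a, b), hF⟩
      rcases Sym2.mem_iff.1 h1 with h2 | h2
      · exact ⟨.inr ⟨s(a, b), hF⟩, .inr ⟨_, rfl, h2⟩, .inl b, .inl rfl, Sym2.mem_mk_right a b⟩
      · exact ⟨.inl a, .inl rfl, .inr ⟨s(a, b), hF⟩, .inr ⟨_, rfl, h2⟩, Sym2.mem_mk_left a b⟩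
    · exact ⟨.inl a, .inl rfl, .inl b, .inl rfl, hab, hF⟩

theorem IsSide.eq_of_mem {W C D : Set V} {x y x' y' v : V} (hC : G.IsSide C x y)
    (hD : G.IsSide D x' y') (hCW : Disjoint C W) (hDW : Disjoint D W) (hx : x ∈ W) (hy : y ∈ W)
    (hx' : x' ∈ W) (hy' : y' ∈ W) (hvC : v ∈ C) (hvD : v ∈ D) : C = D :=
  have hCW := Set.disjoint_left.1 hCW
  have hDW := Set.disjoint_left.1 hDW
  Set.Subset.antisymm
    (hD.2.2.subset_of_isConn hC.2.1 (fun h => hCW h hx') (fun h => hCW h hy') hvC hvD)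
    (hC.2.2.subset_of_isConn hD.2.1 (fun h => hDW h hx) (fun h => hDW h hy) hvD hvC)

theorem eq_of_mem_side (hG : G.IsBlock) {W : Set V} {K : G.virtualEdges W → Set V}
    (hKW : ∀ e, Disjoint (K e) W) (hK : ∀ e, ∀ u v : W, e.1 = s(u, v) → G.IsSide (K e) u v)
    {e f : G.virtualEdges W} {z : V} (he : z ∈ K e) (hf : z ∈ K f) : e = f := by
  obtain ⟨e, h⟩ := e
  obtain ⟨f, h'⟩ := f
  induction e with
  | _ u v =>
  induction f with
  | _ u' v' =>
    have h1 := hK ⟨s(u, v), h⟩ u v rfl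
    have h2 := hK ⟨s(u', v'), h'⟩ u' v' rfl
    have h3 := h1.eq_of_mem h2 (hKW _) (hKW _) u.2 v.2 u'.2 v'.2 he hf
    rw [h3] at h1
    apply Subtype.ext
    change s(u, v) = s(u', v')
    rcases h1.ends_eq hG h2 with ⟨h, h'⟩ | ⟨h, h'⟩
    · rw [Subtype.ext h, Subtype.ext h']
    · rw [Subtype.ext h, Subtype.ext h', Sym2.eq_swap]

/-- The subdivided torso is a minor of `G`: one component for each virtual edge is contracted to the
subdividing vertex. Components chosen for different edges are disjoint, because a component
determines its ends. -/
theorem isSubdividable_virtualEdges (hG : G.IsBlock) (hf : G.IsK24MinorFree) (W : Set V) :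
    (G.torso W).IsSubdividable (G.virtualEdges W) := by
  refine ⟨G.virtualEdges_subset W, ?_⟩
  choose K hKW hK using fun e : G.virtualEdges W => e.2
  refine hf.of_branchSets (β := Sum.elim (fun w => {(w : V)}) K) ?_ ?_ ?_
  · rintro (w | ⟨e, he⟩)
    · exact isConn_singleton _
    · induction e with
      | _ u v => exact (hK ⟨_, he⟩ u v rfl).2.1
  · rintro (w | e) (w' | f) h
    · exact Set.disjoint_singleton.2 fun h' => h (congrArg _ (Subtype.ext h'))
    · exact Set.disjoint_singleton_left.2 fun h' => Set.disjoint_left.1 (hKW f) h' w.2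
    · exact Set.disjoint_singleton_right.2 fun h' => Set.disjoint_left.1 (hKW e) h' w'.2
    · exact Set.disjoint_left.2 fun z hz hz' => h (congrArg _ (eq_of_mem_side hG hKW hK hz hz'))
  · have key : ∀ (w : W) (e : G.virtualEdges W), w ∈ e.1 → G.Touch {(w : V)} (K e) := by
      intro w e hw
      obtain ⟨w', h⟩ := hw
      exact (hK e w w' h).touch_left hG rfl
    rintro (w | e) (w' | f) h
    · refine ⟨w, rfl, w', rfl, h.1.2.resolve_right ?_⟩
      rintro ⟨C, hd, hC⟩
      exact h.2 (mem_virtualEdges hd hC)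
    · exact key w f h
    · exact (key w' e h).symm
    · exact h.elim

theorem IsSkeleton.isPathOuterplanarReplacement [Finite V] (hG : G.IsBlock) {W : Set V}
    (hW : G.IsSkeleton W) (hcard : 3 ≤ W.ncard)
    (h3 : ∀ x y A B C, G.IsSide A x y → G.IsSide B x y → G.IsSide C x y → Disjoint A B →
      Disjoint A C → Disjoint B C → False) :
    G.IsPathOuterplanarReplacement (G.torso W) (G.virtualEdges W) := by
  choose K hKW hK using fun e : G.virtualEdges W => e.2
  have hends : ∀ (x y : W) (h : s(x, y) ∈ G.virtualEdges W),
      K ⟨s(x, y), h⟩ ∪ {v | ∃ w : W, w ∈ s(x, y) ∧ w = v} = withEnds (K ⟨s(x, y), h⟩) x y := by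
    intro x y h
    congr 1
    ext v
    constructor
    · rintro ⟨w, hw, rfl⟩
      rcases Sym2.mem_iff.1 hw with rfl | rfl <;> simp
    · rintro (rfl | rfl)
      exacts [⟨x, Sym2.mem_mk_left _ _, rfl⟩, ⟨y, Sym2.mem_mk_right _ _, rfl⟩]
  -- A virtual edge comes from only one component: two of them, and the side through a third vertex
  -- of `W`, would be three sides at `x` and `y`.
  have huniq : ∀ {C : Set V} {x y : W} (hd : Disjoint C W) (hC : G.IsSide C x y),
      K ⟨s(x, y), mem_virtualEdges hd hC⟩ = C := by
    intro C x y hd hC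
    have hC' := hK ⟨s(x, y), mem_virtualEdges hd hC⟩ x y rfl
    refine (hC'.eq_or_disjoint hC).resolve_right fun hdis => ?_
    obtain ⟨c, hc, hcxy⟩ : ∃ c ∈ W, c ∉ ({(x : V), (y : V)} : Set V) := by
      refine Set.exists_mem_notMem_of_ncard_lt_ncard ?_
      rw [Set.ncard_pair hC.1]
      omega
    simp only [Set.mem_insert_iff, Set.mem_singleton_iff, not_or] at hcxy
    obtain ⟨E, hcE, hE⟩ := G.exists_isSide hC.1 hcxy.1 hcxy.2
    have : ∀ {D}, Disjoint D W → G.IsSide D x y → Disjoint D E := fun hDW hD =>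
      (hD.eq_or_disjoint hE).resolve_left fun h => Set.disjoint_left.1 hDW (h ▸ hcE) hc
    exact h3 x y _ C E hC' hC hE hdis (this (hKW _) hC') (this hd hC)
  have hout : ∀ v, v ∉ W → ∃ e, v ∈ K e := by
    intro v hv
    obtain ⟨C, hvC, hd, x, hx, y, hy, hC⟩ := hW.exists_isSide hv
    have := huniq (x := ⟨x, hx⟩) (y := ⟨y, hy⟩) hd hC
    exact ⟨_, this ▸ hvC⟩
  have hnbr : ∀ e, ∀ u ∈ K e, ∀ v, G.Adj u v → v ∈ K e ∪ {v | ∃ w : W, w ∈ e.1 ∧ w = v} := by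
    rintro ⟨e, he⟩ u hu v huv
    induction e with
    | _ x y =>
      change v ∈ K ⟨s(x, y), he⟩ ∪ {v | ∃ w : W, w ∈ s(x, y) ∧ w = v}
      rw [hends]
      exact mem_withEnds.2 ((hK ⟨s(x, y), he⟩ x y rfl).2.2.2.2 u hu v huv)
  -- Describing the ends as the members of `e` avoids ordering the unordered pair. Being induced,
  -- the inserted graph keeps an edge of `G` between the ends, which `deleteEdges` removes from the
  -- torso.
  refine ⟨fun e => (⊤ : G.Subgraph).induce (K e ∪ {v | ∃ w : W, w ∈ e.1 ∧ w = v}), ?_, ?_, ?_, ?_⟩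
  · intro x y h
    dsimp only
    rw [hends x y h]
    have hC := hK ⟨s(x, y), h⟩ x y rfl
    refine ⟨hC.isPathOuterplanar hG (hW.not_hasRootedK22 hG hC (hKW _) x.2 y.2), ?_⟩
    rw [Subgraph.induce_verts, withEnds, Set.union_inter_distrib_right, (hKW _).inter_eq,
      Set.empty_union, Set.inter_eq_left]
    rintro v (rfl | rfl)
    exacts [x.2, y.2]
  · rintro e f hef v ⟨he | ⟨w, -, rfl⟩, hf | ⟨w', -, hw'⟩⟩
    · exact absurd (eq_of_mem_side hG hKW hK he hf) hef
    · subst hw'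
      exact w'.2
    · exact w.2
    · exact w.2
  · refine Set.eq_univ_of_forall fun v => ?_
    by_cases hv : v ∈ W
    · exact .inl hv
    · obtain ⟨e, he⟩ := hout v hv
      exact .inr (Set.mem_iUnion.2 ⟨e, .inl he⟩)
  · ext u v
    simp only [sup_adj, iSup_adj, Subgraph.spanningCoe_adj, Subgraph.induce_adj, Subgraph.top_adj,
      map_adj, Function.Embedding.subtype_apply, deleteEdges_adj]
    constructor
    · intro huv
      by_cases hu : u ∈ W
      · by_cases hv : v ∈ W
        · by_cases hF : s((⟨u, hu⟩ : W), ⟨v, hv⟩) ∈ G.virtualEdges W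
          · exact .inr ⟨⟨_, hF⟩, .inr ⟨_, Sym2.mem_mk_left _ _, rfl⟩,
              .inr ⟨_, Sym2.mem_mk_right _ _, rfl⟩, huv⟩
          · exact .inl ⟨⟨u, hu⟩, ⟨v, hv⟩, ⟨⟨fun h => huv.ne (congrArg Subtype.val h), .inl huv⟩, hF⟩,
              rfl, rfl⟩
        · obtain ⟨e, he⟩ := hout v hv
          exact .inr ⟨e, hnbr e v he u huv.symm, .inl he, huv⟩
      · obtain ⟨e, he⟩ := hout u hu
        exact .inr ⟨e, .inl he, hnbr e u he v huv, huv⟩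
    · rintro (⟨a, b, ⟨hab, hF⟩, rfl, rfl⟩ | ⟨e, -, -, h⟩)
      · refine hab.2.resolve_right ?_
        rintro ⟨C, hd, hC⟩
        exact hF (mem_virtualEdges hd hC)
      · exact h

/-! ### The structure theorem -/

/-- A `K_{2,4}`-minor-free block is of one of the three kinds. -/
theorem IsBlock.structure_of_isK24MinorFree [Finite V] (hG : G.IsBlock) (hf : G.IsK24MinorFree) :
    G.IsOuterplanar ∨ G.IsTriplePathOuterplanarUnion ∨
      ∃ (W : Set V) (G₀ : SimpleGraph W) (F : Set (Sym2 W)),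
        G₀.IsVertexConnected 3 ∧ G₀.IsK24MinorFree ∧ G₀.IsSubdividable F ∧
        G.IsPathOuterplanarReplacement G₀ F := by
  by_cases hT : G.IsTriplePathOuterplanarUnion
  · exact .inr (.inl hT)
  have h3 : ∀ x y A B C, G.IsSide A x y → G.IsSide B x y → G.IsSide C x y → Disjoint A B →
      Disjoint A C → Disjoint B C → False := by
    intro x y A B C hA hB hC hAB hAC hBC
    refine hT (isTriplePathOuterplanarUnion_of_three_sides hG hf (x := x) (y := y)
      (C := ![A, B, C]) ?_ ?_)
    · intro i
      fin_cases i
      exacts [hA, hB, hC]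
    · intro i j hij
      fin_cases i <;> fin_cases j
      exacts [absurd rfl hij, hAB, hAC, hAB.symm, absurd rfl hij, hBC, hAC.symm, hBC.symm,
        absurd rfl hij]
  by_cases hV : Nat.card V < 2
  · have : Subsingleton V := Finite.card_le_one_iff_subsingleton.1 (by omega)
    refine .inl (isOuterplanar_of_isNoncrossing (f := fun _ => 0)
      (Function.injective_of_subsingleton _) ?_)
    intro a b c d hab
    simp at hab
  -- The whole vertex set is a skeleton, since it leaves no components. A smallest skeleton with at
  -- least two vertices is chosen; its size decides between (i) and (iii).
  have hex : ∃ n W, Set.ncard W = n ∧ 2 ≤ W.ncard ∧ G.IsSkeleton W :=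
    ⟨_, Set.univ, rfl, by rw [Set.ncard_univ]; omega, G.isSkeleton_univ⟩
  classical
  obtain ⟨W, hn, h2, hW⟩ := Nat.find_spec hex
  have hmin : ∀ W' : Set V, 2 ≤ W'.ncard → G.IsSkeleton W' → W.ncard ≤ W'.ncard :=
    fun W' h hW' => hn ▸ Nat.find_min' hex ⟨W', rfl, h, hW'⟩
  have hM : ∀ s t E, G.IsSide E s t → s ∈ W → t ∈ W →
      ¬ G.HasRootedK22 (withEnds E s t) s t → Disjoint E W := fun s t E hE hs ht hr =>
    hW.disjoint_of_minimal hG hmin hE hs ht hr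
  by_cases h4 : 4 ≤ W.ncard
  · have hsub := isSubdividable_virtualEdges hG hf W
    exact .inr (.inr ⟨W, G.torso W, G.virtualEdges W, hW.torso_isVertexConnected hG hf h4 hM,
      hsub.2.of_subdivide, hsub, hW.isPathOuterplanarReplacement hG (by omega) h3⟩)
  have hcases : W.ncard = 2 ∨ W.ncard = 3 := by omega
  rcases hcases with hc | hc
  · obtain ⟨s, t, hst, rfl⟩ := Set.ncard_eq_two.1 hc
    refine .inl (isOuterplanar_of_not_hasRootedK22 hG hst (fun C hC => ?_) (h3 s t))
    refine hW.not_hasRootedK22 hG hC (Set.disjoint_left.2 ?_) (by simp) (by simp)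
    rintro v hv (rfl | rfl)
    exacts [hC.2.2.1 hv, hC.2.2.2.1 hv]
  · obtain ⟨a, b, c, hab, hac, hbc, rfl⟩ := Set.ncard_eq_three.1 hc
    exact (hW.not_three hG hab hac hbc hM h3).elim

end SimpleGraph

theorem theorem3p5 {V : Type*} [Finite V] (G : SimpleGraph V) (hG : G.IsBlock) :
    G.IsK24MinorFree ↔
      G.IsOuterplanar ∨
      G.IsTriplePathOuterplanarUnion ∨
      ∃ (W : Set V) (G₀ : SimpleGraph W) (F : Set (Sym2 W)),
        G₀.IsVertexConnected 3 ∧ G₀.IsK24MinorFree ∧ G₀.IsSubdividable F ∧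
        G.IsPathOuterplanarReplacement G₀ F := by
  refine ⟨hG.structure_of_isK24MinorFree, ?_⟩
  rintro (h | h | ⟨W, G₀, F, -, -, hF, h⟩)
  exacts [h.isK24MinorFree, h.isK24MinorFree, h.isK24MinorFree hF]
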